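/- **Theorem (Gagliardo–Nirenberg interpolation for sections).** Let $(M,g)$ be a closed (compact, without boundary) smooth Riemannian manifold of dimension $m$ with Levi-Civita connection $\nabla$ and Riemannian volume measure $dM$, and let $(E,h,D)$ be a smooth real vector bundle of finite rank over $M$ with a smooth bundle metric $h$ and a smooth connection $D$ such that $Dh=0$ (no restriction on the rank, and $E$ need not be orientable). For a smooth section $T$ of $E$ let $D^iT\in\Gamma(T^*M^{\otimes i}\otimes E)$ be its $i$-th covariant derivative, formed with the connection on $T^*M^{\otimes (i-1)}\otimes E$ induced by $\nabla$ and $D$, let $|D^iT|$ be its pointwise norm induced by $g$ and $h$, and let $\|D^iT\|_p=\big(\int_M|D^iT|^p\,dM\big)^{1/p}$ for $0<p<\infty$ and $\|D^iT\|_\infty=\sup_M|D^iT|$. Let $j,k$ be integers with $1\le j\le k$. (a) For every real $s>0$ there is a constant $C=C(m,s,k,j)$, independent of $(M,g)$, $(E,h,D)$, $T$ and $l$, such that $$\|D^jT\|_{\frac{2s}{l}}\le C\,\|D^kT\|_{\frac{2s}{l+k-j}}^{\frac jk}\,\|T\|_{\frac{2s}{l-j}}^{1-\frac jk}$$ for every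 integer $l\in[1,s]\cap[j,\,s+j+1-k]$, where $\frac{2s}{l-j}$ means $\infty$ if $l=j$. (b) For all $r,q\in[2,\infty]$ there is a constant $C=C(m,r,q,j,k)$, independent of $(M,g)$, $(E,h,D)$ and $T$, such that $$\|D^jT\|_p\le C\,\|D^kT\|_r^{\frac jk}\,\|T\|_q^{1-\frac jk},\qquad\text{where}\qquad \frac kp=\frac jr+\frac{k-j}q$$ (with $1/\infty=0$). A factor with exponent $0$ is read as $1$. -/

import Mathlib

open Bundle MeasureTheory
open scoped Manifold ContDiff ENNReal NNReal

noncomputable section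

section RiemannianVolume

variable (m : ℕ) (M : Type*) [TopologicalSpace M] [ChartedSpace (EuclideanSpace ℝ (Fin m)) M]
  [RiemannianBundle (fun x : M => TangentSpace (𝓡 m) x)]

variable {m M} in
/-- The metric coefficients `g_{ij} = g(∂/∂x^i, ∂/∂x^j)` in the preferred chart `φ` around `x₀`, at
the point of coordinates `z`; here `∂/∂x^i` is the image of the `i`-th basis vector under the
derivative of `φ⁻¹` at `z`. -/
def metricCoeff (x₀ : M) (z : EuclideanSpace ℝ (Fin m)) : Matrix (Fin m) (Fin m) ℝ :=
  letI : ChartedSpace (EuclideanSpace ℝ (Fin m)) (EuclideanSpace ℝ (Fin m)) := chartedSpaceSelf _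
  Matrix.gram ℝ fun i : Fin m =>
    (mfderiv 𝓘(ℝ, EuclideanSpace ℝ (Fin m)) (𝓡 m) (extChartAt (𝓡 m) x₀).symm z
      (EuclideanSpace.single i (1 : ℝ)) : TangentSpace (𝓡 m) ((extChartAt (𝓡 m) x₀).symm z))

variable {m M} in
/-- The measure `√(det g_{ij}) dx¹ ⋯ dxᵐ` of the preferred chart around `x₀`, seen as a measure on
`M` carried by the domain of that chart. -/
def chartVolume [MeasurableSpace M] (x₀ : M) : Measure M :=
  (((volume : Measure (EuclideanSpace ℝ (Fin m))).restrict
      (extChartAt (𝓡 m) x₀).target).withDensity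
    fun z => ENNReal.ofReal (Real.sqrt (metricCoeff x₀ z).det)).map (extChartAt (𝓡 m) x₀).symm

/-- The Riemannian volume measure `dM`. By the change of variables formula the chart measures agree
on overlaps; on a manifold covered by countably many charts, their supremum in the complete
lattice of measures is the unique measure which restricts to `√(det g_{ij}) dx¹ ⋯ dxᵐ` on the
domain of each chart. -/
def riemannianVolume [MeasurableSpace M] : Measure M :=
  ⨆ x₀ : M, chartVolume (m := m) x₀

end RiemannianVolume

section LeviCivita

variable {m : ℕ} {M : Type*} [TopologicalSpace M] [ChartedSpace (EuclideanSpace ℝ (Fin m)) M]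
  [IsManifold (𝓡 m) ∞ M]
  [RiemannianBundle (fun x : M => TangentSpace (𝓡 m) x)]
  [IsContMDiffRiemannianBundle (𝓡 m) ∞ (EuclideanSpace ℝ (Fin m))
    (fun x : M => TangentSpace (𝓡 m) x)]

instance instIsContMDiffRiemannianBundleOneTangent :
    IsContMDiffRiemannianBundle (𝓡 m) 1 (EuclideanSpace ℝ (Fin m))
      (fun x : M => TangentSpace (𝓡 m) x) :=
  IsContMDiffRiemannianBundle.of_le (n := ∞) (by simp)

/-- A connection on the tangent bundle is the Levi-Civita connection of the metric if it is
compatible with the metric and torsion free. -/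
structure IsLeviCivita (nabla : CovariantDerivative (𝓡 m) (EuclideanSpace ℝ (Fin m))
    (fun x : M => TangentSpace (𝓡 m) x)) : Prop where
  isMetricCompatible : nabla.IsMetricCompatible
  torsion_eq_zero : nabla.torsion = 0

end LeviCivita

section CovariantDerivatives

variable {m : ℕ} {M : Type*} [TopologicalSpace M] [ChartedSpace (EuclideanSpace ℝ (Fin m)) M]
  [IsManifold (𝓡 m) ∞ M]
  [RiemannianBundle (fun x : M => TangentSpace (𝓡 m) x)]
  {F : Type*} [NormedAddCommGroup F] [NormedSpace ℝ F]
  {V : M → Type*} [TopologicalSpace (TotalSpace F V)]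
  [∀ x, NormedAddCommGroup (V x)] [∀ x, InnerProductSpace ℝ (V x)]
  [FiberBundle F V]

/-- The covariant derivative of a section `S` of `T*M^{⊗k} ⊗ V`, for the connection induced by
`nabla` on `TM` and by `D` on `V`:
`(DS)(v₁, …, v_k, w) = D_w (S(X₁, …, X_k)) - ∑ᵢ S(v₁, …, ∇_w Xᵢ, …, v_k)`,
where `X₁, …, X_k` are vector fields that are smooth near `x` with `Xᵢ(x) = vᵢ`. The
differentiation slot is the last one. -/
def tensorCovDeriv
    (nabla : CovariantDerivative (𝓡 m) (EuclideanSpace ℝ (Fin m))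
      (fun x : M => TangentSpace (𝓡 m) x))
    (D : CovariantDerivative (𝓡 m) F V) {k : ℕ}
    (S : Π x : M, (Fin k → TangentSpace (𝓡 m) x) → V x) :
    Π x : M, (Fin (k + 1) → TangentSpace (𝓡 m) x) → V x :=
  fun x v =>
    let X : Fin k → Π y : M, TangentSpace (𝓡 m) y := fun i =>
      FiberBundle.extend (EuclideanSpace ℝ (Fin m)) (v i.castSucc)
    let w : TangentSpace (𝓡 m) x := v (Fin.last k)
    D (fun y => S y fun i => X i y) x w
      - ∑ i : Fin k, S x (Function.update (fun a => v a.castSucc) i (nabla (X i) x w))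

/-- The iterated covariant derivative `D^k T`, a section of `T*M^{⊗k} ⊗ V`. -/
def iterCovDeriv
    (nabla : CovariantDerivative (𝓡 m) (EuclideanSpace ℝ (Fin m))
      (fun x : M => TangentSpace (𝓡 m) x))
    (D : CovariantDerivative (𝓡 m) F V) (T : Π x : M, V x) :
    (k : ℕ) → Π x : M, (Fin k → TangentSpace (𝓡 m) x) → V x
  | 0 => fun x _ => T x
  | k + 1 => tensorCovDeriv nabla D (iterCovDeriv nabla D T k)

instance instFiniteDimensionalTangentSpaceEuclidean (x : M) :
    FiniteDimensional ℝ (TangentSpace (𝓡 m) x) :=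
  inferInstanceAs (FiniteDimensional ℝ (EuclideanSpace ℝ (Fin m)))

/-- The pointwise norm of `S ∈ T_x*M^{⊗k} ⊗ V_x` induced by the two metrics:
`|S|² = ∑ |S(e_{i₁}, …, e_{i_k})|²` for an orthonormal basis `(e_i)` of `T_xM`. -/
def tensorNorm {k : ℕ} (x : M) (S : (Fin k → TangentSpace (𝓡 m) x) → V x) : ℝ :=
  Real.sqrt (∑ i : Fin k → Fin (Module.finrank ℝ (TangentSpace (𝓡 m) x)),
    ‖S fun a => stdOrthonormalBasis ℝ (TangentSpace (𝓡 m) x) (i a)‖ ^ 2)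

/-- The norm `‖D^k T‖_p` with respect to the Riemannian volume, for `0 < p ≤ ∞`; for `p = ∞` it is
the essential supremum of `|D^k T|`. -/
def covDerivLpNorm [MeasurableSpace M]
    (nabla : CovariantDerivative (𝓡 m) (EuclideanSpace ℝ (Fin m))
      (fun x : M => TangentSpace (𝓡 m) x))
    (D : CovariantDerivative (𝓡 m) F V) (T : Π x : M, V x) (k : ℕ) (p : ℝ≥0∞) : ℝ≥0∞ :=
  eLpNorm (fun x : M => tensorNorm x (iterCovDeriv nabla D T k x)) p (riemannianVolume m M)

end CovariantDerivatives

end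

/-! Everything reduces to a one-step inequality for a smooth tensor field S with values in the
bundle: if p ≥ 2 and 2/p = 1/q + 1/r, then ‖DS‖_p² ≤ K ‖S‖_q ‖D²S‖_r, where K depends only on m, p
and the order of S. Derivatives are never commuted, so no curvature enters, and no embedding theorem
is used; this is why K does not see the geometry.

For finite p, consider the vector field dual to w ↦ |DS|^(p-2) ⟨S, D_w S⟩. Its divergence is |DS|^p
plus terms bounded by (√m + p - 2) |S| |D²S| |DS|^(p-2). The divergence integrates to zero and
Hölder's inequality finishes (`eLpNorm_tensorCovDeriv_sq_le`). The weight is first regularised to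
(|DS|² + ε)^((p-2)/2), to be smooth at the zeros of DS. The two tools are the product rule for the
metric on tensors (`mvfderiv_tensorInner`) and the divergence theorem
(`integral_divergence_eq_zero`). The latter rests on the chart formula ρ div Y = ∑ ∂_k(ρ Y^k) with ρ
= √det g, and on a partition of unity.

For p = ∞ also q = r = ∞, and integration is replaced by a maximum argument in the spirit of
Landau's inequality |f'|² ≤ 4 sup|f| sup|f''|. One maximises ⟨DS(u), ξ⟩² + λ⟨S(u'), ξ⟩ over unit
vectors, where u' omits the last entry of u. Differentiating at the maximum in the direction of that
last entry, along unit extensions that are parallel to first order, forces ⟨DS(u), ξ⟩ = 0 as soon as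
λ > 2 sup|D²S| (`inner_eq_zero_of_max`). Comparison with the maximum bounds the first term
everywhere (`sq_inner_tensorCovDeriv_le`).

Finally, take exponents p_i whose inverses form an arithmetic progression. The step inequality for S
= D^i T says that i ↦ ‖D^i T‖_{p_i} is logarithmically convex up to the factor K, and log-convexity
between 0 and k is the theorem (`le_mul_rpow_mul_rpow_of_sq_le`). Parts (a) and (b) differ only in
the progression. -/

set_option linter.unusedSectionVars false

noncomputable section

open Filter Topology

/-! ### Cut-offs and smooth orthonormal frames. -/

section LocalSections

variable {m : ℕ} {M : Type*} [TopologicalSpace M] [ChartedSpace (EuclideanSpace ℝ (Fin m)) M]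
  [IsManifold (𝓡 m) ∞ M]
  {F : Type*} [NormedAddCommGroup F] [NormedSpace ℝ F]
  {V : M → Type*} [TopologicalSpace (TotalSpace F V)]
  [∀ x, NormedAddCommGroup (V x)] [∀ x, InnerProductSpace ℝ (V x)]
  [FiberBundle F V] [VectorBundle ℝ F V]

variable (m F) in
/-- Smoothness of a section of a vector bundle. -/
abbrev SmoothSection (σ : Π x : M, V x) : Prop :=
  ContMDiff (𝓡 m) ((𝓡 m).prod 𝓘(ℝ, F)) ∞ fun x => TotalSpace.mk' F x (σ x)

variable (m F) in
/-- Smoothness of a section of a vector bundle on a set. -/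
abbrev SmoothSectionOn (σ : Π x : M, V x) (u : Set M) : Prop :=
  ContMDiffOn (𝓡 m) ((𝓡 m).prod 𝓘(ℝ, F)) ∞ (fun x => TotalSpace.mk' F x (σ x)) u

variable (m F) in
/-- Differentiability of a section of a vector bundle at a point. -/
abbrev DiffSectionAt (σ : Π x : M, V x) (x₀ : M) : Prop :=
  MDifferentiableAt (𝓡 m) ((𝓡 m).prod 𝓘(ℝ, F)) (fun x => TotalSpace.mk' F x (σ x)) x₀

/-- A section which is smooth near a point coincides near that point with a global smooth one. -/
theorem exists_contMDiff_section_eventuallyEq [T2Space M] {σ : Π x : M, V x} {u : Set M} {x₀ : M}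
    (hu : u ∈ 𝓝 x₀) (hσ : SmoothSectionOn m F σ u) :
    ∃ σ' : Π x : M, V x, SmoothSection m F σ' ∧ ∀ᶠ x in 𝓝 x₀, σ' x = σ x := by
  obtain ⟨f, -, hf⟩ := (SmoothBumpFunction.nhds_basis_tsupport (I := 𝓡 m) x₀).mem_iff.1
    (interior_mem_nhds.2 hu)
  refine ⟨(f : M → ℝ) • σ, ?_, ?_⟩
  · exact ContMDiffOn.smul_section_of_tsupport f.contMDiff.contMDiffOn isOpen_interior hf
      (hσ.mono interior_subset)
  · filter_upwards [f.eventuallyEq_one] with x hx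
    simp [hx]

/-- Strong induction along the Gram–Schmidt recursion. Linear independence keeps the earlier vectors
nonzero, so the projection coefficients are smooth quotients. -/
theorem contMDiffOn_gramSchmidt [IsContMDiffRiemannianBundle (𝓡 m) ∞ F V] {n : ℕ}
    {s : Fin n → Π x : M, V x} {u : Set M} (hs : ∀ i, SmoothSectionOn m F (s i) u)
    (hli : ∀ x ∈ u, LinearIndependent ℝ (s · x)) (i : Fin n) :
    SmoothSectionOn m F (fun x => InnerProductSpace.gramSchmidt ℝ (s · x) i) u := by
  induction i using WellFoundedLT.induction with
  | _ i ih =>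
    have hG : ∀ j < i, ∀ x ∈ u, InnerProductSpace.gramSchmidt ℝ (s · x) j ≠ 0 := fun j _ x hx =>
      InnerProductSpace.gramSchmidt_ne_zero j (hli x hx)
    have hsum : SmoothSectionOn m F (fun x => ∑ j ∈ Finset.Iio i,
        ((inner ℝ (InnerProductSpace.gramSchmidt ℝ (s · x) j) (s i x) /
          inner ℝ (InnerProductSpace.gramSchmidt ℝ (s · x) j)
            (InnerProductSpace.gramSchmidt ℝ (s · x) j) : ℝ) •
            InnerProductSpace.gramSchmidt ℝ (s · x) j)) u := by
      refine ContMDiffOn.sum_section fun j hj => ?_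
      have hj' := Finset.mem_Iio.1 hj
      refine ContMDiffOn.smul_section (f := fun x =>
        (inner ℝ (InnerProductSpace.gramSchmidt ℝ (s · x) j) (s i x) /
          inner ℝ (InnerProductSpace.gramSchmidt ℝ (s · x) j)
            (InnerProductSpace.gramSchmidt ℝ (s · x) j) : ℝ)) ?_ (ih j hj')
      refine ContMDiffOn.div₀ ((ih j hj').inner_bundle (hs i)) 
        ((ih j hj').inner_bundle (ih j hj')) fun x hx => ?_
      simpa using hG j hj' x hx
    refine ((hs i).sub_section hsum).congr fun x hx => ?_
    have := InnerProductSpace.gramSchmidt_def'' ℝ (s · x) i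
    simp only [Pi.sub_apply]
    congr 1
    refine eq_sub_of_add_eq ?_
    conv_rhs => rw [this]
    simp

/-- A Riemannian vector bundle has, near every point, an orthonormal frame consisting of global
smooth sections. -/
theorem exists_orthonormal_sections [T2Space M] [IsContMDiffRiemannianBundle (𝓡 m) ∞ F V]
    [ContMDiffVectorBundle ∞ F V (𝓡 m)] {n : ℕ} (b : Module.Basis (Fin n) ℝ F) (x₀ : M) :
    ∃ E : Fin n → Π x : M, V x, (∀ i, SmoothSection m F (E i)) ∧
      ∀ᶠ x in 𝓝 x₀, Orthonormal ℝ (E · x) := by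
  set e := trivializationAt F V x₀
  have hu : e.baseSet ∈ 𝓝 x₀ :=
    e.open_baseSet.mem_nhds (FiberBundle.mem_baseSet_trivializationAt' x₀)
  have hfr := e.isLocalFrameOn_localFrame_baseSet (𝓡 m) ∞ b
  have hli : ∀ x ∈ e.baseSet, LinearIndependent ℝ (e.localFrame b · x) :=
    fun x hx => hfr.linearIndependent hx
  have hG := contMDiffOn_gramSchmidt hfr.contMDiffOn hli
  have hN : ∀ i, SmoothSectionOn m F
      (fun x => InnerProductSpace.gramSchmidtNormed ℝ (e.localFrame b · x) i) e.baseSet := by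
    intro i
    refine ContMDiffOn.smul_section
      (f := fun x => ‖InnerProductSpace.gramSchmidt ℝ (e.localFrame b · x) i‖⁻¹) ?_ (hG i)
    have h2 : ContMDiffOn (𝓡 m) 𝓘(ℝ) ∞ (fun x => (inner ℝ
        (InnerProductSpace.gramSchmidt ℝ (e.localFrame b · x) i)
        (InnerProductSpace.gramSchmidt ℝ (e.localFrame b · x) i) : ℝ)) e.baseSet :=
            (hG i).inner_bundle (hG i)
    have hne : ∀ x ∈ e.baseSet, InnerProductSpace.gramSchmidt ℝ (e.localFrame b · x) i ≠ 0 :=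
      fun x hx => InnerProductSpace.gramSchmidt_ne_zero i (hli x hx)
    intro x hx
    -- The inverse norm is smooth because it is t ↦ 1/√t applied to a smooth, nowhere vanishing
    -- squared norm.
    have h3 : ContDiffAt ℝ ∞ (fun t : ℝ => (Real.sqrt t)⁻¹) (inner ℝ
        (InnerProductSpace.gramSchmidt ℝ (e.localFrame b · x) i)
        (InnerProductSpace.gramSchmidt ℝ (e.localFrame b · x) i)) := by
      have hpos : inner ℝ
        (InnerProductSpace.gramSchmidt ℝ (e.localFrame b · x) i)
        (InnerProductSpace.gramSchmidt ℝ (e.localFrame b · x) i) ≠ 0 := by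
          simpa using hne x hx
      refine (Real.contDiffAt_sqrt hpos).inv ?_
      rw [← norm_eq_sqrt_real_inner]
      simpa using hne x hx
    refine (h3.contMDiffAt.comp_contMDiffWithinAt x (h2 x hx)).congr (fun y _ => ?_) ?_ <;>
    exact congrArg (·⁻¹) (norm_eq_sqrt_real_inner _)
  choose E hE hEe using fun i => exists_contMDiff_section_eventuallyEq hu (hN i)
  refine ⟨E, hE, ?_⟩
  filter_upwards [eventually_all.2 hEe, hu] with x hx hxu
  have : (E · x) = InnerProductSpace.gramSchmidtNormed ℝ (e.localFrame b · x) := funext hx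
  rw [this]
  exact InnerProductSpace.gramSchmidtNormed_orthonormal (hli x hxu)

end LocalSections

section OrthonormalFrames

variable {m : ℕ} {M : Type*} [TopologicalSpace M] [ChartedSpace (EuclideanSpace ℝ (Fin m)) M]
  [IsManifold (𝓡 m) ∞ M] [T2Space M]
  {F : Type*} [NormedAddCommGroup F] [NormedSpace ℝ F]
  {V : M → Type*} [TopologicalSpace (TotalSpace F V)]
  [∀ x, NormedAddCommGroup (V x)] [∀ x, InnerProductSpace ℝ (V x)]
  [FiberBundle F V] [VectorBundle ℝ F V]
  [IsContMDiffRiemannianBundle (𝓡 m) ∞ F V] [ContMDiffVectorBundle ∞ F V (𝓡 m)]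

/-- The rank equals the dimension of the model fibre, so an orthonormal family of that size spans.
-/
theorem exists_orthonormalBasis_sections {n : ℕ} (b : Module.Basis (Fin n) ℝ F) (x₀ : M) :
    ∃ E : Fin n → Π x : M, V x, (∀ i, SmoothSection m F (E i)) ∧
      ∀ᶠ x in 𝓝 x₀, ∃ e : OrthonormalBasis (Fin n) ℝ (V x), ∀ i, e i = E i x := by
  obtain ⟨E, hE, hon⟩ := exists_orthonormal_sections (m := m) (V := V) b x₀
  refine ⟨E, hE, hon.mono fun x hx => ?_⟩
  have hfin : Module.finrank ℝ (V x) = n := by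
    rw [(VectorBundle.continuousLinearEquivAt ℝ F V x).toLinearEquiv.finrank_eq,
      Module.finrank_eq_card_basis b, Fintype.card_fin]
  have hsp : ⊤ ≤ Submodule.span ℝ (Set.range (E · x)) := by
    have := b.finiteDimensional_of_finite
    have : FiniteDimensional ℝ (V x) := VectorBundle.finiteDimensional ℝ F V x
    exact (hx.linearIndependent.span_eq_top_of_card_eq_finrank' (by simp [hfin])).ge
  exact ⟨OrthonormalBasis.mk hx hsp, fun i => by simp⟩

end OrthonormalFrames

/-! ### Smooth tensor fields. -/

section SmoothTensors

variable {m : ℕ} {M : Type*} [TopologicalSpace M] [ChartedSpace (EuclideanSpace ℝ (Fin m)) M]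
  [IsManifold (𝓡 m) ∞ M]
  [RiemannianBundle (fun x : M => TangentSpace (𝓡 m) x)]
  {F : Type*} [NormedAddCommGroup F] [NormedSpace ℝ F]
  {V : M → Type*} [TopologicalSpace (TotalSpace F V)]
  [∀ x, NormedAddCommGroup (V x)] [∀ x, InnerProductSpace ℝ (V x)]
  [FiberBundle F V]

variable (F) in
/-- A smooth section `S` of `T*M^{⊗k} ⊗ V`, seen as a family of multilinear maps. -/
structure IsSmoothTensor {k : ℕ} (S : Π x : M, (Fin k → TangentSpace (𝓡 m) x) → V x) : Prop where
  update_add : ∀ (x : M) (v : Fin k → TangentSpace (𝓡 m) x) (i : Fin k)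
    (a b : TangentSpace (𝓡 m) x), S x (Function.update v i (a + b)) =
      S x (Function.update v i a) + S x (Function.update v i b)
  update_smul : ∀ (x : M) (v : Fin k → TangentSpace (𝓡 m) x) (i : Fin k)
    (c : ℝ) (a : TangentSpace (𝓡 m) x), S x (Function.update v i (c • a)) =
      c • S x (Function.update v i a)
  smooth : ∀ X : Fin k → Π x : M, TangentSpace (𝓡 m) x,
    (∀ i, SmoothSection m (EuclideanSpace ℝ (Fin m)) (X i)) →
      SmoothSection m F fun x => S x fun i => X i x

variable (m) in
theorem exists_orthonormalBasis_vectorFields [T2Space M]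
    [IsContMDiffRiemannianBundle (𝓡 m) ∞ (EuclideanSpace ℝ (Fin m))
      (fun x : M => TangentSpace (𝓡 m) x)] (x₀ : M) :
    ∃ E : Fin m → Π x : M, TangentSpace (𝓡 m) x,
      (∀ i, SmoothSection m (EuclideanSpace ℝ (Fin m)) (E i)) ∧
      ∀ᶠ x in 𝓝 x₀, ∃ e : OrthonormalBasis (Fin m) ℝ (TangentSpace (𝓡 m) x),
        ∀ i, e i = E i x :=
  exists_orthonormalBasis_sections (EuclideanSpace.basisFun (Fin m) ℝ).toBasis x₀

namespace IsSmoothTensor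

variable {k : ℕ} {S : Π x : M, (Fin k → TangentSpace (𝓡 m) x) → V x}

/-- The value of a smooth tensor at a point, as a multilinear map. -/
def toMultilinearMap (hS : IsSmoothTensor F S) (x : M) :
    MultilinearMap ℝ (fun _ : Fin k => TangentSpace (𝓡 m) x) (V x) where
  toFun := S x
  map_update_add' v i a b := by
    -- Only the decidability instances inside `Function.update` may differ.
    convert hS.update_add x v i a b
  map_update_smul' v i c a := by
    convert hS.update_smul x v i c a

theorem toMultilinearMap_apply (hS : IsSmoothTensor F S) (x : M)
    (v : Fin k → TangentSpace (𝓡 m) x) : hS.toMultilinearMap x v = S x v := rfl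

theorem apply_sum (hS : IsSmoothTensor F S) (x : M) {n : ℕ}
    (c : Fin k → Fin n → ℝ) (e : Fin n → TangentSpace (𝓡 m) x) :
    S x (fun i => ∑ a, c i a • e a) =
      ∑ r : Fin k → Fin n, (∏ i, c i (r i)) • S x fun i => e (r i) := by
  have := (hS.toMultilinearMap x).map_sum (fun i (a : Fin n) => c i a • e a)
  simp only [toMultilinearMap_apply] at this
  rw [this]
  refine Finset.sum_congr rfl fun r _ => ?_
  exact (hS.toMultilinearMap x).map_smul_univ (fun i => c i (r i)) fun i => e (r i)

variable [T2Space M] [IsContMDiffRiemannianBundle (𝓡 m) ∞ (EuclideanSpace ℝ (Fin m))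
      (fun x : M => TangentSpace (𝓡 m) x)] [VectorBundle ℝ F V]

/-- The definition of a smooth tensor tests it only on globally smooth fields, whereas
`FiberBundle.extend` is known here only to be differentiable at the base point. Expanding the fields
in a smooth orthonormal frame bridges the gap: the coefficients are differentiable and the tensor is
evaluated on smooth fields alone. -/
theorem diffSectionAt (hS : IsSmoothTensor F S) {x₀ : M}
    {X : Fin k → Π x : M, TangentSpace (𝓡 m) x}
    (hX : ∀ i, DiffSectionAt m (EuclideanSpace ℝ (Fin m)) (X i) x₀) :
    DiffSectionAt m F (fun x => S x fun i => X i x) x₀ := by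
  obtain ⟨E, hE, hon⟩ := exists_orthonormalBasis_vectorFields m x₀
  have hEd : ∀ a, DiffSectionAt m (EuclideanSpace ℝ (Fin m)) (E a) x₀ := fun a =>
    (hE a).mdifferentiableAt (by simp)
  have hc : ∀ i a, MDifferentiableAt (𝓡 m) 𝓘(ℝ) (fun x => (inner ℝ (E a x) (X i x) : ℝ)) x₀ :=
    fun i a => (hEd a).inner_bundle (hX i)
  have hprod : ∀ (r : Fin k → Fin m) (s : Finset (Fin k)), MDifferentiableAt (𝓡 m) 𝓘(ℝ)
      (fun x => ∏ i ∈ s, (inner ℝ (E (r i) x) (X i x) : ℝ)) x₀ := by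
    intro r s
    induction s using Finset.induction_on with
    | empty => simpa using mdifferentiableAt_const
    | insert i s hi ih =>
      simp only [Finset.prod_insert hi]
      exact (hc i (r i)).mul ih
  have hsum : DiffSectionAt m F (fun x => ∑ r : Fin k → Fin m,
      (∏ i, (inner ℝ (E (r i) x) (X i x) : ℝ)) • S x fun i => E (r i) x) x₀ := by
    refine MDifferentiableAt.sum_section fun r _ => ?_
    exact (hprod r Finset.univ).smul_section
      ((hS.smooth (fun i => E (r i)) fun i => hE (r i)).mdifferentiableAt (by simp))
  refine hsum.congr_of_eventuallyEq (hon.mono fun x ⟨e, he⟩ => ?_)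
  have : (fun i => X i x) = fun i => ∑ a, (inner ℝ (E a x) (X i x) : ℝ) • E a x := by
    funext i
    simpa [he] using (e.sum_repr' (X i x)).symm
  simp only [TotalSpace.mk_inj]
  rw [this, hS.apply_sum]

end IsSmoothTensor

end SmoothTensors

/-! ### The covariant derivative of a tensor field is again a smooth tensor field. -/

section TensorDerivative

variable {m : ℕ} {M : Type*} [TopologicalSpace M] [ChartedSpace (EuclideanSpace ℝ (Fin m)) M]
  [IsManifold (𝓡 m) ∞ M] [T2Space M]
  [RiemannianBundle (fun x : M => TangentSpace (𝓡 m) x)]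
  [IsContMDiffRiemannianBundle (𝓡 m) ∞ (EuclideanSpace ℝ (Fin m))
    (fun x : M => TangentSpace (𝓡 m) x)]
  {F : Type*} [NormedAddCommGroup F] [NormedSpace ℝ F]
  {V : M → Type*} [TopologicalSpace (TotalSpace F V)]
  [∀ x, NormedAddCommGroup (V x)] [∀ x, InnerProductSpace ℝ (V x)]
  [FiberBundle F V]
  (nabla : CovariantDerivative (𝓡 m) (EuclideanSpace ℝ (Fin m))
    (fun x : M => TangentSpace (𝓡 m) x))
  (D : CovariantDerivative (𝓡 m) F V)

/-- The covariant derivative of `S`, computed from vector fields `X₁, …, X_k`. -/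
def covDerivOfFields {k : ℕ} (S : Π x : M, (Fin k → TangentSpace (𝓡 m) x) → V x)
    (X : Fin k → Π x : M, TangentSpace (𝓡 m) x) (x : M) (w : TangentSpace (𝓡 m) x) : V x :=
  D (fun y => S y fun i => X i y) x w -
    ∑ i, S x (Function.update (fun a => X a x) i (nabla (X i) x w))

variable {nabla D}
variable {k : ℕ} {S : Π x : M, (Fin k → TangentSpace (𝓡 m) x) → V x}

theorem update_apply_section (X : Fin k → Π x : M, TangentSpace (𝓡 m) x) (i : Fin k)
    (Y : Π x : M, TangentSpace (𝓡 m) x) (y : M) :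
    (fun a => Function.update X i Y a y) = Function.update (fun a => X a y) i (Y y) := by
  funext a
  by_cases h : a = i
  · subst h; simp
  · simp [h]

variable [VectorBundle ℝ F V]

/-- When the field in slot i is multiplied by f, the Leibniz term df(w) S(…) produced by D cancels
the one produced by the connection on that slot. -/
theorem tensorialAt_covDerivOfFields (hS : IsSmoothTensor F S) {x : M}
    {X : Fin k → Π x : M, TangentSpace (𝓡 m) x}
    (hX : ∀ i, DiffSectionAt m (EuclideanSpace ℝ (Fin m)) (X i) x) (i : Fin k)
    (w : TangentSpace (𝓡 m) x) :
    TensorialAt (𝓡 m) (EuclideanSpace ℝ (Fin m))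
      (fun Y => covDerivOfFields nabla D S (Function.update X i Y) x w) x := by
  have hupd : ∀ {Y : Π x : M, TangentSpace (𝓡 m) x},
      DiffSectionAt m (EuclideanSpace ℝ (Fin m)) Y x →
      ∀ a, DiffSectionAt m (EuclideanSpace ℝ (Fin m)) (Function.update X i Y a) x := by
    intro Y hY a
    by_cases h : a = i
    · subst h; simpa using hY
    · simpa [h] using hX a
  -- Isolates the only summand that differentiates Y; all the others depend on Y through its value
  -- at x.
  have hsum : ∀ Y : Π x : M, TangentSpace (𝓡 m) x,
      ∑ a, S x (Function.update (fun b => Function.update X i Y b x) a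
        (nabla (Function.update X i Y a) x w)) =
      S x (Function.update (fun b => X b x) i (nabla Y x w)) +
      ∑ a ∈ Finset.univ.erase i, S x (Function.update
        (Function.update (fun b => X b x) a (nabla (X a) x w)) i (Y x)) := by
    intro Y
    rw [← Finset.add_sum_erase _ _ (Finset.mem_univ i)]
    congr 1
    · simp [update_apply_section]
    · refine Finset.sum_congr rfl fun a ha => ?_
      have ha' : a ≠ i := Finset.ne_of_mem_erase ha
      rw [update_apply_section, Function.update_of_ne ha', Function.update_comm ha']
  refine ⟨fun {f Y} hf hY => ?_, fun {Y Y'} hY hY' => ?_⟩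
  · have h1 : (fun y => S y fun a => Function.update X i (f • Y) a y) =
        f • fun y => S y fun a => Function.update X i Y a y := by
      funext y
      simp only [update_apply_section, Pi.smul_apply', hS.update_smul]
    simp only [covDerivOfFields, hsum]
    rw [h1, D.isCovariantDerivativeOn.leibniz (s := Set.univ) (hS.diffSectionAt (hupd hY)) hf,
      nabla.isCovariantDerivativeOn.leibniz (s := Set.univ) hY hf]
    simp only [update_apply_section, Pi.smul_apply', hS.update_smul, hS.update_add,
      add_apply, smul_apply, ContinuousLinearMap.smulRight_apply,
      smul_sub, smul_add, Finset.smul_sum]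
    abel
  · have h1 : (fun y => S y fun a => Function.update X i (Y + Y') a y) =
        (fun y => S y fun a => Function.update X i Y a y) +
          fun y => S y fun a => Function.update X i Y' a y := by
      funext y
      simp only [update_apply_section, Pi.add_apply, hS.update_add]
    simp only [covDerivOfFields, hsum]
    rw [h1, D.isCovariantDerivativeOn.add (s := Set.univ) (hS.diffSectionAt (hupd hY))
      (hS.diffSectionAt (hupd hY')), nabla.isCovariantDerivativeOn.add (s := Set.univ) hY hY']
    simp only [Pi.add_apply, hS.update_add, add_apply, Finset.sum_add_distrib]
    abel

/-- Replaces the fields one slot at a time, each replacement being tensoriality in that slot. The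
finite set records the slots already replaced. -/
theorem covDerivOfFields_congr (hS : IsSmoothTensor F S) {x : M}
    {X Y : Fin k → Π x : M, TangentSpace (𝓡 m) x}
    (hX : ∀ i, DiffSectionAt m (EuclideanSpace ℝ (Fin m)) (X i) x)
    (hY : ∀ i, DiffSectionAt m (EuclideanSpace ℝ (Fin m)) (Y i) x)
    (hXY : ∀ i, X i x = Y i x) (w : TangentSpace (𝓡 m) x) :
    covDerivOfFields nabla D S X x w = covDerivOfFields nabla D S Y x w := by
  have key : ∀ s : Finset (Fin k), covDerivOfFields nabla D S (s.piecewise Y X) x w =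
      covDerivOfFields nabla D S X x w := by
    intro s
    induction s using Finset.induction_on with
    | empty => simp
    | insert i s hi ih =>
      rw [Finset.piecewise_insert, ← ih]
      have hd : ∀ a, DiffSectionAt m (EuclideanSpace ℝ (Fin m)) (s.piecewise Y X a) x := by
        intro a
        by_cases ha : a ∈ s
        · simpa [ha] using hY a
        · simpa [ha] using hX a
      have h := (tensorialAt_covDerivOfFields (nabla := nabla) (D := D) hS hd i w).pointwise
        (hY i) (hX i) (hXY i).symm

      rw [h]
      congr 1
      rw [Function.update_eq_self_iff]
      simp [hi]
  have := key Finset.univ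
  rw [Finset.piecewise_univ] at this
  exact this.symm

/-- Frees the covariant derivative from the particular extensions used to define it, so that smooth
frames or parallel extensions can be used instead. -/
theorem tensorCovDeriv_eq_covDerivOfFields (hS : IsSmoothTensor F S) {x : M}
    {X : Fin k → Π x : M, TangentSpace (𝓡 m) x}
    (hX : ∀ i, DiffSectionAt m (EuclideanSpace ℝ (Fin m)) (X i) x)
    {v : Fin (k + 1) → TangentSpace (𝓡 m) x} (hv : ∀ i, X i x = v i.castSucc) :
    tensorCovDeriv nabla D S x v = covDerivOfFields nabla D S X x (v (Fin.last k)) := by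
  rw [covDerivOfFields_congr (Y := fun i =>
    FiberBundle.extend (EuclideanSpace ℝ (Fin m)) (v i.castSucc)) hS hX
    (fun i => FiberBundle.mdifferentiableAt_extend ..) (by simpa using hv)]
  simp [tensorCovDeriv, covDerivOfFields]

variable [ContMDiffVectorBundle ∞ F V (𝓡 m)]
  [CovariantDerivative.ContMDiffCovariantDerivative nabla ∞]
  [CovariantDerivative.ContMDiffCovariantDerivative D ∞]

theorem SmoothSection.covariantDerivative {W : M → Type*} {G : Type*} [NormedAddCommGroup G]
    [NormedSpace ℝ G] [TopologicalSpace (TotalSpace G W)]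
    [∀ x, AddCommGroup (W x)] [∀ x, Module ℝ (W x)] [∀ x, TopologicalSpace (W x)]
    [∀ x, IsTopologicalAddGroup (W x)] [∀ x, ContinuousSMul ℝ (W x)]
    [FiberBundle G W] [VectorBundle ℝ G W] [ContMDiffVectorBundle ∞ G W (𝓡 m)]
    {D : CovariantDerivative (𝓡 m) G W}
    [h : CovariantDerivative.ContMDiffCovariantDerivative D ∞]
    {σ : Π x : M, W x} (hσ : ContMDiff (𝓡 m) ((𝓡 m).prod 𝓘(ℝ, G)) ∞
      fun x => TotalSpace.mk' G x (σ x))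
    {X : Π x : M, TangentSpace (𝓡 m) x} (hX : SmoothSection m (EuclideanSpace ℝ (Fin m)) X) :
    ContMDiff (𝓡 m) ((𝓡 m).prod 𝓘(ℝ, G)) ∞
      fun x => TotalSpace.mk' G x (D σ x (X x)) := by
  have h1 := h.contMDiff.contMDiff (σ := σ) (by simpa using hσ.contMDiffOn)
  rw [contMDiffOn_univ] at h1
  exact h1.clm_bundle_apply hX

/-- Linearity in the first k slots is tensoriality; linearity in the last slot is linearity of the
connections in the direction. For smoothness, the given global fields replace the pointwise
extensions. -/
theorem IsSmoothTensor.tensorCovDeriv (hS : IsSmoothTensor F S) :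
    IsSmoothTensor F (tensorCovDeriv nabla D S) := by
  have hext : ∀ {x : M} (v : Fin k → TangentSpace (𝓡 m) x) (i : Fin k),
      DiffSectionAt m (EuclideanSpace ℝ (Fin m))
        (FiberBundle.extend (EuclideanSpace ℝ (Fin m)) (v i)) x :=
    fun v i => FiberBundle.mdifferentiableAt_extend ..
  -- Varying a vector in slot i is realised by varying a field, to which tensoriality applies.
  have hupd : ∀ {x : M} (v : Fin (k + 1) → TangentSpace (𝓡 m) x) (i : Fin k)
      {Y : Π x : M, TangentSpace (𝓡 m) x}, DiffSectionAt m (EuclideanSpace ℝ (Fin m)) Y x →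
      _root_.tensorCovDeriv nabla D S x (Function.update v i.castSucc (Y x)) =
        covDerivOfFields nabla D S (Function.update (fun a =>
          FiberBundle.extend (EuclideanSpace ℝ (Fin m)) (v a.castSucc)) i Y) x
          (v (Fin.last k)) := by
    intro x v i Y hY
    rw [tensorCovDeriv_eq_covDerivOfFields hS (X := Function.update (fun a =>
          FiberBundle.extend (EuclideanSpace ℝ (Fin m)) (v a.castSucc)) i Y)]
    · rw [Function.update_of_ne (Fin.castSucc_lt_last i).ne']
    · intro a
      by_cases h : a = i
      · subst h; simpa using hY
      · simpa [h] using hext (fun a => v a.castSucc) a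
    · intro a
      by_cases h : a = i
      · subst h; simp
      · simp [h]
  have hlast : ∀ {x : M} (v : Fin (k + 1) → TangentSpace (𝓡 m) x) (w : TangentSpace (𝓡 m) x),
      _root_.tensorCovDeriv nabla D S x (Function.update v (Fin.last k) w) =
        covDerivOfFields nabla D S (fun a =>
          FiberBundle.extend (EuclideanSpace ℝ (Fin m)) (v a.castSucc)) x w := by
    intro x v w
    rw [tensorCovDeriv_eq_covDerivOfFields hS (X := fun a =>
          FiberBundle.extend (EuclideanSpace ℝ (Fin m)) (v a.castSucc))
          (fun a => hext (fun a => v a.castSucc) a)]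
    · simp
    · intro a
      simp
  refine ⟨fun x v i a b => ?_, fun x v i c a => ?_, fun X hX => ?_⟩
  · induction i using Fin.lastCases with
    | last =>
      simp only [hlast, covDerivOfFields, map_add, hS.update_add, Finset.sum_add_distrib]
      abel
    | cast i =>
      have ht := tensorialAt_covDerivOfFields (nabla := nabla) (D := D) hS
        (hext (fun a => v a.castSucc)) i (v (Fin.last k))
      have ha : DiffSectionAt m (EuclideanSpace ℝ (Fin m))
        (FiberBundle.extend (EuclideanSpace ℝ (Fin m)) a) x :=
      FiberBundle.mdifferentiableAt_extend ..
      have hb : DiffSectionAt m (EuclideanSpace ℝ (Fin m))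
        (FiberBundle.extend (EuclideanSpace ℝ (Fin m)) b) x :=
      FiberBundle.mdifferentiableAt_extend ..
      have h1 := ht.add ha hb
      rw [← hupd v i ha, ← hupd v i hb, ← hupd v i (mdifferentiableAt_add_section ha hb)] at h1
      simpa using h1
  · induction i using Fin.lastCases with
    | last =>
      simp only [hlast, covDerivOfFields, map_smul, hS.update_smul, ← Finset.smul_sum, smul_sub]
    | cast i =>
      have ht := tensorialAt_covDerivOfFields (nabla := nabla) (D := D) hS
        (hext (fun a => v a.castSucc)) i (v (Fin.last k))
      have ha : DiffSectionAt m (EuclideanSpace ℝ (Fin m))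
        (FiberBundle.extend (EuclideanSpace ℝ (Fin m)) a) x :=
      FiberBundle.mdifferentiableAt_extend ..
      have hc : MDifferentiableAt (𝓡 m) 𝓘(ℝ) (fun _ : M => c) x := mdifferentiableAt_const
      have h1 := ht.smul hc ha
      rw [← hupd v i ha, ← hupd v i (hc.smul_section ha)] at h1
      simpa using h1
  · have h0 : (fun x => _root_.tensorCovDeriv nabla D S x fun i => X i x) =
        (fun x => D (fun y => S y fun i => X (Fin.castSucc i) y) x (X (Fin.last k) x)) -
        fun x => ∑ i : Fin k, S x fun a => Function.update (fun a => X (Fin.castSucc a)) i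
          (fun y => nabla (X i.castSucc) y (X (Fin.last k) y)) a x := by
      funext x
      rw [tensorCovDeriv_eq_covDerivOfFields hS (X := fun i => X i.castSucc)
        (fun i => (hX _).mdifferentiableAt (by simp)) (fun i => rfl)]
      simp [covDerivOfFields, update_apply_section]
    have h1 : SmoothSection m F fun y => S y fun i => X (Fin.castSucc i) y :=
      hS.smooth _ fun i => hX _
    show SmoothSection m F fun x => _root_.tensorCovDeriv nabla D S x fun i => X i x
    rw [h0]
    refine ContMDiff.sub_section (SmoothSection.covariantDerivative h1 (hX _))
      (ContMDiff.sum_section fun i _ => hS.smooth _ fun a => ?_)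
    by_cases h : a = i
    · subst h
      simpa using SmoothSection.covariantDerivative (hX a.castSucc) (hX (Fin.last k))
    · simpa [h] using hX a.castSucc

theorem isSmoothTensor_iterCovDeriv {T : Π x : M, V x} (hT : SmoothSection m F T) (n : ℕ) :
    IsSmoothTensor F (iterCovDeriv nabla D T n) := by
  induction n with
  | zero => exact ⟨fun _ _ i => i.elim0, fun _ _ i => i.elim0, fun _ _ => hT⟩
  | succ n ih => exact ih.tensorCovDeriv

end TensorDerivative

/-! ### Linear algebra: independence of the basis and antisymmetric cancellation. -/

section MultilinearInner

variable {T W : Type*} [NormedAddCommGroup T] [InnerProductSpace ℝ T]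
  [NormedAddCommGroup W] [InnerProductSpace ℝ W]

/-- A map of `k` vectors is multilinear. -/
def IsMultilinear {k : ℕ} (S : (Fin k → T) → W) : Prop :=
  ∃ A : MultilinearMap ℝ (fun _ : Fin k => T) W, ⇑A = S

/-- Insertion of a vector in the last slot. -/
def insertLast {k : ℕ} (S : (Fin (k + 1) → T) → W) (w : T) (v : Fin k → T) : W :=
  S (Fin.snoc (α := fun _ => T) v w)

theorem IsMultilinear.insertLast {k : ℕ} {S : (Fin (k + 1) → T) → W} (hS : IsMultilinear S)
    (w : T) : IsMultilinear (insertLast S w) := by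
  obtain ⟨A, rfl⟩ := hS
  exact ⟨(LinearMap.applyₗ w).compMultilinearMap A.curryRight, rfl⟩

theorem sum_snoc {ι A : Type*} [Fintype ι] [AddCommMonoid A] {k : ℕ}
    (f : (Fin (k + 1) → ι) → A) :
    ∑ r, f r = ∑ a : ι, ∑ r : Fin k → ι, f (Fin.snoc (α := fun _ => ι) r a) := by
  rw [← Fintype.sum_prod_type', ← (Fin.snocEquiv fun _ => ι).sum_comp]
  rfl

theorem comp_snoc {ι A : Type*} {k : ℕ} (e : ι → A) (r : Fin k → ι) (a : ι) :
    (fun i => e (Fin.snoc (α := fun _ => ι) r a i)) =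
      Fin.snoc (α := fun _ => A) (fun i => e (r i)) (e a) := by
  funext i
  induction i using Fin.lastCases <;> simp

/-- Expand b in b' and use ∑_a ⟨b'_c, b_a⟩⟨b_a, b'_d⟩ = δ_cd. -/
theorem OrthonormalBasis.sum_inner_apply_eq {ι ι' : Type*} [Fintype ι] [Fintype ι']
    (b : OrthonormalBasis ι ℝ T) (b' : OrthonormalBasis ι' ℝ T) (f g : T →ₗ[ℝ] W) :
    ∑ a, (inner ℝ (f (b a)) (g (b a)) : ℝ) = ∑ c, (inner ℝ (f (b' c)) (g (b' c)) : ℝ) := by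
  classical
  have h1 : ∀ a, (inner ℝ (f (b a)) (g (b a)) : ℝ) = ∑ c, ∑ d,
      (inner ℝ (b' c) (b a) * inner ℝ (b a) (b' d)) * inner ℝ (f (b' c)) (g (b' d)) := by
    intro a
    conv_lhs => rw [← b'.sum_repr' (b a)]
    simp only [map_sum, map_smul, sum_inner, inner_sum, inner_smul_left, inner_smul_right,
        Finset.mul_sum]
    rw [Finset.sum_comm]
    refine Finset.sum_congr rfl fun c _ => Finset.sum_congr rfl fun d _ => ?_
    rw [real_inner_comm (b' d) (b a)]
    simp only [conj_trivial]
    ring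
  simp only [h1]
  rw [Finset.sum_comm]
  refine Finset.sum_congr rfl fun c _ => ?_
  rw [Finset.sum_comm]
  simp only [← Finset.sum_mul, b.sum_inner_mul_inner, b'.inner_eq_ite, ite_mul, one_mul, zero_mul,
    Finset.sum_ite_eq, Finset.mem_univ, if_true]

/-- The pointwise inner product is defined with a basis chosen separately at each point, with no
regularity in the point. This lemma allows it to be computed in a smooth frame. The basis is changed
slot by slot, the last slot being peeled off. -/
theorem sum_inner_eq_of_isMultilinear {ι ι' : Type*} [Fintype ι] [Fintype ι']
    (b : OrthonormalBasis ι ℝ T) (b' : OrthonormalBasis ι' ℝ T) {k : ℕ}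
    {S S' : (Fin k → T) → W} (hS : IsMultilinear S) (hS' : IsMultilinear S') :
    ∑ r : Fin k → ι, (inner ℝ (S fun i => b (r i)) (S' fun i => b (r i)) : ℝ) =
      ∑ r : Fin k → ι', (inner ℝ (S fun i => b' (r i)) (S' fun i => b' (r i)) : ℝ) := by
  induction k with
  | zero =>
    rw [Fintype.sum_unique, Fintype.sum_unique]
    congr 2 <;> exact Subsingleton.elim _ _
  | succ k ih =>
    rw [sum_snoc, sum_snoc]
    simp only [comp_snoc]
    have h1 : ∀ a : ι, ∑ r : Fin k → ι,
        (inner ℝ (S (Fin.snoc (α := fun _ => T) (fun i => b (r i)) (b a)))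
        (S' (Fin.snoc (α := fun _ => T) (fun i => b (r i)) (b a))) : ℝ) = ∑ r : Fin k → ι',
        (inner ℝ (S (Fin.snoc (α := fun _ => T) (fun i => b' (r i)) (b a)))
        (S' (Fin.snoc (α := fun _ => T) (fun i => b' (r i)) (b a))) : ℝ) := fun a =>
      ih (hS.insertLast (b a)) (hS'.insertLast (b a))
    simp only [h1]
    rw [Finset.sum_comm]
    conv_rhs => rw [Finset.sum_comm]
    refine Finset.sum_congr rfl fun r _ => ?_
    obtain ⟨A, rfl⟩ := hS
    obtain ⟨B, rfl⟩ := hS'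
    exact b.sum_inner_apply_eq b' (A.curryRight fun i => b' (r i)) (B.curryRight fun i => b' (r i))

/-- Cancellation of the terms `θ` of an antisymmetric connection matrix. -/
theorem sum_antisymm_update_eq_zero {ι : Type*} [Fintype ι] {k : ℕ} (θ : ι → ι → ℝ)
    (hθ : ∀ a b, θ a b = -θ b a) (A : (Fin k → ι) → (Fin k → ι) → ℝ) (i : Fin k) :
    ∑ r : Fin k → ι, ∑ b, θ (r i) b * A (Function.update r i b) r +
      ∑ r : Fin k → ι, ∑ b, θ (r i) b * A r (Function.update r i b) = 0 := by
  -- Exchanging b with the i-th entry of r turns one double sum into the other and transposes the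
  -- indices of θ.
  have hinv : Function.Involutive
      fun p : (Fin k → ι) × ι => (Function.update p.1 i p.2, p.1 i) := by
    rintro ⟨r, b⟩
    simp
  rw [← Fintype.sum_prod_type' (f := fun (r : Fin k → ι) b => θ (r i) b * A r
      (Function.update r i b)),
    ← Equiv.sum_comp hinv.toPerm, ← Fintype.sum_prod_type', ← Finset.sum_add_distrib]
  refine Finset.sum_eq_zero fun p _ => ?_
  simp [Function.Involutive.toPerm, hθ p.2]

end MultilinearInner

/-! ### The induced inner product on tensors. -/

section TensorInner

variable {m : ℕ} {M : Type*} [TopologicalSpace M] [ChartedSpace (EuclideanSpace ℝ (Fin m)) M]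
  [IsManifold (𝓡 m) ∞ M]
  [RiemannianBundle (fun x : M => TangentSpace (𝓡 m) x)]
  {F : Type*} [NormedAddCommGroup F] [NormedSpace ℝ F]
  {V : M → Type*} [TopologicalSpace (TotalSpace F V)]
  [∀ x, NormedAddCommGroup (V x)] [∀ x, InnerProductSpace ℝ (V x)]
  [FiberBundle F V]

/-- The inner product on `T_x*M^{⊗k} ⊗ V_x` induced by the two metrics. -/
def tensorInner {k : ℕ} (x : M) (S S' : (Fin k → TangentSpace (𝓡 m) x) → V x) : ℝ :=
  ∑ i : Fin k → Fin (Module.finrank ℝ (TangentSpace (𝓡 m) x)),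
    inner ℝ (S fun a => stdOrthonormalBasis ℝ (TangentSpace (𝓡 m) x) (i a))
      (S' fun a => stdOrthonormalBasis ℝ (TangentSpace (𝓡 m) x) (i a))

theorem tensorNorm_eq_sqrt {k : ℕ} (x : M) (S : (Fin k → TangentSpace (𝓡 m) x) → V x) :
    tensorNorm x S = Real.sqrt (tensorInner x S S) := by
  simp [tensorNorm, tensorInner]

theorem tensorInner_self_nonneg {k : ℕ} (x : M) (S : (Fin k → TangentSpace (𝓡 m) x) → V x) :
    0 ≤ tensorInner x S S :=
  Finset.sum_nonneg fun _ _ => real_inner_self_nonneg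

theorem tensorNorm_sq {k : ℕ} (x : M) (S : (Fin k → TangentSpace (𝓡 m) x) → V x) :
    tensorNorm x S ^ 2 = tensorInner x S S := by
  rw [tensorNorm_eq_sqrt, Real.sq_sqrt (tensorInner_self_nonneg x S)]

theorem tensorNorm_nonneg {k : ℕ} (x : M) (S : (Fin k → TangentSpace (𝓡 m) x) → V x) :
    0 ≤ tensorNorm x S := Real.sqrt_nonneg _

theorem tensorInner_eq_sum {k : ℕ} {x : M} {S S' : (Fin k → TangentSpace (𝓡 m) x) → V x}
    (hS : IsMultilinear S) (hS' : IsMultilinear S') {ι : Type*} [Fintype ι]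
    (b : OrthonormalBasis ι ℝ (TangentSpace (𝓡 m) x)) :
    tensorInner x S S' =
      ∑ r : Fin k → ι, inner ℝ (S fun i => b (r i)) (S' fun i => b (r i)) :=
  sum_inner_eq_of_isMultilinear _ b hS hS'

theorem tensorInner_eq_sum_insertLast {k : ℕ} {x : M}
    {S S' : (Fin (k + 1) → TangentSpace (𝓡 m) x) → V x}
    (hS : IsMultilinear S) (hS' : IsMultilinear S') {ι : Type*} [Fintype ι]
    (b : OrthonormalBasis ι ℝ (TangentSpace (𝓡 m) x)) :
    tensorInner x S S' = ∑ a, tensorInner x (insertLast S (b a)) (insertLast S' (b a)) := by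
  rw [tensorInner_eq_sum hS hS' b, sum_snoc]
  refine Finset.sum_congr rfl fun a _ => ?_
  rw [tensorInner_eq_sum (hS.insertLast _) (hS'.insertLast _) b]
  simp only [comp_snoc]
  rfl

theorem IsSmoothTensor.isMultilinear {k : ℕ}
    {S : Π x : M, (Fin k → TangentSpace (𝓡 m) x) → V x} (hS : IsSmoothTensor F S) (x : M) :
    IsMultilinear (S x) := ⟨hS.toMultilinearMap x, rfl⟩

theorem mvfderiv_congr_of_eventuallyEq {f g : M → ℝ} {x : M} (h : f =ᶠ[𝓝 x] g) :
    mvfderiv (𝓡 m) f x = mvfderiv (𝓡 m) g x := by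
  simp only [mvfderiv]
  rw [h.mfderiv_eq, h.eq_of_nhds]

theorem mvfderiv_finset_sum {ι : Type*} (s : Finset ι) {f : ι → M → ℝ} {x : M}
    (h : ∀ i ∈ s, MDifferentiableAt (𝓡 m) 𝓘(ℝ) (f i) x) :
    mvfderiv (𝓡 m) (fun y => ∑ i ∈ s, f i y) x = ∑ i ∈ s, mvfderiv (𝓡 m) (f i) x ∧
      MDifferentiableAt (𝓡 m) 𝓘(ℝ) (fun y => ∑ i ∈ s, f i y) x := by
  classical
  induction s using Finset.induction_on with
  | empty => exact ⟨by simpa using mvfderiv_const 0, by simpa using mdifferentiableAt_const⟩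
  | insert i s hi ih =>
    obtain ⟨h1, h2⟩ := ih fun j hj => h j (Finset.mem_insert_of_mem hj)
    have h3 := h i (Finset.mem_insert_self i s)
    simp only [Finset.sum_insert hi]
    exact ⟨by rw [mvfderiv_fun_add h3 h2, h1], h3.add h2⟩

end TensorInner

/-! ### Metric compatibility of the induced connection on tensors. -/

section ProductRule

variable {m : ℕ} {M : Type*} [TopologicalSpace M] [ChartedSpace (EuclideanSpace ℝ (Fin m)) M]
  [IsManifold (𝓡 m) ∞ M] [T2Space M]
  [RiemannianBundle (fun x : M => TangentSpace (𝓡 m) x)]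
  [IsContMDiffRiemannianBundle (𝓡 m) ∞ (EuclideanSpace ℝ (Fin m))
    (fun x : M => TangentSpace (𝓡 m) x)]
  {nabla : CovariantDerivative (𝓡 m) (EuclideanSpace ℝ (Fin m))
    (fun x : M => TangentSpace (𝓡 m) x)}
  {F : Type*} [NormedAddCommGroup F] [NormedSpace ℝ F] [FiniteDimensional ℝ F]
  {V : M → Type*} [TopologicalSpace (TotalSpace F V)]
  [∀ x, NormedAddCommGroup (V x)] [∀ x, InnerProductSpace ℝ (V x)]
  [FiberBundle F V] [VectorBundle ℝ F V] [ContMDiffVectorBundle ∞ F V (𝓡 m)]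
  [IsContMDiffRiemannianBundle (𝓡 m) ∞ F V]
  {D : CovariantDerivative (𝓡 m) F V}
  {k : ℕ} {S S' : Π x : M, (Fin k → TangentSpace (𝓡 m) x) → V x}

theorem contMDiff_tensorInner (hS : IsSmoothTensor F S) (hS' : IsSmoothTensor F S') :
    ContMDiff (𝓡 m) 𝓘(ℝ) ∞ fun x => tensorInner x (S x) (S' x) := by
  intro x₀
  obtain ⟨E, hE, hon⟩ := exists_orthonormalBasis_vectorFields m x₀
  have h : ContMDiffAt (𝓡 m) 𝓘(ℝ) ∞ (fun x => ∑ r : Fin k → Fin m,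
      (inner ℝ (S x fun i => E (r i) x) (S' x fun i => E (r i) x) : ℝ)) x₀ :=
    contMDiffAt_finsetSum fun r _ => ((hS.smooth _ fun i => hE (r i)).inner_bundle
      (hS'.smooth _ fun i => hE (r i))) x₀
  refine h.congr_of_eventuallyEq (hon.mono fun x ⟨e, he⟩ => ?_)
  simp only [tensorInner_eq_sum (hS.isMultilinear x) (hS'.isMultilinear x) e, he]

theorem mvfderiv_inner_eq (hD : D.IsMetricCompatible) {x : M} {σ τ : Π x : M, V x}
    (hσ : DiffSectionAt m F σ x) (hτ : DiffSectionAt m F τ x) (w : TangentSpace (𝓡 m) x) :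
    mvfderiv (𝓡 m) (fun y => (inner ℝ (σ y) (τ y) : ℝ)) x w =
      inner ℝ (D σ x w) (τ x) + inner ℝ (σ x) (D τ x w) := by
  simpa using hD.mvfderiv_inner_eq
    (FiberBundle.extend (EuclideanSpace ℝ (Fin m)) w) hσ hτ

theorem insertLast_tensorCovDeriv (hS : IsSmoothTensor F S) {x : M}
    {X : Fin k → Π x : M, TangentSpace (𝓡 m) x}
    (hX : ∀ i, DiffSectionAt m (EuclideanSpace ℝ (Fin m)) (X i) x) (w : TangentSpace (𝓡 m) x) :
    insertLast (tensorCovDeriv nabla D S x) w (fun i => X i x) =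
      D (fun y => S y fun i => X i y) x w -
        ∑ i, S x (Function.update (fun a => X a x) i (nabla (X i) x w)) := by
  rw [insertLast, tensorCovDeriv_eq_covDerivOfFields hS hX (by simp), Fin.snoc_last]
  rfl

/-- The connection form of an orthonormal frame is antisymmetric. -/
theorem inner_covariantDerivative_antisymm (hD : D.IsMetricCompatible) {x₀ : M} {n : ℕ}
    {E : Fin n → Π x : M, V x} (hE : ∀ i, DiffSectionAt m F (E i) x₀)
    (hon : ∀ᶠ x in 𝓝 x₀, ∃ e : OrthonormalBasis (Fin n) ℝ (V x), ∀ i, e i = E i x)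
    (w : TangentSpace (𝓡 m) x₀) (a b : Fin n) :
    (inner ℝ (E b x₀) (D (E a) x₀ w) : ℝ) = -inner ℝ (E a x₀) (D (E b) x₀ w) := by
  have h1 := mvfderiv_inner_eq hD (hE a) (hE b) w
  have h2 : (fun y => (inner ℝ (E a y) (E b y) : ℝ)) =ᶠ[𝓝 x₀] fun _ => if a = b then 1 else 0 := by
    filter_upwards [hon] with y ⟨e, he⟩
    rw [← he, ← he, e.inner_eq_ite]
  rw [mvfderiv_congr_of_eventuallyEq h2, mvfderiv_const, zero_apply,
    real_inner_comm] at h1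
  linarith

/-- In a smooth orthonormal frame the inner product is a sum of products of components. The
derivative of a component is the component of the covariant derivative plus connection-form terms,
and these cancel in the sum because the connection form of an orthonormal frame is antisymmetric. -/
theorem mvfderiv_tensorInner
    (hnabla : nabla.IsMetricCompatible) (hD : D.IsMetricCompatible)
    (hS : IsSmoothTensor F S) (hS' : IsSmoothTensor F S') (x : M) (w : TangentSpace (𝓡 m) x)
    (hDS : IsMultilinear (tensorCovDeriv nabla D S x))
    (hDS' : IsMultilinear (tensorCovDeriv nabla D S' x)) :
    mvfderiv (𝓡 m) (fun y => tensorInner y (S y) (S' y)) x w =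
      tensorInner x (insertLast (tensorCovDeriv nabla D S x) w) (S' x) +
        tensorInner x (S x) (insertLast (tensorCovDeriv nabla D S' x) w) := by
  obtain ⟨E, hE, hon⟩ := exists_orthonormalBasis_vectorFields m x
  obtain ⟨e, he⟩ := hon.self_of_nhds
  have hEd : ∀ i, DiffSectionAt m (EuclideanSpace ℝ (Fin m)) (E i) x := fun i =>
    (hE i).mdifferentiableAt (by simp)
  have hd : ∀ {S : Π x : M, (Fin k → TangentSpace (𝓡 m) x) → V x}, IsSmoothTensor F S →
      ∀ r : Fin k → Fin m, DiffSectionAt m F (fun y => S y fun i => E (r i) y) x := fun hS r =>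
    (hS.smooth _ fun i => hE (r i)).mdifferentiableAt (by simp)
  have hcongr : (fun y => tensorInner y (S y) (S' y)) =ᶠ[𝓝 x] fun y => ∑ r : Fin k → Fin m,
      (inner ℝ (S y fun i => E (r i) y) (S' y fun i => E (r i) y) : ℝ) := by
    filter_upwards [hon] with y ⟨e, he⟩
    simp only [tensorInner_eq_sum (hS.isMultilinear y) (hS'.isMultilinear y) e, he]
  -- The connection form of the frame, evaluated in the direction w.
  let θ : Fin m → Fin m → ℝ := fun a b => inner ℝ (E b x) (nabla (E a) x w)
  have hθ : ∀ a b, θ a b = -θ b a :=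
    inner_covariantDerivative_antisymm hnabla hEd hon w
  have hnE : ∀ a, nabla (E a) x w = ∑ b, θ a b • E b x := by
    intro a
    simpa [he] using (e.sum_repr' (nabla (E a) x w)).symm
  have hDd : ∀ {S : Π x : M, (Fin k → TangentSpace (𝓡 m) x) → V x}, IsSmoothTensor F S →
      ∀ r : Fin k → Fin m, D (fun y => S y fun i => E (r i) y) x w =
        insertLast (tensorCovDeriv nabla D S x) w (fun i => E (r i) x) +
          ∑ i, ∑ b, θ (r i) b • S x fun a => E (Function.update r i b a) x := by
    intro S hS r
    rw [insertLast_tensorCovDeriv hS (X := fun i => E (r i)) fun i => hEd (r i)]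
    rw [eq_comm, sub_add_eq_add_sub, sub_eq_iff_eq_add, add_right_inj]
    refine Finset.sum_congr rfl fun i _ => ?_
    rw [hnE]
    have := (hS.toMultilinearMap x).map_update_sum Finset.univ i
      (fun b => θ (r i) b • E b x) fun a => E (r a) x
    simp only [IsSmoothTensor.toMultilinearMap_apply, hS.update_smul] at this
    rw [this]
    refine Finset.sum_congr rfl fun b _ => ?_
    congr 2
    funext a
    by_cases h : a = i
    · subst h; simp
    · simp [h]
  rw [mvfderiv_congr_of_eventuallyEq hcongr,
    (mvfderiv_finset_sum Finset.univ fun r _ => (hd hS r).inner_bundle (hd hS' r)).1,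
    sum_apply]
  simp only [mvfderiv_inner_eq hD (hd hS _) (hd hS' _) w, hDd hS, hDd hS']
  rw [tensorInner_eq_sum (hDS.insertLast w) (hS'.isMultilinear x) e,
    tensorInner_eq_sum (hS.isMultilinear x) (hDS'.insertLast w) e]
  simp only [he, inner_add_left, inner_add_right, Finset.sum_add_distrib, sum_inner, inner_sum,
    inner_smul_left, inner_smul_right, conj_trivial]
  have hz : ∑ r : Fin k → Fin m, ∑ i, ∑ b, θ (r i) b *
        (inner ℝ (S x fun a => E (Function.update r i b a) x) (S' x fun a => E (r a) x) : ℝ) +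
      ∑ r : Fin k → Fin m, ∑ i, ∑ b, θ (r i) b *
        (inner ℝ (S x fun a => E (r a) x) (S' x fun a => E (Function.update r i b a) x) : ℝ)
        = 0 := by
    rw [Finset.sum_comm, Finset.sum_comm (s := (Finset.univ : Finset (Fin k → Fin m))),
      ← Finset.sum_add_distrib]
    exact Finset.sum_eq_zero fun i _ => sum_antisymm_update_eq_zero θ hθ
      (fun r r' => (inner ℝ (S x fun a => E (r a) x) (S' x fun a => E (r' a) x) : ℝ)) i
  linarith

end ProductRule

/-! ### Divergence, dual vector fields and contractions. -/

section Divergence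

variable {m : ℕ} {M : Type*} [TopologicalSpace M] [ChartedSpace (EuclideanSpace ℝ (Fin m)) M]
  [IsManifold (𝓡 m) ∞ M] [T2Space M]
  [RiemannianBundle (fun x : M => TangentSpace (𝓡 m) x)]
  [IsContMDiffRiemannianBundle (𝓡 m) ∞ (EuclideanSpace ℝ (Fin m))
    (fun x : M => TangentSpace (𝓡 m) x)]

/-- The divergence of a vector field. -/
def divergence (nabla : CovariantDerivative (𝓡 m) (EuclideanSpace ℝ (Fin m))
    (fun x : M => TangentSpace (𝓡 m) x)) (X : Π x : M, TangentSpace (𝓡 m) x) (x : M) : ℝ :=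
  LinearMap.trace ℝ (TangentSpace (𝓡 m) x) (nabla X x).toLinearMap

variable {nabla : CovariantDerivative (𝓡 m) (EuclideanSpace ℝ (Fin m))
    (fun x : M => TangentSpace (𝓡 m) x)}

/-- The vector field dual to a one-form. -/
def dualField (θ : Π x : M, TangentSpace (𝓡 m) x →ₗ[ℝ] ℝ) (x : M) : TangentSpace (𝓡 m) x :=
  ∑ a, θ x (stdOrthonormalBasis ℝ (TangentSpace (𝓡 m) x) a) •
    stdOrthonormalBasis ℝ (TangentSpace (𝓡 m) x) a

theorem inner_dualField (θ : Π x : M, TangentSpace (𝓡 m) x →ₗ[ℝ] ℝ) (x : M)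
    (w : TangentSpace (𝓡 m) x) : (inner ℝ (dualField θ x) w : ℝ) = θ x w := by
  conv_rhs => rw [← (stdOrthonormalBasis ℝ (TangentSpace (𝓡 m) x)).sum_repr' w]
  simp only [dualField, sum_inner, inner_smul_left, map_sum, map_smul, conj_trivial, smul_eq_mul]
  exact Finset.sum_congr rfl fun _ _ => mul_comm _ _

theorem dualField_eq_sum (θ : Π x : M, TangentSpace (𝓡 m) x →ₗ[ℝ] ℝ) (x : M) {ι : Type*}
    [Fintype ι] (e : OrthonormalBasis ι ℝ (TangentSpace (𝓡 m) x)) :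
    dualField θ x = ∑ a, θ x (e a) • e a := by
  rw [← e.sum_repr' (dualField θ x)]
  simp only [real_inner_comm (dualField θ x), inner_dualField]

theorem smoothSection_dualField {θ : Π x : M, TangentSpace (𝓡 m) x →ₗ[ℝ] ℝ}
    (hθ : ∀ Y : Π x : M, TangentSpace (𝓡 m) x, SmoothSection m (EuclideanSpace ℝ (Fin m)) Y →
      ContMDiff (𝓡 m) 𝓘(ℝ) ∞ fun x => θ x (Y x)) :
    SmoothSection m (EuclideanSpace ℝ (Fin m)) (dualField θ) := by
  intro x₀
  obtain ⟨E, hE, hon⟩ := exists_orthonormalBasis_vectorFields m x₀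
  have h : ContMDiff (𝓡 m) ((𝓡 m).prod 𝓘(ℝ, EuclideanSpace ℝ (Fin m))) ∞
      fun x => TotalSpace.mk' (EuclideanSpace ℝ (Fin m)) x (∑ a, θ x (E a x) • E a x) :=
    ContMDiff.sum_section fun a _ => (hθ (E a) (hE a)).smul_section (hE a)
  refine (h x₀).congr_of_eventuallyEq (hon.mono fun x ⟨e, he⟩ => ?_)
  simp only [TotalSpace.mk_inj]
  rw [dualField_eq_sum θ x e]
  simp only [he]

/-- Metric compatibility moves the derivative onto the functions ⟨X, E_b⟩. For the field dual to a
one-form these are the values of the form on the frame, so the dual field itself need not be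
differentiated. -/
theorem divergence_eq_sum (hnabla : nabla.IsMetricCompatible)
    {X : Π x : M, TangentSpace (𝓡 m) x} {x : M}
    (hX : DiffSectionAt m (EuclideanSpace ℝ (Fin m)) X x) {n : ℕ}
    {E : Fin n → Π x : M, TangentSpace (𝓡 m) x}
    (hE : ∀ a, DiffSectionAt m (EuclideanSpace ℝ (Fin m)) (E a) x)
    (e : OrthonormalBasis (Fin n) ℝ (TangentSpace (𝓡 m) x)) (he : ∀ a, e a = E a x) :
    divergence nabla X x = ∑ b, (mvfderiv (𝓡 m) (fun y => (inner ℝ (X y) (E b y) : ℝ)) x (E b x) -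
      inner ℝ (X x) (nabla (E b) x (E b x))) := by
  rw [divergence, LinearMap.trace_eq_sum_inner _ e]
  refine Finset.sum_congr rfl fun b _ => ?_
  rw [mvfderiv_inner_eq hnabla hX (hE b), he, real_inner_comm]
  simp

variable {F : Type*} [NormedAddCommGroup F] [NormedSpace ℝ F] [FiniteDimensional ℝ F]
  {V : M → Type*} [TopologicalSpace (TotalSpace F V)]
  [∀ x, NormedAddCommGroup (V x)] [∀ x, InnerProductSpace ℝ (V x)]
  [FiberBundle F V] [VectorBundle ℝ F V] [ContMDiffVectorBundle ∞ F V (𝓡 m)]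
  [IsContMDiffRiemannianBundle (𝓡 m) ∞ F V]
  {D : CovariantDerivative (𝓡 m) F V}
  {k : ℕ}

theorem tensorInner_add_right {x : M} (S P Q : (Fin k → TangentSpace (𝓡 m) x) → V x) :
    tensorInner x S (P + Q) = tensorInner x S P + tensorInner x S Q := by
  simp [tensorInner, inner_add_right, Finset.sum_add_distrib]

theorem tensorInner_smul_right {x : M} (c : ℝ) (S P : (Fin k → TangentSpace (𝓡 m) x) → V x) :
    tensorInner x S (c • P) = c * tensorInner x S P := by
  simp [tensorInner, inner_smul_right, Finset.mul_sum]

theorem tensorInner_comm {x : M} (S P : (Fin k → TangentSpace (𝓡 m) x) → V x) :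
    tensorInner x S P = tensorInner x P S := by
  simp only [tensorInner]
  exact Finset.sum_congr rfl fun _ _ => real_inner_comm _ _

theorem abs_tensorInner_le {x : M} (S P : (Fin k → TangentSpace (𝓡 m) x) → V x) :
    |tensorInner x S P| ≤ tensorNorm x S * tensorNorm x P := by
  refine (Finset.abs_sum_le_sum_abs _ _).trans
    ((Finset.sum_le_sum fun i _ => abs_real_inner_le_norm _ _).trans ?_)
  exact Real.sum_mul_le_sqrt_mul_sqrt _ _ _

theorem IsMultilinear.insertLast_add {T W : Type*} [NormedAddCommGroup T] [InnerProductSpace ℝ T]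
    [NormedAddCommGroup W] [InnerProductSpace ℝ W] {S : (Fin (k + 1) → T) → W}
    (hS : IsMultilinear S) (a b : T) :
    _root_.insertLast S (a + b) = _root_.insertLast S a + _root_.insertLast S b := by
  obtain ⟨A, rfl⟩ := hS
  funext v
  exact map_add (A.curryRight v) a b

theorem IsMultilinear.insertLast_smul {T W : Type*} [NormedAddCommGroup T]
    [InnerProductSpace ℝ T] [NormedAddCommGroup W] [InnerProductSpace ℝ W]
    {S : (Fin (k + 1) → T) → W} (hS : IsMultilinear S) (c : ℝ) (a : T) :
    _root_.insertLast S (c • a) = c • _root_.insertLast S a := by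
  obtain ⟨A, rfl⟩ := hS
  funext v
  exact map_smul (A.curryRight v) c a

theorem IsSmoothTensor.insertLast {P : Π x : M, (Fin (k + 1) → TangentSpace (𝓡 m) x) → V x}
    (hP : IsSmoothTensor F P) {Y : Π x : M, TangentSpace (𝓡 m) x}
    (hY : SmoothSection m (EuclideanSpace ℝ (Fin m)) Y) :
    IsSmoothTensor F fun x => insertLast (P x) (Y x) := by
  refine ⟨fun x v i a b => ?_, fun x v i c a => ?_, fun X hX => ?_⟩
  · simp only [_root_.insertLast, Fin.snoc_update, hP.update_add]
  · simp only [_root_.insertLast, Fin.snoc_update, hP.update_smul]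
  · have h := hP.smooth (Fin.snoc (α := fun _ => Π x : M, TangentSpace (𝓡 m) x) X Y) (by
      intro i
      induction i using Fin.lastCases with
      | last => simpa using hY
      | cast i => simpa using hX i)
    have h2 : ∀ x : M, (fun i => Fin.snoc (α := fun _ => Π x : M, TangentSpace (𝓡 m) x) X Y i x) =
        Fin.snoc (α := fun _ => TangentSpace (𝓡 m) x) (fun i => X i x) (Y x) := fun x =>
      comp_snoc (fun Z : Π x : M, TangentSpace (𝓡 m) x => Z x) _ _
    simp only [h2] at h
    exact h

end Divergence

/-! ### The pointwise divergence identity and estimate. -/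

section DivergenceIdentity

variable {m : ℕ} {M : Type*} [TopologicalSpace M] [ChartedSpace (EuclideanSpace ℝ (Fin m)) M]
  [IsManifold (𝓡 m) ∞ M] [T2Space M]
  [RiemannianBundle (fun x : M => TangentSpace (𝓡 m) x)]
  [IsContMDiffRiemannianBundle (𝓡 m) ∞ (EuclideanSpace ℝ (Fin m))
    (fun x : M => TangentSpace (𝓡 m) x)]
  {nabla : CovariantDerivative (𝓡 m) (EuclideanSpace ℝ (Fin m))
    (fun x : M => TangentSpace (𝓡 m) x)}
  {F : Type*} [NormedAddCommGroup F] [NormedSpace ℝ F] [FiniteDimensional ℝ F]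
  {V : M → Type*} [TopologicalSpace (TotalSpace F V)]
  [∀ x, NormedAddCommGroup (V x)] [∀ x, InnerProductSpace ℝ (V x)]
  [FiberBundle F V] [VectorBundle ℝ F V] [ContMDiffVectorBundle ∞ F V (𝓡 m)]
  [IsContMDiffRiemannianBundle (𝓡 m) ∞ F V]
  {D : CovariantDerivative (𝓡 m) F V}
  {k : ℕ}

/-- The Leibniz rule for the contraction of P with Y: among the correction terms in DP, the one for
the last slot accounts for P(·, ∇_w Y). The direction w is inserted before Y because the
differentiation slot comes last. -/
theorem insertLast_tensorCovDeriv_insertLast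
    {P : Π x : M, (Fin (k + 1) → TangentSpace (𝓡 m) x) → V x} (hP : IsSmoothTensor F P)
    {Y : Π x : M, TangentSpace (𝓡 m) x} (hY : SmoothSection m (EuclideanSpace ℝ (Fin m)) Y)
    (x : M) (w : TangentSpace (𝓡 m) x) :
    insertLast (tensorCovDeriv nabla D (fun y => insertLast (P y) (Y y)) x) w =
      insertLast (insertLast (tensorCovDeriv nabla D P x) w) (Y x) +
        insertLast (P x) (nabla Y x w) := by
  funext v
  let X : Fin k → Π x : M, TangentSpace (𝓡 m) x := fun i =>
    FiberBundle.extend (EuclideanSpace ℝ (Fin m)) (v i)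
  have hX : ∀ i, DiffSectionAt m (EuclideanSpace ℝ (Fin m)) (X i) x := fun i =>
    FiberBundle.mdifferentiableAt_extend ..
  have hXv : (fun i => X i x) = v := by funext i; simp [X]
  have hYd : DiffSectionAt m (EuclideanSpace ℝ (Fin m)) Y x := hY.mdifferentiableAt (by simp)
  let Z : Fin (k + 1) → Π x : M, TangentSpace (𝓡 m) x :=
    Fin.snoc (α := fun _ => Π x : M, TangentSpace (𝓡 m) x) X Y
  have hZ : ∀ i, DiffSectionAt m (EuclideanSpace ℝ (Fin m)) (Z i) x := by
    intro i
    induction i using Fin.lastCases with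
    | last => simpa [Z] using hYd
    | cast i => simpa [Z] using hX i
  have hZx : ∀ y : M, (fun i => Z i y) =
      Fin.snoc (α := fun _ => TangentSpace (𝓡 m) y) (fun i => X i y) (Y y) := fun y =>
    comp_snoc (fun Z : Π x : M, TangentSpace (𝓡 m) x => Z y) _ _
  have h1 := insertLast_tensorCovDeriv (nabla := nabla) (D := D) (hP.insertLast hY) hX w
  have h2 := insertLast_tensorCovDeriv (nabla := nabla) (D := D) hP hZ w
  rw [Fin.sum_univ_castSucc] at h2
  simp only [hZx] at h2
  simp only [Z, Fin.snoc_castSucc, Fin.snoc_last, Fin.update_snoc_last, ← Fin.snoc_update] at h2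
  rw [hXv] at h1 h2
  rw [h1]
  simp only [Pi.add_apply]
  simp only [insertLast] at h2 ⊢
  rw [h2]
  abel

/-- The one-form `w ↦ φ ⟨S, P(·, w)⟩`. -/
def pairingForm (φ : M → ℝ) {S : Π x : M, (Fin k → TangentSpace (𝓡 m) x) → V x}
    {P : Π x : M, (Fin (k + 1) → TangentSpace (𝓡 m) x) → V x}
    (hP : ∀ x, IsMultilinear (P x)) (x : M) : TangentSpace (𝓡 m) x →ₗ[ℝ] ℝ where
  toFun w := φ x * tensorInner x (S x) (insertLast (P x) w)
  map_add' a b := by rw [(hP x).insertLast_add, tensorInner_add_right, mul_add]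
  map_smul' c a := by
    rw [(hP x).insertLast_smul, tensorInner_smul_right, RingHom.id_apply, smul_eq_mul]
    ring

variable [CovariantDerivative.ContMDiffCovariantDerivative nabla ∞]
  [CovariantDerivative.ContMDiffCovariantDerivative D ∞]

theorem smoothSection_pairingField {φ : M → ℝ} (hφ : ContMDiff (𝓡 m) 𝓘(ℝ) ∞ φ)
    {S : Π x : M, (Fin k → TangentSpace (𝓡 m) x) → V x} (hS : IsSmoothTensor F S)
    {P : Π x : M, (Fin (k + 1) → TangentSpace (𝓡 m) x) → V x} (hP : IsSmoothTensor F P) :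
    SmoothSection m (EuclideanSpace ℝ (Fin m))
      (dualField (pairingForm φ (S := S) hP.isMultilinear)) :=
  smoothSection_dualField fun _ hY => hφ.mul (contMDiff_tensorInner hS (hP.insertLast hY))

/-- The product rule applied to φ⟨S, D_b S⟩ in an orthonormal frame. The terms containing ∇_b E_b
from the contraction cancel those in `divergence_eq_sum`. -/
theorem divergence_pairingField
    (hnabla : nabla.IsMetricCompatible) (hD : D.IsMetricCompatible)
    {φ : M → ℝ} (hφ : ContMDiff (𝓡 m) 𝓘(ℝ) ∞ φ)
    {S : Π x : M, (Fin k → TangentSpace (𝓡 m) x) → V x} (hS : IsSmoothTensor F S) (x : M) :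
    ∃ e : OrthonormalBasis (Fin m) ℝ (TangentSpace (𝓡 m) x),
    divergence nabla (dualField (pairingForm φ (S := S)
        (hS.tensorCovDeriv (nabla := nabla) (D := D)).isMultilinear)) x =
      φ x * tensorInner x (tensorCovDeriv nabla D S x) (tensorCovDeriv nabla D S x) +
      φ x * ∑ b, tensorInner x (S x) (insertLast (insertLast
        (tensorCovDeriv nabla D (tensorCovDeriv nabla D S) x) (e b)) (e b)) +
      ∑ b, mvfderiv (𝓡 m) φ x (e b) *
        tensorInner x (S x) (insertLast (tensorCovDeriv nabla D S x) (e b)) := by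
  have hP : IsSmoothTensor F (tensorCovDeriv nabla D S) := hS.tensorCovDeriv
  obtain ⟨E, hE, hon⟩ := exists_orthonormalBasis_vectorFields m x
  obtain ⟨e, he⟩ := hon.self_of_nhds
  have hEd : ∀ i, DiffSectionAt m (EuclideanSpace ℝ (Fin m)) (E i) x := fun i =>
    (hE i).mdifferentiableAt (by simp)
  refine ⟨e, ?_⟩
  rw [divergence_eq_sum hnabla ((smoothSection_pairingField hφ hS hP).mdifferentiableAt (by simp))
    hEd e he, tensorInner_eq_sum_insertLast (hP.isMultilinear x) (hP.isMultilinear x) e,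
    ← mul_add, ← Finset.sum_add_distrib, Finset.mul_sum, ← Finset.sum_add_distrib]
  refine Finset.sum_congr rfl fun b _ => ?_
  simp only [inner_dualField]
  have hQ : IsSmoothTensor F fun y => insertLast (tensorCovDeriv nabla D S y) (E b y) :=
    hP.insertLast (hE b)
  have h1 : mvfderiv (𝓡 m) (fun y => φ y * tensorInner y (S y)
      (insertLast (tensorCovDeriv nabla D S y) (E b y))) x (E b x) =
      φ x * (tensorInner x (insertLast (tensorCovDeriv nabla D S x) (E b x))
          (insertLast (tensorCovDeriv nabla D S x) (E b x)) +
        (tensorInner x (S x) (insertLast (insertLast (tensorCovDeriv nabla D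
          (tensorCovDeriv nabla D S) x) (E b x)) (E b x)) +
        tensorInner x (S x) (insertLast (tensorCovDeriv nabla D S x)
          (nabla (E b) x (E b x))))) +
      tensorInner x (S x) (insertLast (tensorCovDeriv nabla D S x) (E b x)) *
        mvfderiv (𝓡 m) φ x (E b x) := by
    rw [mvfderiv_fun_mul (hφ.mdifferentiableAt (by simp))
      ((contMDiff_tensorInner hS hQ).mdifferentiableAt (by simp)), add_apply, smul_apply,
      smul_apply, mvfderiv_tensorInner hnabla hD hS hQ x (E b x) (hP.isMultilinear x)
      (hQ.tensorCovDeriv.isMultilinear x), insertLast_tensorCovDeriv_insertLast hP (hE b),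
      tensorInner_add_right]
    rfl
  change mvfderiv (𝓡 m) (fun y => φ y * tensorInner y (S y)
      (insertLast (tensorCovDeriv nabla D S y) (E b y))) x (E b x) - φ x * tensorInner x (S x)
        (insertLast (tensorCovDeriv nabla D S x) (nabla (E b) x (E b x))) = _
  rw [h1, he]
  ring

theorem sum_tensorNorm_insertLast_sq {x : M} {S : (Fin (k + 1) → TangentSpace (𝓡 m) x) → V x}
    (hS : IsMultilinear S) {ι : Type*} [Fintype ι]
    (b : OrthonormalBasis ι ℝ (TangentSpace (𝓡 m) x)) :
    ∑ a, tensorNorm x (insertLast S (b a)) ^ 2 = tensorNorm x S ^ 2 := by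
  simp only [tensorNorm_sq]
  exact (tensorInner_eq_sum_insertLast hS hS b).symm

theorem mvfderiv_comp_hasDerivAt {g : ℝ → ℝ} {f : M → ℝ} {x : M} {g' : ℝ}
    (hg : HasDerivAt g g' (f x)) (hf : MDifferentiableAt (𝓡 m) 𝓘(ℝ) f x)
    (w : TangentSpace (𝓡 m) x) :
    mvfderiv (𝓡 m) (fun y => g (f y)) x w = g' * mvfderiv (𝓡 m) f x w := by
  have h := hg.hasFDerivAt.hasMFDerivAt.comp x hf.hasMFDerivAt
  have h2 : mfderiv (𝓡 m) 𝓘(ℝ) (fun y => g (f y)) x = _ := h.mfderiv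
  have h3 : mvfderiv (𝓡 m) (fun y => g (f y)) x w =
      ContinuousLinearMap.toSpanSingleton ℝ g' (mvfderiv (𝓡 m) f x w) := by
    simp only [mvfderiv, h2]
    rfl
  rw [h3, ContinuousLinearMap.toSpanSingleton_apply, smul_eq_mul, mul_comm]

theorem abs_mul_sum_le_of_sq {ι : Type*} [Fintype ι] (f g : ι → ℝ) {A B : ℝ} (hA : 0 ≤ A)
    (hB : 0 ≤ B) (hf : ∑ i, f i ^ 2 ≤ A ^ 2) (hg : ∑ i, g i ^ 2 ≤ B ^ 2) :
    ∑ i, f i * g i ≤ A * B := by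
  refine (Real.sum_mul_le_sqrt_mul_sqrt _ f g).trans ?_
  exact mul_le_mul (Real.sqrt_le_iff.2 ⟨hA, hf⟩) (Real.sqrt_le_iff.2 ⟨hB, hg⟩)
    (Real.sqrt_nonneg _) hA

/-- The pointwise estimate behind the interpolation inequality for a finite exponent. -/
theorem mul_tensorNorm_sq_le_divergence
    (hnabla : nabla.IsMetricCompatible) (hD : D.IsMetricCompatible)
    {S : Π x : M, (Fin k → TangentSpace (𝓡 m) x) → V x} (hS : IsSmoothTensor F S)
    {α ε : ℝ} (hα : 0 ≤ α) (hε : 0 < ε) (x : M) :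
    (tensorNorm x (tensorCovDeriv nabla D S x) ^ 2 + ε) ^ α *
        tensorNorm x (tensorCovDeriv nabla D S x) ^ 2 ≤
      divergence nabla (dualField (pairingForm (fun y =>
        (tensorNorm y (tensorCovDeriv nabla D S y) ^ 2 + ε) ^ α) (S := S)
        (hS.tensorCovDeriv (nabla := nabla) (D := D)).isMultilinear)) x +
      (Real.sqrt m + 2 * α) * (tensorNorm x (S x) *
        tensorNorm x (tensorCovDeriv nabla D (tensorCovDeriv nabla D S) x) *
        (tensorNorm x (tensorCovDeriv nabla D S x) ^ 2 + ε) ^ α) ∧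
    SmoothSection m (EuclideanSpace ℝ (Fin m)) (dualField (pairingForm (fun y =>
        (tensorNorm y (tensorCovDeriv nabla D S y) ^ 2 + ε) ^ α) (S := S)
        (hS.tensorCovDeriv (nabla := nabla) (D := D)).isMultilinear)) := by
  have hP : IsSmoothTensor F (tensorCovDeriv nabla D S) := hS.tensorCovDeriv
  have hQ : IsSmoothTensor F (tensorCovDeriv nabla D (tensorCovDeriv nabla D S)) :=
    hP.tensorCovDeriv
  have hu : ContMDiff (𝓡 m) 𝓘(ℝ) ∞ fun y => tensorNorm y (tensorCovDeriv nabla D S y) ^ 2 := by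
    simp only [tensorNorm_sq]
    exact contMDiff_tensorInner hP hP
  -- Positivity of ε makes the real power smooth even where DS vanishes.
  have hpos : ∀ y, 0 < tensorNorm y (tensorCovDeriv nabla D S y) ^ 2 + ε := fun y => by positivity
  have hg : ∀ y, ContDiffAt ℝ ∞ (fun t : ℝ => (t + ε) ^ α)
      (tensorNorm y (tensorCovDeriv nabla D S y) ^ 2) := fun y =>
    (contDiffAt_id.add contDiffAt_const).rpow_const_of_ne (hpos y).ne'
  have hφ : ContMDiff (𝓡 m) 𝓘(ℝ) ∞ fun y =>
      (tensorNorm y (tensorCovDeriv nabla D S y) ^ 2 + ε) ^ α := fun y =>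
    ContMDiffAt.comp (g := fun t : ℝ => (t + ε) ^ α) y (hg y).contMDiffAt (hu y)
  refine ⟨?_, smoothSection_pairingField hφ hS hP⟩
  obtain ⟨e, he⟩ := divergence_pairingField hnabla hD hφ hS x
  have hdφ : ∀ w, mvfderiv (𝓡 m) (fun y =>
      (tensorNorm y (tensorCovDeriv nabla D S y) ^ 2 + ε) ^ α) x w =
      α * (tensorNorm x (tensorCovDeriv nabla D S x) ^ 2 + ε) ^ (α - 1) *
        (2 * tensorInner x (insertLast (tensorCovDeriv nabla D (tensorCovDeriv nabla D S) x) w)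
          (tensorCovDeriv nabla D S x)) := by
    intro w
    have hd : HasDerivAt (fun t : ℝ => (t + ε) ^ α)
        (α * (tensorNorm x (tensorCovDeriv nabla D S x) ^ 2 + ε) ^ (α - 1))
        (tensorNorm x (tensorCovDeriv nabla D S x) ^ 2) := by
      simpa using! ((hasDerivAt_id _).add_const ε).rpow_const (p := α) (Or.inl (hpos x).ne')
    have h2 : mvfderiv (𝓡 m) (fun y => tensorNorm y (tensorCovDeriv nabla D S y) ^ 2) x w =
        2 * tensorInner x (insertLast (tensorCovDeriv nabla D (tensorCovDeriv nabla D S) x) w)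
          (tensorCovDeriv nabla D S x) := by
      simp only [tensorNorm_sq]
      rw [mvfderiv_tensorInner hnabla hD hP hP x w (hQ.isMultilinear x) (hQ.isMultilinear x),
        tensorInner_comm (tensorCovDeriv nabla D S x)]
      ring
    rw [mvfderiv_comp_hasDerivAt
      (f := fun y => tensorNorm y (tensorCovDeriv nabla D S y) ^ 2) hd
          (hu.mdifferentiableAt (by simp)) w, h2]
  rw [he]
  simp only [hdφ]
  set N := tensorNorm x (tensorCovDeriv nabla D S x) with hN
  set A := tensorNorm x (S x) with hA
  set B := tensorNorm x (tensorCovDeriv nabla D (tensorCovDeriv nabla D S) x) with hB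
  have hN0 : 0 ≤ N := tensorNorm_nonneg x _
  have hA0 : 0 ≤ A := tensorNorm_nonneg x _
  have hB0 : 0 ≤ B := tensorNorm_nonneg x _
  -- Cauchy–Schwarz over the m diagonal entries of D²S; this is the origin of √m.
  have hQ1 : ∑ b, |tensorInner x (S x) (insertLast (insertLast
      (tensorCovDeriv nabla D (tensorCovDeriv nabla D S) x) (e b)) (e b))| ≤
      A * (Real.sqrt m * B) := by
    calc _ ≤ ∑ b, A * (1 * tensorNorm x (insertLast (insertLast
          (tensorCovDeriv nabla D (tensorCovDeriv nabla D S) x) (e b)) (e b))) :=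
          Finset.sum_le_sum fun b _ => (abs_tensorInner_le _ _).trans_eq (by rw [one_mul])
      _ ≤ A * (Real.sqrt m * B) := by
          rw [← Finset.mul_sum]
          refine mul_le_mul_of_nonneg_left (abs_mul_sum_le_of_sq _ _ (Real.sqrt_nonneg _) hB0
            (by simp) ?_) hA0
          rw [hB, ← sum_tensorNorm_insertLast_sq (hQ.isMultilinear x) e]
          refine Finset.sum_le_sum fun b _ => ?_
          rw [← sum_tensorNorm_insertLast_sq ((hQ.isMultilinear x).insertLast (e b)) e]
          exact Finset.single_le_sum (f := fun a => tensorNorm x (insertLast (insertLast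
            (tensorCovDeriv nabla D (tensorCovDeriv nabla D S) x) (e b)) (e a)) ^ 2)
            (fun _ _ => sq_nonneg _) (Finset.mem_univ b)
  have hQ2 : ∑ b, |tensorInner x (insertLast
      (tensorCovDeriv nabla D (tensorCovDeriv nabla D S) x) (e b)) (tensorCovDeriv nabla D S x) *
      tensorInner x (S x) (insertLast (tensorCovDeriv nabla D S x) (e b))| ≤
      N * A * (B * N) := by
    calc _ ≤ ∑ b, N * A * (tensorNorm x (insertLast
          (tensorCovDeriv nabla D (tensorCovDeriv nabla D S) x) (e b)) *
          tensorNorm x (insertLast (tensorCovDeriv nabla D S x) (e b))) := by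
          refine Finset.sum_le_sum fun b _ => ?_
          rw [abs_mul]
          refine (mul_le_mul (abs_tensorInner_le _ _) (abs_tensorInner_le _ _) (abs_nonneg _)
            (mul_nonneg (tensorNorm_nonneg x _) hN0)).trans_eq ?_
          ring
      _ ≤ N * A * (B * N) := by
          rw [← Finset.mul_sum]
          exact mul_le_mul_of_nonneg_left (abs_mul_sum_le_of_sq _ _ hB0 hN0
            (sum_tensorNorm_insertLast_sq (hQ.isMultilinear x) e).le
            (sum_tensorNorm_insertLast_sq (hP.isMultilinear x) e).le) (mul_nonneg hN0 hA0)
  have hU : 0 < N ^ 2 + ε := hpos x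
  -- The weight φ and its differential then share the factor ψ. The contribution of dφ is at most
  -- 2αψABN², which is at most 2αφAB because N² ≤ N² + ε.
  have hφψ : (N ^ 2 + ε) ^ α = (N ^ 2 + ε) ^ (α - 1) * (N ^ 2 + ε) := by
    rw [Real.rpow_sub_one hU.ne', div_mul_cancel₀ _ hU.ne']
  have hψ0 : 0 ≤ (N ^ 2 + ε) ^ (α - 1) := (Real.rpow_pos_of_pos hU _).le
  set ψ := (N ^ 2 + ε) ^ (α - 1) with hψ
  have e1 := (Finset.abs_sum_le_sum_abs _ _).trans hQ1
  have e2 := (Finset.abs_sum_le_sum_abs _ _).trans hQ2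
  set q := ∑ b, tensorInner x (S x) (insertLast (insertLast
      (tensorCovDeriv nabla D (tensorCovDeriv nabla D S) x) (e b)) (e b))
  set p := ∑ b, tensorInner x (insertLast
      (tensorCovDeriv nabla D (tensorCovDeriv nabla D S) x) (e b)) (tensorCovDeriv nabla D S x) *
      tensorInner x (S x) (insertLast (tensorCovDeriv nabla D S x) (e b)) with hp
  have e3 : ∑ b, α * ψ * (2 * tensorInner x (insertLast
      (tensorCovDeriv nabla D (tensorCovDeriv nabla D S) x) (e b)) (tensorCovDeriv nabla D S x)) *
      tensorInner x (S x) (insertLast (tensorCovDeriv nabla D S x) (e b)) = 2 * α * ψ * p := by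
    rw [hp, Finset.mul_sum]
    exact Finset.sum_congr rfl fun _ _ => by ring
  rw [e3, hφψ, ← tensorNorm_sq, ← hN]
  have e1' := mul_le_mul_of_nonneg_left (neg_le_of_abs_le e1) (mul_nonneg hψ0 hU.le)
  have e2' := mul_le_mul_of_nonneg_left (neg_le_of_abs_le e2)
    (mul_nonneg (mul_nonneg zero_le_two hα) hψ0)
  have e4 : 0 ≤ 2 * α * ψ * (A * B * ε) := by positivity
  nlinarith [e1', e2', e4]

end DivergenceIdentity

/-! ### Coordinate fields, the chart density and the Riemannian volume. -/

section CoordinateFields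

variable {m : ℕ} {M : Type*} [TopologicalSpace M] [ChartedSpace (EuclideanSpace ℝ (Fin m)) M]
  [IsManifold (𝓡 m) ∞ M]

/-- The coordinate vector field `∂/∂xⁱ` of the preferred chart around `c`. -/
def coordField (c : M) (i : Fin m) (y : M) : TangentSpace (𝓡 m) y :=
  (trivializationAt (EuclideanSpace ℝ (Fin m)) (TangentSpace (𝓡 m)) c).localFrame
    (EuclideanSpace.basisFun (Fin m) ℝ).toBasis i y

theorem mem_baseSet_iff (c y : M) :
    y ∈ (trivializationAt (EuclideanSpace ℝ (Fin m)) (TangentSpace (𝓡 m)) c).baseSet ↔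
      y ∈ (extChartAt (𝓡 m) c).source := by
  rw [TangentBundle.trivializationAt_baseSet, extChartAt_source]

theorem isOpen_target (c : M) : IsOpen (extChartAt (𝓡 m) c).target :=
  isOpen_extChartAt_target c

theorem isLocalFrameOn_coordField (c : M) :
    IsLocalFrameOn (𝓡 m) (EuclideanSpace ℝ (Fin m)) ∞ (coordField (m := m) c)
      (extChartAt (𝓡 m) c).source := by
  have h := (trivializationAt (EuclideanSpace ℝ (Fin m))
    (TangentSpace (𝓡 m)) c).isLocalFrameOn_localFrame_baseSet (𝓡 m) ∞
    (EuclideanSpace.basisFun (Fin m) ℝ).toBasis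
  rw [extChartAt_source, ← TangentBundle.trivializationAt_baseSet (I := 𝓡 m) c]
  exact h

theorem coordField_eq_symmL {c y : M} (hy : y ∈ (extChartAt (𝓡 m) c).source) (i : Fin m) :
    coordField c i y = (trivializationAt (EuclideanSpace ℝ (Fin m))
      (TangentSpace (𝓡 m)) c).symmL ℝ y (EuclideanSpace.single i (1 : ℝ)) := by
  have hy' := (mem_baseSet_iff c y).2 hy
  rw [coordField, Bundle.Trivialization.localFrame_apply_of_mem_baseSet _ _ hy',
    Bundle.Trivialization.basisAt, Module.Basis.map_apply, OrthonormalBasis.coe_toBasis,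
    EuclideanSpace.basisFun_apply]
  exact (Bundle.Trivialization.symmL_apply (R := ℝ) _ hy' _).symm

/-- The form suited to comparing two charts, since `tangentCoordChange` satisfies a cocycle
relation. -/
theorem coordField_eq_tangentCoordChange {c y : M} (hy : y ∈ (extChartAt (𝓡 m) c).source)
    (i : Fin m) :
    coordField c i y = tangentCoordChange (𝓡 m) c y y (EuclideanSpace.single i (1 : ℝ)) := by
  rw [coordField_eq_symmL hy, TangentBundle.symmL_trivializationAt_eq_core
    (by rwa [extChartAt_source] at hy)]
  rfl

theorem coordField_eq_mfderiv {c y : M} (hy : y ∈ (extChartAt (𝓡 m) c).source) (i : Fin m) :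
    coordField c i y = mfderiv 𝓘(ℝ, EuclideanSpace ℝ (Fin m)) (𝓡 m) (extChartAt (𝓡 m) c).symm
      (extChartAt (𝓡 m) c y) (EuclideanSpace.single i (1 : ℝ)) := by
  rw [coordField_eq_symmL hy, TangentBundle.symmL_trivializationAt
    (by rwa [extChartAt_source] at hy), ← mfderivWithin_univ,
    ModelWithCorners.range_eq_univ]
  rfl

theorem mfderiv_single_eq_coordField {c : M} {z : EuclideanSpace ℝ (Fin m)}
    (hz : z ∈ (extChartAt (𝓡 m) c).target) (i : Fin m) :
    mfderiv 𝓘(ℝ, EuclideanSpace ℝ (Fin m)) (𝓡 m) (extChartAt (𝓡 m) c).symm z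
      (EuclideanSpace.single i (1 : ℝ)) = coordField c i ((extChartAt (𝓡 m) c).symm z) := by
  have h := coordField_eq_mfderiv ((extChartAt (𝓡 m) c).map_target hz) i
  have hz' := (extChartAt (𝓡 m) c).right_inv hz
  -- The base point is replaced by substitution, with values read in the model space, because the
  -- tangent spaces at the two points are distinct types.
  have key : ∀ z' : EuclideanSpace ℝ (Fin m), z' = z →
      (mfderiv 𝓘(ℝ, EuclideanSpace ℝ (Fin m)) (𝓡 m) (extChartAt (𝓡 m) c).symm z'
        (EuclideanSpace.single i (1 : ℝ)) : EuclideanSpace ℝ (Fin m)) =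
      (mfderiv 𝓘(ℝ, EuclideanSpace ℝ (Fin m)) (𝓡 m) (extChartAt (𝓡 m) c).symm z
        (EuclideanSpace.single i (1 : ℝ)) : EuclideanSpace ℝ (Fin m)) := by
    rintro z' rfl; rfl
  rw [h]
  exact (key _ hz').symm

variable [RiemannianBundle (fun x : M => TangentSpace (𝓡 m) x)]

/-- The Gram matrix of the coordinate fields. -/
def coordGram (c y : M) : Matrix (Fin m) (Fin m) ℝ :=
  Matrix.gram ℝ fun i => coordField c i y

theorem metricCoeff_eq_coordGram {c : M} {z : EuclideanSpace ℝ (Fin m)}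
    (hz : z ∈ (extChartAt (𝓡 m) c).target) :
    metricCoeff c z = coordGram (m := m) c ((extChartAt (𝓡 m) c).symm z) := by
  rw [metricCoeff, coordGram]
  congr 1
  funext i
  exact mfderiv_single_eq_coordField hz i

theorem det_coordGram_pos {c y : M} (hy : y ∈ (extChartAt (𝓡 m) c).source) :
    0 < (coordGram (m := m) c y).det := by
  have h : LinearIndependent ℝ fun i => coordField (m := m) c i y :=
    (isLocalFrameOn_coordField c).linearIndependent hy
  have h2 := Matrix.posDef_gram_of_linearIndependent h
  exact h2.det_pos

/-- The Jacobian matrix of a change of coordinates. -/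
def coordChangeMatrix (c d y : M) : Matrix (Fin m) (Fin m) ℝ :=
  LinearMap.toMatrix (EuclideanSpace.basisFun (Fin m) ℝ).toBasis
    (EuclideanSpace.basisFun (Fin m) ℝ).toBasis (tangentCoordChange (𝓡 m) c d y).toLinearMap

theorem coordField_eq_sum {c d y : M} (hc : y ∈ (extChartAt (𝓡 m) c).source)
    (hd : y ∈ (extChartAt (𝓡 m) d).source) (i : Fin m) :
    coordField c i y = ∑ j, coordChangeMatrix c d y j i • coordField d j y := by
  simp only [coordField_eq_tangentCoordChange hc, coordField_eq_tangentCoordChange hd]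
  have h1 := tangentCoordChange_comp (I := 𝓡 m) (w := c) (x := d) (y := y) (z := y)
    (v := EuclideanSpace.single i (1 : ℝ)) ⟨⟨hc, hd⟩, mem_extChartAt_source y⟩
  have h2 : tangentCoordChange (𝓡 m) c d y (EuclideanSpace.single i (1 : ℝ)) =
      ∑ j, coordChangeMatrix c d y j i • EuclideanSpace.single j (1 : ℝ) := by
    rw [← (EuclideanSpace.basisFun (Fin m) ℝ).toBasis.sum_repr
      (tangentCoordChange (𝓡 m) c d y (EuclideanSpace.single i (1 : ℝ)))]
    simp [coordChangeMatrix, LinearMap.toMatrix_apply]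
  rw [h2] at h1
  exact h1.symm.trans (by rw [map_sum]; simp only [map_smul]; rfl)

theorem coordGram_change {c d y : M} (hc : y ∈ (extChartAt (𝓡 m) c).source)
    (hd : y ∈ (extChartAt (𝓡 m) d).source) :
    coordGram (m := m) c y =
      (coordChangeMatrix c d y).transpose * coordGram (m := m) d y * coordChangeMatrix c d y := by
  ext i j
  simp only [coordGram, Matrix.gram_apply, coordField_eq_sum hc hd, sum_inner, inner_sum,
    inner_smul_left, inner_smul_right, conj_trivial, Matrix.mul_apply, Matrix.transpose_apply,
    Finset.sum_mul, Finset.mul_sum]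
  refine Finset.sum_congr rfl fun a _ => Finset.sum_congr rfl fun b _ => ?_
  ring

/-- The Gram matrices are congruent through the Jacobian J, so the square root of the determinant
acquires |det J|, the factor in the change of variables formula. -/
theorem sqrt_det_coordGram_change {c d y : M} (hc : y ∈ (extChartAt (𝓡 m) c).source)
    (hd : y ∈ (extChartAt (𝓡 m) d).source) :
    Real.sqrt (coordGram (m := m) c y).det =
      |(tangentCoordChange (𝓡 m) c d y).det| * Real.sqrt (coordGram (m := m) d y).det := by
  have hdet : (coordChangeMatrix c d y).det = (tangentCoordChange (𝓡 m) c d y).det :=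
    LinearMap.det_toMatrix _ _
  rw [coordGram_change hc hd, Matrix.det_mul, Matrix.det_mul, Matrix.det_transpose, hdet,
    mul_right_comm, Real.sqrt_mul (mul_self_nonneg _), Real.sqrt_mul_self_eq_abs]

variable [IsContMDiffRiemannianBundle (𝓡 m) ∞ (EuclideanSpace ℝ (Fin m))
      (fun x : M => TangentSpace (𝓡 m) x)]

theorem contMDiffOn_coordGram (c : M) (i j : Fin m) :
    ContMDiffOn (𝓡 m) 𝓘(ℝ) ∞ (fun y => coordGram (m := m) c y i j) (extChartAt (𝓡 m) c).source :=
  ((isLocalFrameOn_coordField c).contMDiffOn i).inner_bundle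
    ((isLocalFrameOn_coordField c).contMDiffOn j)

/-- The density of the Riemannian volume in the chart around `c`, as a function on `M`. -/
def chartDensity (c y : M) : ℝ := Real.sqrt (coordGram (m := m) c y).det

theorem chartDensity_pos {c y : M} (hy : y ∈ (extChartAt (𝓡 m) c).source) :
    0 < chartDensity (m := m) c y := Real.sqrt_pos.2 (det_coordGram_pos hy)

theorem contMDiffOn_det_coordGram (c : M) :
    ContMDiffOn (𝓡 m) 𝓘(ℝ) ∞ (fun y => (coordGram (m := m) c y).det)
      (extChartAt (𝓡 m) c).source := by
  simp only [Matrix.det_apply]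
  refine contMDiffOn_finsetSum fun σ _ => ?_
  have h : ContMDiffOn (𝓡 m) 𝓘(ℝ) ∞ (fun y => ∏ i, coordGram (m := m) c y (σ i) i)
      (extChartAt (𝓡 m) c).source :=
    contMDiffOn_finsetProd fun i _ => contMDiffOn_coordGram c (σ i) i
  have h2 : ContMDiffOn (𝓡 m) 𝓘(ℝ) ∞ (fun _ : M => (((Equiv.Perm.sign σ : ℤˣ) : ℤ) : ℝ))
      (extChartAt (𝓡 m) c).source := contMDiffOn_const
  refine (h2.mul h).congr fun y _ => ?_
  simp [Units.smul_def]

theorem contMDiffOn_chartDensity (c : M) :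
    ContMDiffOn (𝓡 m) 𝓘(ℝ) ∞ (fun y => chartDensity (m := m) c y) (extChartAt (𝓡 m) c).source := by
  intro y hy
  exact ((Real.contDiffAt_sqrt (det_coordGram_pos hy).ne').contMDiffAt).comp_contMDiffWithinAt y
    (contMDiffOn_det_coordGram c y hy)

variable [MeasurableSpace M] [BorelSpace M]

/-- The inverse chart is continuous only on its target, so measurability is obtained on that subtype
and pushed forward. -/
theorem measurableSet_target_inter_preimage (c : M) {s : Set M} (hs : MeasurableSet s) :
    MeasurableSet ((extChartAt (𝓡 m) c).symm ⁻¹' s ∩ (extChartAt (𝓡 m) c).target) := by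
  have h : Measurable ((extChartAt (𝓡 m) c).target.domRestrict (extChartAt (𝓡 m) c).symm) :=
    (continuousOn_iff_continuous_domRestrict.1 (continuousOn_extChartAt_symm c)).measurable
  have h2 := (isOpen_target c).measurableSet.subtype_image (h hs)
  convert h2 using 1
  ext z
  simp [Set.domRestrict]

theorem aemeasurable_symm (c : M) {f : EuclideanSpace ℝ (Fin m) → ℝ≥0∞} :
    AEMeasurable (extChartAt (𝓡 m) c).symm
      (((volume : Measure (EuclideanSpace ℝ (Fin m))).restrict
        (extChartAt (𝓡 m) c).target).withDensity f) :=
  ((continuousOn_extChartAt_symm c).aemeasurable (isOpen_target c).measurableSet).mono_ac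
    (withDensity_absolutelyContinuous _ _)

theorem chartVolume_apply (c : M) {s : Set M} (hs : MeasurableSet s) :
    chartVolume (m := m) c s = ∫⁻ z in (extChartAt (𝓡 m) c).symm ⁻¹' s ∩
        (extChartAt (𝓡 m) c).target,
      ENNReal.ofReal (chartDensity (m := m) c ((extChartAt (𝓡 m) c).symm z)) := by
  rw [chartVolume, Measure.map_apply_of_aemeasurable (aemeasurable_symm c) hs,
    withDensity_apply', Measure.restrict_restrict' (isOpen_target c).measurableSet]
  refine setLIntegral_congr_fun (measurableSet_target_inter_preimage c hs) fun z hz => ?_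
  simp only [chartDensity, metricCoeff_eq_coordGram hz.2]

/-- Change of variables under the transition map, whose Jacobian cancels against the transformation
of the density. -/
theorem chartVolume_eq_of_subset {c d : M} {s : Set M} (hs : MeasurableSet s)
    (hc : s ⊆ (extChartAt (𝓡 m) c).source) (hd : s ⊆ (extChartAt (𝓡 m) d).source) :
    chartVolume (m := m) c s = chartVolume (m := m) d s := by
  rw [chartVolume_apply c hs, chartVolume_apply d hs]
  set A := (extChartAt (𝓡 m) c).symm ⁻¹' s ∩ (extChartAt (𝓡 m) c).target with hA
  have himg : (extChartAt (𝓡 m) d).symm ⁻¹' s ∩ (extChartAt (𝓡 m) d).target =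
      ((extChartAt (𝓡 m) d) ∘ (extChartAt (𝓡 m) c).symm) '' A := by
    ext z
    constructor
    · rintro ⟨hz, hzt⟩
      refine ⟨extChartAt (𝓡 m) c ((extChartAt (𝓡 m) d).symm z), ⟨?_, ?_⟩, ?_⟩
      · rw [Set.mem_preimage, (extChartAt (𝓡 m) c).left_inv (hc hz)]
        exact hz
      · exact (extChartAt (𝓡 m) c).map_source (hc hz)
      · simp only [Function.comp_apply]
        rw [(extChartAt (𝓡 m) c).left_inv (hc hz), (extChartAt (𝓡 m) d).right_inv hzt]
    · rintro ⟨w, ⟨hw, hwt⟩, rfl⟩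
      refine ⟨?_, (extChartAt (𝓡 m) d).map_source (hd hw)⟩
      simp only [Function.comp_apply, Set.mem_preimage]
      rw [(extChartAt (𝓡 m) d).left_inv (hd hw)]
      exact hw
  rw [himg, lintegral_image_eq_lintegral_abs_det_fderiv_mul volume
    (measurableSet_target_inter_preimage c hs)
    (f' := fun z => tangentCoordChange (𝓡 m) c d ((extChartAt (𝓡 m) c).symm z))]
  · refine setLIntegral_congr_fun (measurableSet_target_inter_preimage c hs) fun z hz => ?_
    simp only [Function.comp_apply]
    rw [(extChartAt (𝓡 m) d).left_inv (hd hz.1), ← ENNReal.ofReal_mul (abs_nonneg _)]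
    congr 1
    exact sqrt_det_coordGram_change (hc hz.1) (hd hz.1)
  · intro z hz
    have h := hasFDerivWithinAt_tangentCoordChange (I := 𝓡 m) (x := c) (y := d)
      ⟨hc hz.1, hd hz.1⟩
    rw [(extChartAt (𝓡 m) c).right_inv hz.2] at h
    exact h.mono (by simp)
  · intro z hz w hw hzw
    have h := (extChartAt (𝓡 m) d).injOn (hd hz.1) (hd hw.1) hzw
    rw [← (extChartAt (𝓡 m) c).right_inv hz.2, h, (extChartAt (𝓡 m) c).right_inv hw.2]

theorem chartVolume_compl_source (c : M) :
    chartVolume (m := m) c (extChartAt (𝓡 m) c).sourceᶜ = 0 := by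
  rw [chartVolume_apply c (isOpen_extChartAt_source c).measurableSet.compl]
  have : (extChartAt (𝓡 m) c).symm ⁻¹' (extChartAt (𝓡 m) c).sourceᶜ ∩
      (extChartAt (𝓡 m) c).target = ∅ := by
    ext z
    simp only [Set.mem_inter_iff, Set.mem_preimage, Set.mem_compl_iff, Set.mem_empty_iff_false,
      iff_false, not_and]
    exact fun h hz => h ((extChartAt (𝓡 m) c).map_target hz)
  rw [this, setLIntegral_empty]

/-- On the domain of the chart at c every other chart measure is dominated by the one at c, because
they agree on overlaps. The supremum is controlled by exhibiting an upper bound, so no countability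
of the atlas is needed. -/
theorem riemannianVolume_restrict_source (c : M) :
    (riemannianVolume m M).restrict (extChartAt (𝓡 m) c).source = chartVolume (m := m) c := by
  have hU : ∀ c : M, MeasurableSet (extChartAt (𝓡 m) c).source := fun c =>
    (isOpen_extChartAt_source c).measurableSet
  have hcc : (chartVolume (m := m) c).restrict (extChartAt (𝓡 m) c).source =
      chartVolume (m := m) c :=
    Measure.restrict_eq_self_of_ae_mem (by
      rw [ae_iff]; exact chartVolume_compl_source c)
  have hle : ∀ d : M, (chartVolume (m := m) d).restrict (extChartAt (𝓡 m) c).source ≤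
      chartVolume (m := m) c := by
    intro d
    refine Measure.le_iff.2 fun s hs => ?_
    rw [Measure.restrict_apply hs]
    have h1 : chartVolume (m := m) d (s ∩ (extChartAt (𝓡 m) c).source) ≤
        chartVolume (m := m) d (s ∩ (extChartAt (𝓡 m) c).source ∩ (extChartAt (𝓡 m) d).source) := by
      refine (measure_le_inter_add_sdiff _ _ (extChartAt (𝓡 m) d).source).trans ?_
      have : chartVolume (m := m) d ((s ∩ (extChartAt (𝓡 m) c).source) \
          (extChartAt (𝓡 m) d).source) = 0 :=
        measure_mono_null (fun _ h => h.2) (chartVolume_compl_source d)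
      rw [this, add_zero]
    refine h1.trans ?_
    rw [chartVolume_eq_of_subset (d := c) ((hs.inter (hU c)).inter (hU d)) (fun _ h => h.2)
      fun _ h => h.1.2]
    exact measure_mono fun _ h => h.1.1
  apply le_antisymm
  · have hV : riemannianVolume m M ≤ chartVolume (m := m) c +
        (riemannianVolume m M).restrict (extChartAt (𝓡 m) c).sourceᶜ := by
      refine iSup_le fun d => ?_
      rw [← Measure.restrict_add_restrict_compl (μ := chartVolume (m := m) d) (hU c)]
      exact add_le_add (hle d) (Measure.restrict_mono le_rfl (le_iSup _ d))
    refine (Measure.restrict_mono le_rfl hV).trans ?_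
    rw [Measure.restrict_add, hcc, Measure.restrict_restrict (hU c), Set.inter_compl_self,
      Measure.restrict_empty, add_zero]
  · rw [← hcc]
    exact Measure.restrict_mono le_rfl (le_iSup (fun d : M => chartVolume (m := m) d) c)

end CoordinateFields

/-! ### Derivatives of determinants. -/

/-- Jacobi's formula. -/
theorem hasDerivAt_det {n : Type*} [Fintype n] [DecidableEq n] {A : ℝ → Matrix n n ℝ}
    {A' : Matrix n n ℝ} {t : ℝ} (h : ∀ i j, HasDerivAt (fun s => A s i j) (A' i j) t) :
    HasDerivAt (fun s => (A s).det) ((A t).adjugate * A').trace t := by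
  have h1 : HasDerivAt (fun s => (A s).det)
      (∑ σ : Equiv.Perm n, ((Equiv.Perm.sign σ : ℤ) : ℝ) *
        ∑ i, (∏ j ∈ Finset.univ.erase i, A t (σ j) j) • A' (σ i) i) t := by
    simp only [Matrix.det_apply']
    exact HasDerivAt.fun_sum fun σ _ => (HasDerivAt.fun_finsetProd fun i _ => h (σ i) i).const_mul _
  refine h1.congr_deriv ?_
  -- By Cramer's rule the trace is the sum over i of det A with its i-th column replaced by that of
  -- A'.
  have h2 : ((A t).adjugate * A').trace = ∑ i, ((A t).updateCol i (A'.col i)).det := by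
    rw [Matrix.trace]
    refine Finset.sum_congr rfl fun i _ => ?_
    rw [← Matrix.cramer_apply, Matrix.cramer_eq_adjugate_mulVec]
    rfl
  rw [h2]
  simp only [Matrix.det_apply', Finset.mul_sum]
  rw [Finset.sum_comm]
  refine Finset.sum_congr rfl fun i _ => Finset.sum_congr rfl fun σ _ => ?_
  have h3 : ∏ j ∈ Finset.univ.erase i, (A t).updateCol i (A'.col i) (σ j) j =
      ∏ j ∈ Finset.univ.erase i, A t (σ j) j :=
    Finset.prod_congr rfl fun j hj => Matrix.updateCol_ne (Finset.ne_of_mem_erase hj)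
  rw [← Finset.mul_prod_erase Finset.univ (fun j => (A t).updateCol i (A'.col i) (σ j) j)
    (Finset.mem_univ i), h3]
  simp [mul_comm]

/-- The derivative of the determinant of a Gram matrix along a linear flow. -/
theorem trace_adjugate_mul_eq {n : Type*} [Fintype n] [DecidableEq n] (G B : Matrix n n ℝ) :
    (G.adjugate * (B.transpose * G + G * B)).trace = 2 * G.det * B.trace := by
  rw [Matrix.mul_add, Matrix.trace_add, ← Matrix.mul_assoc, Matrix.trace_mul_cycle,
    Matrix.mul_adjugate, ← Matrix.mul_assoc, Matrix.adjugate_mul]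
  simp only [Matrix.smul_mul, Matrix.one_mul, Matrix.trace_smul, Matrix.trace_transpose,
    smul_eq_mul]
  ring

/-! ### Derivatives in coordinates and the logarithmic derivative of the density. -/

section CoordinateDerivatives

variable {m : ℕ} {M : Type*} [TopologicalSpace M] [ChartedSpace (EuclideanSpace ℝ (Fin m)) M]
  [IsManifold (𝓡 m) ∞ M]

variable [RiemannianBundle (fun x : M => TangentSpace (𝓡 m) x)]

/-- The partial derivatives of a function in a chart. -/
theorem exists_hasFDerivAt_comp_chart_symm {c : M} {z : EuclideanSpace ℝ (Fin m)}
    (hz : z ∈ (extChartAt (𝓡 m) c).target) {f : M → ℝ}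
    (hf : MDifferentiableAt (𝓡 m) 𝓘(ℝ) f ((extChartAt (𝓡 m) c).symm z)) :
    ∃ L : EuclideanSpace ℝ (Fin m) →L[ℝ] ℝ,
      HasFDerivAt (fun z => f ((extChartAt (𝓡 m) c).symm z)) L z ∧
      ∀ i, L (EuclideanSpace.single i (1 : ℝ)) =
        mvfderiv (𝓡 m) f ((extChartAt (𝓡 m) c).symm z)
          (coordField c i ((extChartAt (𝓡 m) c).symm z)) := by
  have hs : MDifferentiableAt 𝓘(ℝ, EuclideanSpace ℝ (Fin m)) (𝓡 m)
      (extChartAt (𝓡 m) c).symm z :=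
    ((contMDiffOn_extChartAt_symm (n := ∞) c).contMDiffAt
      ((isOpen_target c).mem_nhds hz)).mdifferentiableAt (by simp)
  refine ⟨_, (hf.hasMFDerivAt.comp z hs.hasMFDerivAt).hasFDerivAt, fun i => ?_⟩
  rw [← mfderiv_single_eq_coordField hz i]
  rfl

/-- Turns a derivative along a coordinate field into a one-variable derivative, as required by
Jacobi's formula for curves of matrices. -/
theorem hasDerivAt_coordCurve {c y : M} (hy : y ∈ (extChartAt (𝓡 m) c).source) {f : M → ℝ}
    (hf : MDifferentiableAt (𝓡 m) 𝓘(ℝ) f y) (i : Fin m) :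
    HasDerivAt (fun t : ℝ => f ((extChartAt (𝓡 m) c).symm
      (extChartAt (𝓡 m) c y + t • EuclideanSpace.single i (1 : ℝ))))
      (mvfderiv (𝓡 m) f y (coordField c i y)) 0 := by
  have hl := (extChartAt (𝓡 m) c).left_inv hy
  obtain ⟨L, hL, hLi⟩ := exists_hasFDerivAt_comp_chart_symm
    ((extChartAt (𝓡 m) c).map_source hy) (f := f) (by rwa [hl])
  have hc : HasDerivAt (fun t : ℝ => extChartAt (𝓡 m) c y + t • EuclideanSpace.single i (1 : ℝ))
      (EuclideanSpace.single i (1 : ℝ)) 0 := by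
    simpa using ((hasDerivAt_id (0 : ℝ)).smul_const
      (EuclideanSpace.single i (1 : ℝ))).const_add (extChartAt (𝓡 m) c y)
  have hL' : HasFDerivAt (fun z => f ((extChartAt (𝓡 m) c).symm z)) L
      (extChartAt (𝓡 m) c y + (0 : ℝ) • EuclideanSpace.single i (1 : ℝ)) := by
    rwa [zero_smul, add_zero]
  refine (hL'.comp_hasDerivAt (0 : ℝ) hc).congr_deriv ?_
  have key : ∀ y' : M, y' = y → mvfderiv (𝓡 m) f y' (coordField c i y') =
      mvfderiv (𝓡 m) f y (coordField c i y) := by rintro y' rfl; rfl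
  rw [hLi, key _ hl]

theorem diffSectionAt_coordField {c y : M} (hy : y ∈ (extChartAt (𝓡 m) c).source) (i : Fin m) :
    DiffSectionAt m (EuclideanSpace ℝ (Fin m)) (coordField c i) y :=
  (((isLocalFrameOn_coordField c).contMDiffOn i).contMDiffAt
    ((isOpen_extChartAt_source c).mem_nhds hy)).mdifferentiableAt (by simp)

theorem mlieBracket_eq_lieBracket {E : Type*} [NormedAddCommGroup E] [NormedSpace ℝ E]
    (X Y : Π z : E, TangentSpace 𝓘(ℝ, E) z) (z : E) :
    VectorField.mlieBracket 𝓘(ℝ, E) X Y z = VectorField.lieBracket ℝ X Y z := by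
  rw [← VectorField.mlieBracketWithin_univ, VectorField.mlieBracketWithin_eq_lieBracketWithin]
  exact congrFun (VectorField.lieBracketWithin_univ (𝕜 := ℝ) (V := X) (W := Y)) z

/-- The inverse chart pulls coordinate fields back to constant fields, whose bracket vanishes.
Brackets commute with pullback, and the derivative of the inverse chart is invertible. -/
theorem mlieBracket_coordField {c y : M} (hy : y ∈ (extChartAt (𝓡 m) c).source) (i j : Fin m) :
    VectorField.mlieBracket (𝓡 m) (coordField c i) (coordField c j) y = 0 := by
  have : IsManifold (𝓡 m) (minSmoothness ℝ 2) M :=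
    IsManifold.of_le (n := ∞) (by simpa using (WithTop.coe_le_coe.2 le_top : ((2 : ℕ∞) : ℕ∞ω) ≤
        ((⊤ : ℕ∞) : ℕ∞ω)))
  set φ := extChartAt (𝓡 m) c with hφ
  have hz := φ.map_source hy
  have hl := φ.left_inv hy
  have hs : ∀ z ∈ φ.target, ContMDiffAt 𝓘(ℝ, EuclideanSpace ℝ (Fin m)) (𝓡 m) ∞ φ.symm z :=
    fun z hz => (contMDiffOn_extChartAt_symm (n := ∞) c).contMDiffAt ((isOpen_target c).mem_nhds hz)
  have hinv : ∀ z ∈ φ.target,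
      (mfderiv 𝓘(ℝ, EuclideanSpace ℝ (Fin m)) (𝓡 m) φ.symm z).IsInvertible := by
    intro z hz
    have := isInvertible_mfderivWithin_extChartAt_symm hz
    rwa [ModelWithCorners.range_eq_univ, mfderivWithin_univ] at this
  have hpull : ∀ a : Fin m, ∀ z ∈ φ.target, VectorField.mpullback 𝓘(ℝ, EuclideanSpace ℝ (Fin m))
      (𝓡 m) φ.symm (coordField c a) z = EuclideanSpace.single a (1 : ℝ) := by
    intro a z hz
    rw [VectorField.mpullback_apply, ← mfderiv_single_eq_coordField hz a]
    exact (hinv z hz).inverse_apply_self _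
  have hd : ∀ a : Fin m, DiffSectionAt m (EuclideanSpace ℝ (Fin m)) (coordField c a)
      (φ.symm (φ y)) := fun a => by
    rw [hl]; exact diffSectionAt_coordField hy a
  have h := VectorField.mpullback_mlieBracket (I := 𝓘(ℝ, EuclideanSpace ℝ (Fin m))) (I' := 𝓡 m)
    (n := ∞) (f := φ.symm) (x₀ := φ y) (V := coordField c i) (W := coordField c j)
    (hd i) (hd j) (hs _ hz) (by simpa using (WithTop.coe_le_coe.2 le_top : ((2 : ℕ∞) : ℕ∞ω) ≤
        ((⊤ : ℕ∞) : ℕ∞ω)))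
  have hev : ∀ a : Fin m, VectorField.mpullback 𝓘(ℝ, EuclideanSpace ℝ (Fin m))
      (𝓡 m) φ.symm (coordField c a) =ᶠ[𝓝 (φ y)] fun _ => EuclideanSpace.single a (1 : ℝ) :=
    fun a => Filter.eventually_of_mem ((isOpen_target c).mem_nhds hz) (hpull a)
  have hconst : VectorField.mlieBracket 𝓘(ℝ, EuclideanSpace ℝ (Fin m))
      (fun z => (EuclideanSpace.single i (1 : ℝ) :
        TangentSpace 𝓘(ℝ, EuclideanSpace ℝ (Fin m)) z))
      (fun z => (EuclideanSpace.single j (1 : ℝ) :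
        TangentSpace 𝓘(ℝ, EuclideanSpace ℝ (Fin m)) z)) (φ y) = 0 := by
    exact (mlieBracket_eq_lieBracket _ _ _).trans (by simp [VectorField.lieBracket]; rfl)
  have h0 := h.trans (((hev i).mlieBracket_vectorField_eq (hev j)).trans hconst)
  rw [VectorField.mpullback_apply] at h0
  have h1 := (hinv _ hz).self_apply_inverse
    (VectorField.mlieBracket (𝓡 m) (coordField c i) (coordField c j) (φ.symm (φ y)))
  rw [h0, map_zero] at h1
  rw [← hl]
  exact h1.symm

variable [IsContMDiffRiemannianBundle (𝓡 m) ∞ (EuclideanSpace ℝ (Fin m))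
      (fun x : M => TangentSpace (𝓡 m) x)]
  [T2Space M]
  {nabla : CovariantDerivative (𝓡 m) (EuclideanSpace ℝ (Fin m))
    (fun x : M => TangentSpace (𝓡 m) x)}

theorem covariantDerivative_coordField_comm (hn : IsLeviCivita nabla) {c y : M}
    (hy : y ∈ (extChartAt (𝓡 m) c).source) (i j : Fin m) :
    nabla (coordField c i) y (coordField c j y) = nabla (coordField c j) y (coordField c i y) := by
  have h := CovariantDerivative.torsion_apply (cov := nabla) (diffSectionAt_coordField hy j)
    (diffSectionAt_coordField hy i)
  rw [hn.torsion_eq_zero, mlieBracket_coordField hy, sub_zero] at h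
  exact sub_eq_zero.1 h.symm

/-- The logarithmic derivative of the density of the Riemannian volume. -/
theorem mvfderiv_chartDensity (hn : IsLeviCivita nabla) {c y : M}
    (hy : y ∈ (extChartAt (𝓡 m) c).source) (k : Fin m) :
    mvfderiv (𝓡 m) (fun y => chartDensity (m := m) c y) y (coordField c k y) =
      chartDensity (m := m) c y * divergence nabla (coordField c k) y := by
  have hfr := isLocalFrameOn_coordField (m := m) c
  set b := hfr.toBasisAt hy with hb
  have hbi : ∀ i, b i = coordField c i y := fun i => by simp [hb]
  -- The matrix of ∇_{∂_k} on the coordinate frame, i.e. the Christoffel symbols with k fixed.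
  set B : Matrix (Fin m) (Fin m) ℝ := fun a i =>
    b.repr (nabla (coordField c i) y (coordField c k y)) a with hB
  have hexp : ∀ i, nabla (coordField c i) y (coordField c k y) =
      ∑ a, B a i • coordField c a y := fun i => by
    simp only [hB, ← hbi]
    exact (b.sum_repr _).symm
  have hl := (extChartAt (𝓡 m) c).left_inv hy
  have hsm : ∀ {f : M → ℝ}, ContMDiffOn (𝓡 m) 𝓘(ℝ) ∞ f (extChartAt (𝓡 m) c).source →
      MDifferentiableAt (𝓡 m) 𝓘(ℝ) f y := fun h =>
    (h.contMDiffAt ((isOpen_extChartAt_source c).mem_nhds hy)).mdifferentiableAt (by simp)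
  have hG : ∀ i j, mvfderiv (𝓡 m) (fun y => coordGram (m := m) c y i j) y (coordField c k y) =
      (B.transpose * coordGram (m := m) c y + coordGram (m := m) c y * B) i j := by
    intro i j
    have h := mvfderiv_inner_eq (F := EuclideanSpace ℝ (Fin m)) hn.isMetricCompatible
      (diffSectionAt_coordField hy i) (diffSectionAt_coordField hy j) (coordField c k y)
    refine h.trans ?_
    rw [hexp i, hexp j]
    simp only [sum_inner, inner_sum, inner_smul_left, inner_smul_right, conj_trivial,
      Matrix.add_apply, Matrix.mul_apply, Matrix.transpose_apply, coordGram, Matrix.gram_apply]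
    congr 1
    exact Finset.sum_congr rfl fun _ _ => mul_comm _ _
  have hdet := hasDerivAt_det (t := 0) (A := fun t => coordGram (m := m) c
    ((extChartAt (𝓡 m) c).symm (extChartAt (𝓡 m) c y + t • EuclideanSpace.single k (1 : ℝ))))
    fun i j => (hasDerivAt_coordCurve hy (hsm (contMDiffOn_coordGram c i j)) k).congr_deriv (hG i j)
  simp only [zero_smul, add_zero, hl, trace_adjugate_mul_eq] at hdet
  have hpos := det_coordGram_pos hy
  have hsq := hdet.sqrt (by rw [zero_smul, add_zero, hl]; exact hpos.ne')
  have hρ := hasDerivAt_coordCurve hy (hsm (contMDiffOn_chartDensity c)) k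
  rw [hρ.unique hsq]
  -- Vanishing torsion gives ∇_{∂_k} ∂_i = ∇_{∂_i} ∂_k, which identifies the trace of B with the
  -- divergence of ∂_k.
  have htr : divergence nabla (coordField c k) y = B.trace := by
    rw [divergence, LinearMap.trace_eq_matrix_trace ℝ b, Matrix.trace, Matrix.trace]
    refine Finset.sum_congr rfl fun i _ => ?_
    rw [Matrix.diag_apply, LinearMap.toMatrix_apply, hbi]
    exact congrArg (fun v => b.repr v i) (covariantDerivative_coordField_comm hn hy i k).symm
  simp only [zero_smul, add_zero, hl, htr, chartDensity]
  have := Real.sq_sqrt hpos.le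
  have h0 := (Real.sqrt_pos.2 hpos).ne'
  field_simp
  rw [this]
  ring

end CoordinateDerivatives

/-! ### Sum rule for connections and vanishing of integrals of derivatives. -/

section SumRule

variable {m : ℕ} {M : Type*} [TopologicalSpace M] [ChartedSpace (EuclideanSpace ℝ (Fin m)) M]
  [IsManifold (𝓡 m) ∞ M]
  {F : Type*} [NormedAddCommGroup F] [NormedSpace ℝ F]
  {V : M → Type*} [TopologicalSpace (TotalSpace F V)]
  [∀ x, NormedAddCommGroup (V x)] [∀ x, InnerProductSpace ℝ (V x)]
  [FiberBundle F V] [VectorBundle ℝ F V] [ContMDiffVectorBundle ∞ F V (𝓡 m)]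

/-- Differentiability is carried through the same induction because additivity of the connection
requires it. -/
theorem covariantDerivative_sum_smul (D : CovariantDerivative (𝓡 m) F V) {ι : Type*}
    (s : Finset ι) {f : ι → M → ℝ} {σ : ι → Π x : M, V x} {x : M}
    (hf : ∀ i, MDifferentiableAt (𝓡 m) 𝓘(ℝ) (f i) x) (hσ : ∀ i, DiffSectionAt m F (σ i) x) :
    D (fun y => ∑ i ∈ s, f i y • σ i y) x =
      ∑ i ∈ s, (f i x • D (σ i) x + (mvfderiv (𝓡 m) (f i) x).smulRight (σ i x)) ∧
      DiffSectionAt m F (fun y => ∑ i ∈ s, f i y • σ i y) x := by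
  classical
  have hd : ∀ i, DiffSectionAt m F (f i • σ i) x := fun i => (hf i).smul_section (hσ i)
  induction s using Finset.induction_on with
  | empty =>
    have hz : (fun y : M => ∑ i ∈ (∅ : Finset ι), f i y • σ i y) = (0 : Π y : M, V y) := by
      funext y; simp
    rw [hz, D.zero]
    refine ⟨by simp, ?_⟩
    exact (Bundle.contMDiff_zeroSection ℝ V (n := ∞)).contMDiffAt.mdifferentiableAt (by simp)
  | insert i s hi ih =>
    have hz : (fun y : M => ∑ i ∈ insert i s, f i y • σ i y) =
        f i • σ i + fun y => ∑ i ∈ s, f i y • σ i y := by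
      funext y; simp [Finset.sum_insert hi]
    rw [hz]
    refine ⟨?_, mdifferentiableAt_add_section (hd i) ih.2⟩
    rw [D.isCovariantDerivativeOn.add (s := Set.univ) (hd i) ih.2,
      D.isCovariantDerivativeOn.leibniz (s := Set.univ) (hσ i) (hf i), ih.1,
      Finset.sum_insert hi]

end SumRule

/-- Integration by parts against the constant function 1; compact support of f provides the
integrability. -/
theorem integral_fderiv_apply_eq_zero {E : Type*} [NormedAddCommGroup E] [NormedSpace ℝ E]
    [FiniteDimensional ℝ E] [MeasurableSpace E] [BorelSpace E] (μ : Measure E)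
    [μ.IsAddHaarMeasure] {f : E → ℝ} (hf : ContDiff ℝ 1 f) (hc : HasCompactSupport f) (v : E) :
    ∫ z, fderiv ℝ f z v ∂μ = 0 := by
  have h1 : Integrable (fun z => fderiv ℝ f z v) μ :=
    ((hf.continuous_fderiv (by simp)).clm_apply continuous_const).integrable_of_hasCompactSupport
      (hc.fderiv_apply ℝ v)
  have h := integral_mul_fderiv_eq_neg_fderiv_mul_of_integrable (μ := μ) (f := fun _ : E => (1 : ℝ))
    (g := f) (v := v) (by simp) (by simpa using h1)
    (by simpa using hf.continuous.integrable_of_hasCompactSupport hc)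
    (fun x _ => by simp) (fun x _ => (hf.differentiable (by simp)).differentiableAt)
  simpa using h

/-! ### The divergence in a chart. -/

section DivergenceTheorem

variable {m : ℕ} {M : Type*} [TopologicalSpace M] [ChartedSpace (EuclideanSpace ℝ (Fin m)) M]
  [IsManifold (𝓡 m) ∞ M] [T2Space M]
  [RiemannianBundle (fun x : M => TangentSpace (𝓡 m) x)]
  [IsContMDiffRiemannianBundle (𝓡 m) ∞ (EuclideanSpace ℝ (Fin m))
      (fun x : M => TangentSpace (𝓡 m) x)]
  {nabla : CovariantDerivative (𝓡 m) (EuclideanSpace ℝ (Fin m))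
    (fun x : M => TangentSpace (𝓡 m) x)}

/-- The components of a vector field in the chart around `c`. -/
def coordCoeff (c : M) (Y : Π x : M, TangentSpace (𝓡 m) x) (k : Fin m) (y : M) : ℝ :=
  (trivializationAt (EuclideanSpace ℝ (Fin m)) (TangentSpace (𝓡 m)) c).localFrameCoeff (𝓡 m)
    (EuclideanSpace.basisFun (Fin m) ℝ).toBasis k y (Y y)

theorem contMDiffOn_coordCoeff {c : M} {Y : Π x : M, TangentSpace (𝓡 m) x}
    (hY : SmoothSection m (EuclideanSpace ℝ (Fin m)) Y) (k : Fin m) :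
    ContMDiffOn (𝓡 m) 𝓘(ℝ) ∞ (coordCoeff c Y k) (extChartAt (𝓡 m) c).source := by
  intro y hy
  exact (contMDiffAt_localFrameCoeff (EuclideanSpace.basisFun (Fin m) ℝ).toBasis
    ((mem_baseSet_iff c y).2 hy) (hY y) k).contMDiffWithinAt

theorem sum_coordCoeff_smul {c y : M} (hy : y ∈ (extChartAt (𝓡 m) c).source)
    (Y : Π x : M, TangentSpace (𝓡 m) x) :
    Y y = ∑ k, coordCoeff c Y k y • coordField c k y :=
  Bundle.Trivialization.eq_sum_localFrameCoeff_smul (I := 𝓡 m) ((mem_baseSet_iff c y).2 hy)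

/-- The expression of the divergence in a chart. -/
theorem chartDensity_mul_divergence (hn : IsLeviCivita nabla) {c y : M}
    (hy : y ∈ (extChartAt (𝓡 m) c).source) {Y : Π x : M, TangentSpace (𝓡 m) x}
    (hY : SmoothSection m (EuclideanSpace ℝ (Fin m)) Y) :
    chartDensity (m := m) c y * divergence nabla Y y =
      ∑ k, mvfderiv (𝓡 m) (fun y => chartDensity (m := m) c y * coordCoeff c Y k y) y
        (coordField c k y) := by
  have hu := (isOpen_extChartAt_source (I := 𝓡 m) c).mem_nhds hy
  have hsm : ∀ {f : M → ℝ}, ContMDiffOn (𝓡 m) 𝓘(ℝ) ∞ f (extChartAt (𝓡 m) c).source →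
      MDifferentiableAt (𝓡 m) 𝓘(ℝ) f y := fun h =>
    (h.contMDiffAt hu).mdifferentiableAt (by simp)
  have hk := fun k => hsm (contMDiffOn_coordCoeff (c := c) hY k)
  have hsum := covariantDerivative_sum_smul nabla Finset.univ hk
    (fun k => diffSectionAt_coordField hy k)
  -- Connections are local, so Y may be replaced by its coordinate expansion, which is valid only
  -- near y.
  have hcong : nabla Y y = nabla (fun y => ∑ k, coordCoeff c Y k y • coordField c k y) y :=
    nabla.isCovariantDerivativeOn.congr_of_eventuallyEq (s := Set.univ)
      ((hY y).mdifferentiableAt (by simp)) hsum.2 Filter.univ_mem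
      (Filter.eventually_of_mem hu fun z hz => sum_coordCoeff_smul hz Y)
  have hdiv : divergence nabla Y y = ∑ k, (coordCoeff c Y k y * divergence nabla (coordField c k) y
      + mvfderiv (𝓡 m) (coordCoeff c Y k) y (coordField c k y)) := by
    rw [divergence, hcong, hsum.1, ContinuousLinearMap.toLinearMap_sum, map_sum]
    refine Finset.sum_congr rfl fun k _ => ?_
    rw [ContinuousLinearMap.toLinearMap_add, map_add, ContinuousLinearMap.toLinearMap_smul,
        map_smul, smul_eq_mul]
    congr 1
    exact LinearMap.trace_smulRight _ _
  rw [hdiv, Finset.mul_sum]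
  refine Finset.sum_congr rfl fun k _ => ?_
  have h := mvfderiv_mul (hsm (contMDiffOn_chartDensity c)) (hk k)
  have h' : mvfderiv (𝓡 m) (fun y => chartDensity (m := m) c y * coordCoeff c Y k y) y
      (coordField c k y) = chartDensity (m := m) c y * mvfderiv (𝓡 m) (coordCoeff c Y k) y
        (coordField c k y) + coordCoeff c Y k y *
        mvfderiv (𝓡 m) (fun y => chartDensity (m := m) c y) y (coordField c k y) := by
    refine (congrArg (fun L => L (coordField c k y)) h).trans ?_
    simp
  rw [h', mvfderiv_chartDensity hn hy k]
  ring

theorem continuous_divergence [CovariantDerivative.ContMDiffCovariantDerivative nabla ∞]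
    {X : Π x : M, TangentSpace (𝓡 m) x}
    (hX : SmoothSection m (EuclideanSpace ℝ (Fin m)) X) :
    Continuous fun x => divergence nabla X x := by
  refine continuous_iff_continuousAt.2 fun x₀ => ?_
  obtain ⟨E, hE, hon⟩ := exists_orthonormalBasis_vectorFields m x₀
  have h : ContMDiff (𝓡 m) 𝓘(ℝ) ∞ fun x => ∑ b, (inner ℝ (E b x) (nabla X x (E b x)) : ℝ) :=
    contMDiff_finsetSum fun b _ => (hE b).inner_bundle (SmoothSection.covariantDerivative hX (hE b))
  refine (h.continuous.continuousAt).congr (hon.mono fun x ⟨e, he⟩ => ?_)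
  change (∑ b, inner ℝ (E b x) (nabla X x (E b x)) : ℝ) = divergence nabla X x
  rw [divergence, LinearMap.trace_eq_sum_inner _ e]
  simp only [he]
  rfl

variable [MeasurableSpace M] [BorelSpace M]

theorem integral_chartVolume (c : M) {g : M → ℝ}
    (hg : AEStronglyMeasurable g (chartVolume (m := m) c)) :
    ∫ x, g x ∂(chartVolume (m := m) c) = ∫ z in (extChartAt (𝓡 m) c).target,
      chartDensity (m := m) c ((extChartAt (𝓡 m) c).symm z) *
        g ((extChartAt (𝓡 m) c).symm z) := by
  have ht := (isOpen_target (m := m) c).measurableSet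
  have hcont : ContinuousOn (fun z => chartDensity (m := m) c ((extChartAt (𝓡 m) c).symm z))
      (extChartAt (𝓡 m) c).target :=
    (contMDiffOn_chartDensity c).continuousOn.comp (continuousOn_extChartAt_symm c)
      (extChartAt (𝓡 m) c).mapsTo_symm
  have heq : Set.EqOn (fun z => Real.sqrt (metricCoeff c z).det)
      (fun z => chartDensity (m := m) c ((extChartAt (𝓡 m) c).symm z))
      (extChartAt (𝓡 m) c).target := fun z hz => by
    simp only [chartDensity, metricCoeff_eq_coordGram hz]
  have hmeas : AEMeasurable (fun z => Real.sqrt (metricCoeff (m := m) c z).det)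
      ((volume : Measure (EuclideanSpace ℝ (Fin m))).restrict (extChartAt (𝓡 m) c).target) :=
    (hcont.congr heq).aemeasurable ht
  rw [chartVolume, integral_map (aemeasurable_symm c) hg,
    integral_withDensity_eq_integral_toReal_smul₀ hmeas.ennreal_ofReal (by simp)]
  refine setIntegral_congr_fun ht fun z hz => ?_
  simp only [smul_eq_mul]
  rw [ENNReal.toReal_ofReal (Real.sqrt_nonneg _)]
  exact congrArg (· * _) (heq hz)

end DivergenceTheorem

/-! ### The divergence theorem. -/

section DivergenceTheorem

variable {m : ℕ} {M : Type*} [TopologicalSpace M] [ChartedSpace (EuclideanSpace ℝ (Fin m)) M]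
  [IsManifold (𝓡 m) ∞ M] [T2Space M]
  [RiemannianBundle (fun x : M => TangentSpace (𝓡 m) x)]
  [IsContMDiffRiemannianBundle (𝓡 m) ∞ (EuclideanSpace ℝ (Fin m))
      (fun x : M => TangentSpace (𝓡 m) x)]
  {nabla : CovariantDerivative (𝓡 m) (EuclideanSpace ℝ (Fin m))
    (fun x : M => TangentSpace (𝓡 m) x)}

theorem image_eq_preimage_inter_target (c : M) {K : Set M} (hK : K ⊆ (extChartAt (𝓡 m) c).source) :
    extChartAt (𝓡 m) c '' K =
      (extChartAt (𝓡 m) c).symm ⁻¹' K ∩ (extChartAt (𝓡 m) c).target := by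
  ext z
  constructor
  · rintro ⟨y, hy, rfl⟩
    exact ⟨by rwa [Set.mem_preimage, (extChartAt (𝓡 m) c).left_inv (hK hy)],
      (extChartAt (𝓡 m) c).map_source (hK hy)⟩
  · rintro ⟨hz, hzt⟩
    exact ⟨_, hz, (extChartAt (𝓡 m) c).right_inv hzt⟩

theorem isCompact_image_extChartAt (c : M) {K : Set M} (hKc : IsCompact K)
    (hK : K ⊆ (extChartAt (𝓡 m) c).source) : IsCompact (extChartAt (𝓡 m) c '' K) :=
  hKc.image_of_continuousOn ((continuousOn_extChartAt c).mono hK)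

/-- A function supported in a compact subset of a chart domain, read in the chart. -/
theorem contDiff_indicator_comp_symm (c : M) {K : Set M} (hKc : IsCompact K)
    (hK : K ⊆ (extChartAt (𝓡 m) c).source) {f : M → ℝ}
    (hf : ContMDiffOn (𝓡 m) 𝓘(ℝ) ∞ f (extChartAt (𝓡 m) c).source) (hf0 : ∀ x ∉ K, f x = 0) :
    ContDiff ℝ ∞ ((extChartAt (𝓡 m) c).target.indicator
      fun z => f ((extChartAt (𝓡 m) c).symm z)) ∧
    HasCompactSupport ((extChartAt (𝓡 m) c).target.indicator
      fun z => f ((extChartAt (𝓡 m) c).symm z)) := by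
  have hcpt := isCompact_image_extChartAt c hKc hK
  have hzero : ∀ z ∉ extChartAt (𝓡 m) c '' K, (extChartAt (𝓡 m) c).target.indicator
      (fun z => f ((extChartAt (𝓡 m) c).symm z)) z = 0 := by
    intro z hz
    by_cases hzt : z ∈ (extChartAt (𝓡 m) c).target
    · rw [Set.indicator_of_mem hzt]
      refine hf0 _ fun h => hz ?_
      rw [image_eq_preimage_inter_target c hK]
      exact ⟨h, hzt⟩
    · exact Set.indicator_of_notMem hzt _
  refine ⟨contDiff_iff_contDiffAt.2 fun z => ?_, HasCompactSupport.intro hcpt hzero⟩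
  -- The target and the complement of the compact image of K are two open sets covering the model
  -- space. The extension is smooth on the first and zero on the second.
  by_cases hzt : z ∈ (extChartAt (𝓡 m) c).target
  · have h1 : ContMDiffOn 𝓘(ℝ, EuclideanSpace ℝ (Fin m)) 𝓘(ℝ) ∞
        (fun z => f ((extChartAt (𝓡 m) c).symm z)) (extChartAt (𝓡 m) c).target :=
      hf.comp (contMDiffOn_extChartAt_symm c) (extChartAt (𝓡 m) c).mapsTo_symm
    have hn := (isOpen_target c).mem_nhds hzt
    refine (h1.contDiffOn.contDiffAt hn).congr_of_eventuallyEq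
      (Filter.eventually_of_mem hn fun w hw => Set.indicator_of_mem hw _)
  · have hn : (extChartAt (𝓡 m) c '' K)ᶜ ∈ 𝓝 z := hcpt.isClosed.isOpen_compl.mem_nhds fun h => by
      rw [image_eq_preimage_inter_target c hK] at h
      exact hzt h.2
    exact (contDiffAt_const (c := (0 : ℝ))).congr_of_eventuallyEq
        (Filter.eventually_of_mem hn hzero)

theorem divergence_eq_zero_of_eventually {Y : Π x : M, TangentSpace (𝓡 m) x}
    (hY : SmoothSection m (EuclideanSpace ℝ (Fin m)) Y) {x : M} (h : ∀ᶠ y in 𝓝 x, Y y = 0) :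
    divergence nabla Y x = 0 := by
  have h0 : nabla Y x = nabla 0 x :=
    nabla.isCovariantDerivativeOn.congr_of_eventuallyEq (s := Set.univ)
      ((hY x).mdifferentiableAt (by simp))
      ((Bundle.contMDiff_zeroSection ℝ _ (n := ∞)).contMDiffAt.mdifferentiableAt (by simp))
      Filter.univ_mem h
  rw [divergence, h0, nabla.zero]
  simp

variable [MeasurableSpace M] [BorelSpace M]
  [CovariantDerivative.ContMDiffCovariantDerivative nabla ∞]

/-- In the chart, density times divergence is the Euclidean divergence of a compactly supported
smooth field, so each partial derivative integrates to zero. -/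
theorem integral_divergence_eq_zero_of_subset_source (hn : IsLeviCivita nabla) (c : M) {K : Set M}
    (hKc : IsCompact K) (hK : K ⊆ (extChartAt (𝓡 m) c).source)
    {Y : Π x : M, TangentSpace (𝓡 m) x} (hY : SmoothSection m (EuclideanSpace ℝ (Fin m)) Y)
    (hY0 : ∀ x ∉ K, Y x = 0) :
    ∫ x, divergence nabla Y x ∂(riemannianVolume m M) = 0 := by
  have hdiv0 : ∀ x ∉ K, divergence nabla Y x = 0 := fun x hx =>
    divergence_eq_zero_of_eventually hY
      (Filter.eventually_of_mem (hKc.isClosed.isOpen_compl.mem_nhds hx) hY0)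
  rw [← setIntegral_eq_integral_of_forall_compl_eq_zero (s := (extChartAt (𝓡 m) c).source)
    fun x hx => hdiv0 x fun h => hx (hK h), riemannianVolume_restrict_source,
    integral_chartVolume c (continuous_divergence hY).aestronglyMeasurable]
  set f : Fin m → M → ℝ := fun k y => chartDensity (m := m) c y * coordCoeff c Y k y with hfdef
  have hf : ∀ k, ContMDiffOn (𝓡 m) 𝓘(ℝ) ∞ (f k) (extChartAt (𝓡 m) c).source := fun k =>
    (contMDiffOn_chartDensity c).mul (contMDiffOn_coordCoeff hY k)
  have hf0 : ∀ k, ∀ x ∉ K, f k x = 0 := fun k x hx => by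
    simp only [hfdef, coordCoeff, hY0 x hx, map_zero, mul_zero]
  set g : Fin m → EuclideanSpace ℝ (Fin m) → ℝ := fun k =>
    (extChartAt (𝓡 m) c).target.indicator fun z => f k ((extChartAt (𝓡 m) c).symm z) with hg
  have hgs := fun k => contDiff_indicator_comp_symm c hKc hK (hf k) (hf0 k)
  have hint : ∀ k, Integrable fun z => fderiv ℝ (g k) z (EuclideanSpace.single k (1 : ℝ)) :=
    fun k => (((hgs k).1.continuous_fderiv (by simp)).clm_apply
      continuous_const).integrable_of_hasCompactSupport ((hgs k).2.fderiv_apply ℝ _)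
  have h1 : ∀ z ∈ (extChartAt (𝓡 m) c).target,
      chartDensity (m := m) c ((extChartAt (𝓡 m) c).symm z) *
        divergence nabla Y ((extChartAt (𝓡 m) c).symm z) =
      ∑ k, fderiv ℝ (g k) z (EuclideanSpace.single k (1 : ℝ)) := by
    intro z hz
    have hzs := (extChartAt (𝓡 m) c).map_target hz
    rw [chartDensity_mul_divergence hn hzs hY]
    refine Finset.sum_congr rfl fun k _ => ?_
    obtain ⟨L, hL, hLi⟩ := exists_hasFDerivAt_comp_chart_symm hz (f := f k)
      (((hf k).contMDiffAt ((isOpen_extChartAt_source c).mem_nhds hzs)).mdifferentiableAt (by simp))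
    rw [← hLi, (hL.congr_of_eventuallyEq (Filter.eventually_of_mem ((isOpen_target c).mem_nhds hz)
      fun w hw => Set.indicator_of_mem hw _)).fderiv]
  rw [setIntegral_congr_fun (isOpen_target c).measurableSet h1,
    setIntegral_eq_integral_of_forall_compl_eq_zero, integral_finsetSum _ fun k _ => hint k]
  · exact Finset.sum_eq_zero fun k _ =>
      integral_fderiv_apply_eq_zero volume ((hgs k).1.of_le (by simp)) (hgs k).2 _
  · intro z hz
    refine Finset.sum_eq_zero fun k _ => ?_
    -- The support lies in the compact image of K, hence inside the target, so the derivative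
    -- vanishes off the target and the integral may be extended to the whole space.
    have hz0 : z ∉ tsupport (g k) := fun h => hz (by
      have hsub : tsupport (g k) ⊆ extChartAt (𝓡 m) c '' K :=
        closure_minimal (fun w hw => by
          rw [image_eq_preimage_inter_target c hK]
          have hwt : w ∈ (extChartAt (𝓡 m) c).target := by
            by_contra hwt
            exact hw (Set.indicator_of_notMem hwt _)
          refine ⟨?_, hwt⟩
          by_contra hwK
          exact hw ((Set.indicator_of_mem hwt _).trans (hf0 k _ hwK)))
          (isCompact_image_extChartAt c hKc hK).isClosed
      have := hsub h
      rw [image_eq_preimage_inter_target c hK] at this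
      exact this.2)
    have h2 := notMem_tsupport_iff_eventuallyEq.1 hz0
    rw [h2.fderiv_eq]
    simp

/-- The divergence theorem on a closed Riemannian manifold. -/
theorem integral_divergence_eq_zero [CompactSpace M] (hn : IsLeviCivita nabla)
    [IsFiniteMeasure (riemannianVolume m M)]
    {X : Π x : M, TangentSpace (𝓡 m) x} (hX : SmoothSection m (EuclideanSpace ℝ (Fin m)) X) :
    ∫ x, divergence nabla X x ∂(riemannianVolume m M) = 0 := by
  obtain ⟨f, hf⟩ := SmoothPartitionOfUnity.exists_isSubordinate_chartAt_source (𝓡 m) M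
  have hfin : {i | (Function.support (f i)).Nonempty}.Finite :=
    f.locallyFinite.finite_nonempty_of_compact
  have hsm : ∀ i, SmoothSection m (EuclideanSpace ℝ (Fin m)) ((f i : M → ℝ) • X) := fun i =>
    (f i).contMDiff.smul_section hX
  have hone : ∀ x, ∑ i ∈ hfin.toFinset, f i x = 1 := fun x => by
    rw [← f.sum_eq_one (Set.mem_univ x)]
    refine (finsum_eq_sum_of_support_subset _ fun i hi => ?_).symm
    simp only [Set.Finite.coe_toFinset, Set.mem_ofPred_eq]
    exact ⟨x, hi⟩
  have hdecomp : ∀ x, divergence nabla X x =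
      ∑ i ∈ hfin.toFinset, divergence nabla ((f i : M → ℝ) • X) x := by
    intro x
    have hXd : DiffSectionAt m (EuclideanSpace ℝ (Fin m)) X x := (hX x).mdifferentiableAt (by simp)
    -- The constant coefficients 1 specialise the sum rule to additivity; the cut-off functions stay
    -- inside the sections.
    have h := (covariantDerivative_sum_smul nabla hfin.toFinset (f := fun _ _ => (1 : ℝ))
      (σ := fun i => (f i : M → ℝ) • X) (x := x) (fun i => mdifferentiableAt_const)
      fun i => (hsm i x).mdifferentiableAt (by simp)).1
    have hXe : (fun y => ∑ i ∈ hfin.toFinset, (1 : ℝ) • ((f i : M → ℝ) • X) y) = X := by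
      funext y
      simp only [one_smul, Pi.smul_apply']
      rw [← Finset.sum_smul, hone, one_smul]
    rw [hXe] at h
    simp only [one_smul, mvfderiv_const] at h
    simp only [divergence]
    rw [h, ContinuousLinearMap.toLinearMap_sum, map_sum]
    refine Finset.sum_congr rfl fun i _ => ?_
    congr 2
    ext w
    simp
  simp only [hdecomp]
  rw [integral_finsetSum]
  · refine Finset.sum_eq_zero fun i _ => integral_divergence_eq_zero_of_subset_source hn i
      (isClosed_tsupport (f i)).isCompact (by rw [extChartAt_source]; exact hf i) (hsm i) ?_
    intro x hx
    rw [Pi.smul_apply', image_eq_zero_of_notMem_tsupport hx, zero_smul]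
  · intro i _
    exact (continuous_divergence (hsm i)).integrable_of_hasCompactSupport
      (HasCompactSupport.of_compactSpace _)

end DivergenceTheorem

/-! ### Finiteness and positivity of the volume. -/

section FiniteMeasure

variable {m : ℕ} {M : Type*} [TopologicalSpace M] [ChartedSpace (EuclideanSpace ℝ (Fin m)) M]
  [IsManifold (𝓡 m) ∞ M] [T2Space M]
  [RiemannianBundle (fun x : M => TangentSpace (𝓡 m) x)]
  [IsContMDiffRiemannianBundle (𝓡 m) ∞ (EuclideanSpace ℝ (Fin m))
      (fun x : M => TangentSpace (𝓡 m) x)]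
  [MeasurableSpace M] [BorelSpace M]

theorem continuousOn_chartDensity_comp_symm (c : M) :
    ContinuousOn (fun z => chartDensity (m := m) c ((extChartAt (𝓡 m) c).symm z))
      (extChartAt (𝓡 m) c).target :=
  (contMDiffOn_chartDensity c).continuousOn.comp (continuousOn_extChartAt_symm c)
    (extChartAt (𝓡 m) c).mapsTo_symm

theorem isFiniteMeasure_riemannianVolume [CompactSpace M] :
    IsFiniteMeasure (riemannianVolume m M) := by
  refine ⟨isCompact_univ.measure_lt_top_of_nhdsWithin fun x _ => ?_⟩
  obtain ⟨K, hKn, hKs, hKc⟩ := local_compact_nhds ((isOpen_extChartAt_source (I := 𝓡 m) x).mem_nhds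
    (mem_extChartAt_source x))
  refine ⟨K, mem_nhdsWithin_of_mem_nhds hKn, ?_⟩
  have hKm := hKc.isClosed.measurableSet
  have h1 : riemannianVolume m M K = chartVolume (m := m) x K := by
    rw [← riemannianVolume_restrict_source, Measure.restrict_apply hKm,
      Set.inter_eq_left.2 hKs]
  rw [h1, chartVolume_apply x hKm, ← image_eq_preimage_inter_target x hKs]
  have h2 : IntegrableOn (fun z => chartDensity (m := m) x ((extChartAt (𝓡 m) x).symm z))
      (extChartAt (𝓡 m) x '' K) volume :=
    ((continuousOn_chartDensity_comp_symm x).mono (by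
      rw [image_eq_preimage_inter_target x hKs]
      exact Set.inter_subset_right)).integrableOn_compact (isCompact_image_extChartAt x hKc hKs)
  exact h2.lintegral_lt_top

/-- The chart density is positive, so an open set around x already has positive measure in the chart
at x. This makes essential bounds on continuous functions pointwise bounds. -/
theorem isOpenPosMeasure_riemannianVolume : (riemannianVolume m M).IsOpenPosMeasure := by
  refine ⟨fun U hU ⟨x, hx⟩ h0 => ?_⟩
  have h1 : chartVolume (m := m) x U = 0 :=
    le_antisymm ((Measure.le_iff'.1 (le_iSup (fun d : M => chartVolume (m := m) d) x) U).trans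
        h0.le)
      bot_le
  rw [chartVolume_apply x hU.measurableSet] at h1
  have hopen : IsOpen ((extChartAt (𝓡 m) x).symm ⁻¹' U ∩ (extChartAt (𝓡 m) x).target) := by
    rw [Set.inter_comm]
    exact (continuousOn_extChartAt_symm x).isOpen_inter_preimage (isOpen_target x) hU
  have hpos := hopen.measure_pos (volume : Measure (EuclideanSpace ℝ (Fin m)))
    ⟨extChartAt (𝓡 m) x x, by simpa using hx, mem_extChartAt_target x⟩
  have hmeas : AEMeasurable (fun z => ENNReal.ofReal
      (chartDensity (m := m) x ((extChartAt (𝓡 m) x).symm z))) (volume.restrict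
        ((extChartAt (𝓡 m) x).symm ⁻¹' U ∩ (extChartAt (𝓡 m) x).target)) :=
    (((continuousOn_chartDensity_comp_symm x).mono Set.inter_subset_right).aemeasurable
      hopen.measurableSet).ennreal_ofReal
  rw [lintegral_eq_zero_iff' hmeas, Filter.EventuallyEq, ae_restrict_iff' hopen.measurableSet] at h1
  refine hpos.ne' (measure_mono_null (fun z hz => ?_) (ae_iff.1 h1))
  simp only [Set.mem_ofPred_eq, Pi.zero_apply, ENNReal.ofReal_eq_zero, not_le, Classical.not_imp]
  exact ⟨hz, chartDensity_pos ((extChartAt (𝓡 m) x).map_target hz.2)⟩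

end FiniteMeasure

/-- Hölder twice: the product ac lies in L^(p/2) by the relation between p, q and r, and |b|^(p-2)
lies in the conjugate space L^(p/(p-2)). The factor ‖b‖_p^(p-2) is then cancelled, which is
legitimate because the norm of b is finite. -/
theorem eLpNorm_sq_le_of_lintegral_le {X : Type*} [MeasurableSpace X] {μ : Measure X}
    {a b c : X → ℝ} (ha : AEStronglyMeasurable a μ) (hb : AEStronglyMeasurable b μ)
    (hc : AEStronglyMeasurable c μ) {p : ℝ} (hp : 2 ≤ p) {q r : ℝ≥0∞}
    (hqr : 2 / ENNReal.ofReal p = q⁻¹ + r⁻¹) (hfin : eLpNorm b (ENNReal.ofReal p) μ ≠ ⊤)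
    {C : ℝ≥0∞}
    (h : ∫⁻ x, ‖b x‖ₑ ^ p ∂μ ≤ C * ∫⁻ x, ‖a x‖ₑ * ‖c x‖ₑ * ‖b x‖ₑ ^ (p - 2) ∂μ) :
    eLpNorm b (ENNReal.ofReal p) μ ^ 2 ≤ C * (eLpNorm a q μ * eLpNorm c r μ) := by
  have hp0 : 0 < p := by linarith
  have hP0 : ENNReal.ofReal p ≠ 0 := by simpa using hp0
  have hPt : ENNReal.ofReal p ≠ ⊤ := ENNReal.ofReal_ne_top
  set N := eLpNorm b (ENNReal.ofReal p) μ with hN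
  have hNp : ∫⁻ x, ‖b x‖ₑ ^ p ∂μ = N ^ p := by
    rw [hN, eLpNorm_eq_lintegral_rpow_enorm_toReal hP0 hPt, ENNReal.toReal_ofReal hp0.le,
      ← ENNReal.rpow_mul, one_div, inv_mul_cancel₀ hp0.ne', ENNReal.rpow_one]
  have ht1 : ENNReal.HolderTriple q r (ENNReal.ofReal p / 2) := ⟨by
    rw [← hqr, ENNReal.inv_div (by simp) (by simp)]⟩
  have hac : eLpNorm (a • c) (ENNReal.ofReal p / 2) μ ≤ eLpNorm a q μ * eLpNorm c r μ :=
    eLpNorm_smul_le_mul_eLpNorm hc ha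
  have key : ∫⁻ x, ‖a x‖ₑ * ‖c x‖ₑ * ‖b x‖ₑ ^ (p - 2) ∂μ ≤
      eLpNorm a q μ * eLpNorm c r μ * N ^ (p - 2) := by
    -- For p = 2 the conjugate exponent p/(p-2) degenerates and the power of b is 1, so a single
    -- Hölder inequality suffices.
    rcases hp.eq_or_lt with rfl | hp2
    · simp only [sub_self, ENNReal.rpow_zero, mul_one]
      refine le_trans (le_of_eq ?_) hac
      have : ENNReal.ofReal 2 / 2 = 1 := by
        rw [ENNReal.ofReal_ofNat]; exact ENNReal.div_self (by simp) (by simp)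
      rw [this, eLpNorm_one_eq_lintegral_enorm]
      simp [enorm_mul]
    · have hs : 0 < p - 2 := by linarith
      set B : X → ℝ := fun x => ‖b x‖ ^ (p - 2) with hB
      have hBm : AEStronglyMeasurable B μ :=
        (hb.norm.aemeasurable.pow_const _).aestronglyMeasurable
      have ht2 : ENNReal.HolderTriple (ENNReal.ofReal p / 2) (ENNReal.ofReal (p / (p - 2))) 1 := ⟨by
        have e1 : ENNReal.ofReal p / 2 = ENNReal.ofReal (p / 2) := by
          rw [ENNReal.ofReal_div_of_pos (by norm_num), ENNReal.ofReal_ofNat]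
        rw [e1, ← ENNReal.ofReal_inv_of_pos (by positivity), ← ENNReal.ofReal_inv_of_pos
          (by positivity), ← ENNReal.ofReal_add (by positivity) (by positivity)]
        rw [inv_one, show (p / 2)⁻¹ + (p / (p - 2))⁻¹ = 1 by field_simp; ring]
        simp⟩
      have hBN : eLpNorm B (ENNReal.ofReal (p / (p - 2))) μ = N ^ (p - 2) := by
        rw [hB, eLpNorm_norm_rpow b hs, ← ENNReal.ofReal_mul (by positivity),
          div_mul_cancel₀ _ hs.ne']
      calc ∫⁻ x, ‖a x‖ₑ * ‖c x‖ₑ * ‖b x‖ₑ ^ (p - 2) ∂μ = eLpNorm ((a • c) • B) 1 μ := by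
            rw [eLpNorm_one_eq_lintegral_enorm]
            refine lintegral_congr fun x => ?_
            have hBx : ‖B x‖ₑ = ‖b x‖ₑ ^ (p - 2) := by
              rw [hB, Real.enorm_rpow_of_nonneg (norm_nonneg _) hs.le, enorm_norm]
            rw [← hBx, ← enorm_mul, ← enorm_mul]
            rfl
        _ ≤ eLpNorm (a • c) (ENNReal.ofReal p / 2) μ *
            eLpNorm B (ENNReal.ofReal (p / (p - 2))) μ :=
          eLpNorm_smul_le_mul_eLpNorm hBm (ha.smul hc)
        _ ≤ _ := by rw [hBN]; gcongr
  rw [hNp] at h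
  by_cases hN0 : N = 0
  · simp [hN0]
  have h2 : N ^ (2 : ℕ) * N ^ (p - 2) ≤ C * (eLpNorm a q μ * eLpNorm c r μ) * N ^ (p - 2) := by
    calc N ^ (2 : ℕ) * N ^ (p - 2) = N ^ p := by
          rw [← ENNReal.rpow_natCast, ← ENNReal.rpow_add _ _ hN0 hfin]
          congr 1
          push_cast
          ring
      _ ≤ _ := h.trans (by rw [mul_assoc]; gcongr)
  exact (ENNReal.mul_le_mul_iff_left (by simp [hN0, hfin])
    (by simp [ENNReal.rpow_eq_top_iff, hN0, hfin])).1 h2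

/-! ### The step inequality for finite exponents. -/

section IntegralEstimate

variable {m : ℕ} {M : Type*} [TopologicalSpace M] [ChartedSpace (EuclideanSpace ℝ (Fin m)) M]
  [IsManifold (𝓡 m) ∞ M] [T2Space M] [CompactSpace M] [MeasurableSpace M] [BorelSpace M]
  [RiemannianBundle (fun x : M => TangentSpace (𝓡 m) x)]
  [IsContMDiffRiemannianBundle (𝓡 m) ∞ (EuclideanSpace ℝ (Fin m))
    (fun x : M => TangentSpace (𝓡 m) x)]
  {nabla : CovariantDerivative (𝓡 m) (EuclideanSpace ℝ (Fin m))
    (fun x : M => TangentSpace (𝓡 m) x)}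
  [CovariantDerivative.ContMDiffCovariantDerivative nabla ∞]
  {F : Type*} [NormedAddCommGroup F] [NormedSpace ℝ F] [FiniteDimensional ℝ F]
  {V : M → Type*} [TopologicalSpace (TotalSpace F V)]
  [∀ x, NormedAddCommGroup (V x)] [∀ x, InnerProductSpace ℝ (V x)]
  [FiberBundle F V] [VectorBundle ℝ F V] [ContMDiffVectorBundle ∞ F V (𝓡 m)]
  [IsContMDiffRiemannianBundle (𝓡 m) ∞ F V]
  {D : CovariantDerivative (𝓡 m) F V}
  [CovariantDerivative.ContMDiffCovariantDerivative D ∞]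
  {k : ℕ}

theorem IsSmoothTensor.continuous_tensorNorm
    {S : Π x : M, (Fin k → TangentSpace (𝓡 m) x) → V x} (hS : IsSmoothTensor F S) :
    Continuous fun x => tensorNorm x (S x) := by
  simp only [tensorNorm_eq_sqrt]
  exact (contMDiff_tensorInner hS hS).continuous.sqrt

/-- The regularised pointwise estimate is integrated, the divergence drops out, and ε tends to 0
from the right. -/
theorem integral_rpow_tensorNorm_le (hn : IsLeviCivita nabla) (hD : D.IsMetricCompatible)
    {S : Π x : M, (Fin k → TangentSpace (𝓡 m) x) → V x} (hS : IsSmoothTensor F S)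
    {α : ℝ} (hα : 0 ≤ α) :
    ∫ x, (tensorNorm x (tensorCovDeriv nabla D S x) ^ 2) ^ α *
        tensorNorm x (tensorCovDeriv nabla D S x) ^ 2 ∂(riemannianVolume m M) ≤
      (Real.sqrt m + 2 * α) * ∫ x, (tensorNorm x (S x) *
        tensorNorm x (tensorCovDeriv nabla D (tensorCovDeriv nabla D S) x) *
        (tensorNorm x (tensorCovDeriv nabla D S x) ^ 2) ^ α) ∂(riemannianVolume m M) := by
  have := isFiniteMeasure_riemannianVolume (m := m) (M := M)
  have hP : IsSmoothTensor F (tensorCovDeriv nabla D S) := hS.tensorCovDeriv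
  have hQ : IsSmoothTensor F (tensorCovDeriv nabla D (tensorCovDeriv nabla D S)) :=
    hP.tensorCovDeriv
  have ca := hS.continuous_tensorNorm
  have cb := hP.continuous_tensorNorm
  have cc := hQ.continuous_tensorNorm
  set a := fun x => tensorNorm x (S x) with ha
  set b := fun x => tensorNorm x (tensorCovDeriv nabla D S x) with hb
  set c := fun x => tensorNorm x (tensorCovDeriv nabla D (tensorCovDeriv nabla D S) x) with hc
  -- The absolute value keeps the base nonnegative for every real ε. As α ≥ 0, the power is
  -- continuous also where the base is zero, so the integrals depend continuously on ε at ε = 0.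
  have hpow : Continuous fun y : ℝ × M => (b y.2 ^ 2 + |y.1|) ^ α :=
    (((cb.comp continuous_snd).pow 2).add continuous_fst.abs).rpow_const fun _ => Or.inr hα
  have hint : ∀ {f : M → ℝ}, Continuous f → Integrable f (riemannianVolume m M) := fun hf =>
    hf.integrable_of_hasCompactSupport (HasCompactSupport.of_compactSpace _)
  have hF : Continuous fun ε : ℝ => ∫ x, (b x ^ 2 + |ε|) ^ α * b x ^ 2 ∂(riemannianVolume m M) := by
    have := continuous_parametric_integral_of_continuous (μ := riemannianVolume m M)
      (f := fun (ε : ℝ) x => (b x ^ 2 + |ε|) ^ α * b x ^ 2)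
      (by exact hpow.mul ((cb.comp continuous_snd).pow 2)) isCompact_univ
    simpa using this
  have hG : Continuous fun ε : ℝ => ∫ x, a x * c x * (b x ^ 2 + |ε|) ^ α
      ∂(riemannianVolume m M) := by
    have := continuous_parametric_integral_of_continuous (μ := riemannianVolume m M)
      (f := fun (ε : ℝ) x => a x * c x * (b x ^ 2 + |ε|) ^ α)
      (by exact ((ca.comp continuous_snd).mul (cc.comp continuous_snd)).mul hpow) isCompact_univ
    simpa using this
  have hle : ∀ ε > 0, ∫ x, (b x ^ 2 + |ε|) ^ α * b x ^ 2 ∂(riemannianVolume m M) ≤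
      (Real.sqrt m + 2 * α) * ∫ x, a x * c x * (b x ^ 2 + |ε|) ^ α ∂(riemannianVolume m M) := by
    intro ε hε
    rw [abs_of_pos hε]
    have hpt := mul_tensorNorm_sq_le_divergence (nabla := nabla) (D := D) hn.isMetricCompatible hD
        hS hα hε
    have hc1 : Continuous fun x => (b x ^ 2 + ε) ^ α :=
      ((cb.pow 2).add continuous_const).rpow_const fun _ => Or.inr hα
    -- Smoothness of the vector field is extracted from the estimate at some point, so the empty
    -- manifold is treated apart.
    by_cases hne : Nonempty M
    · obtain ⟨x₀⟩ := hne
      have hX := (hpt x₀).2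
      have hd := continuous_divergence (nabla := nabla) hX
      refine (integral_mono (hint (hc1.mul (cb.pow 2)))
        ((hint hd).add ((hint ((ca.mul cc).mul hc1)).const_mul _)) fun x => (hpt x).1).trans ?_
      rw [integral_add' (hint hd) ((hint ((ca.mul cc).mul hc1)).const_mul _),
        integral_divergence_eq_zero hn hX, zero_add, integral_const_mul]
      exact le_rfl
    · have := not_nonempty_iff.1 hne
      have h0 : riemannianVolume m M = 0 := Measure.eq_zero_of_isEmpty _
      simp [h0]
  have hlim : ∫ x, (b x ^ 2 + |(0 : ℝ)|) ^ α * b x ^ 2 ∂(riemannianVolume m M) ≤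
      (Real.sqrt m + 2 * α) * ∫ x, a x * c x * (b x ^ 2 + |(0 : ℝ)|) ^ α
        ∂(riemannianVolume m M) :=
    le_of_tendsto_of_tendsto (b := 𝓝[>] (0 : ℝ)) (hF.tendsto 0 |>.mono_left nhdsWithin_le_nhds)
      ((hG.const_mul _).tendsto 0 |>.mono_left nhdsWithin_le_nhds)
      (Filter.eventually_of_mem self_mem_nhdsWithin hle)
  simpa using hlim

/-- Interpolation between consecutive derivatives, for a finite exponent. -/
theorem eLpNorm_tensorCovDeriv_sq_le (hn : IsLeviCivita nabla) (hD : D.IsMetricCompatible)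
    {S : Π x : M, (Fin k → TangentSpace (𝓡 m) x) → V x} (hS : IsSmoothTensor F S)
    {p : ℝ} (hp : 2 ≤ p) {q r : ℝ≥0∞} (hqr : 2 / ENNReal.ofReal p = q⁻¹ + r⁻¹) :
    eLpNorm (fun x => tensorNorm x (tensorCovDeriv nabla D S x)) (ENNReal.ofReal p)
        (riemannianVolume m M) ^ 2 ≤
      ENNReal.ofReal (Real.sqrt m + (p - 2)) *
        (eLpNorm (fun x => tensorNorm x (S x)) q (riemannianVolume m M) *
        eLpNorm (fun x => tensorNorm x (tensorCovDeriv nabla D (tensorCovDeriv nabla D S) x)) r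
          (riemannianVolume m M)) := by
  have := isFiniteMeasure_riemannianVolume (m := m) (M := M)
  have hP : IsSmoothTensor F (tensorCovDeriv nabla D S) := hS.tensorCovDeriv
  have hQ : IsSmoothTensor F (tensorCovDeriv nabla D (tensorCovDeriv nabla D S)) :=
    hP.tensorCovDeriv
  have ca := hS.continuous_tensorNorm
  have cb := hP.continuous_tensorNorm
  have cc := hQ.continuous_tensorNorm
  -- With α = (p-2)/2 the left integrand becomes |DS|^p and √m + 2α becomes √m + (p - 2).
  have hmain := integral_rpow_tensorNorm_le hn hD hS (α := (p - 2) / 2) (by linarith)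
  have a0 : ∀ x, 0 ≤ tensorNorm x (S x) := fun x => tensorNorm_nonneg x _
  have b0 : ∀ x, 0 ≤ tensorNorm x (tensorCovDeriv nabla D S x) := fun x => tensorNorm_nonneg x _
  have c0 : ∀ x, 0 ≤ tensorNorm x (tensorCovDeriv nabla D (tensorCovDeriv nabla D S) x) :=
    fun x => tensorNorm_nonneg x _
  set a := fun x => tensorNorm x (S x) with ha
  set b := fun x => tensorNorm x (tensorCovDeriv nabla D S x) with hb
  set c := fun x => tensorNorm x (tensorCovDeriv nabla D (tensorCovDeriv nabla D S) x) with hc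
  have hint : ∀ {f : M → ℝ}, Continuous f → Integrable f (riemannianVolume m M) := fun hf =>
    hf.integrable_of_hasCompactSupport (HasCompactSupport.of_compactSpace _)
  refine eLpNorm_sq_le_of_lintegral_le ca.aestronglyMeasurable cb.aestronglyMeasurable
    cc.aestronglyMeasurable hp hqr ?_ ?_
  · exact (cb.memLp_of_hasCompactSupport (p := ENNReal.ofReal p) (μ := riemannianVolume m M)
      (HasCompactSupport.of_compactSpace _)).2.ne
  · have hp2 : ∀ x, (b x ^ 2) ^ ((p - 2) / 2) = b x ^ (p - 2) := fun x => by
      rw [← Real.rpow_natCast, ← Real.rpow_mul (b0 x)]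
      congr 1
      push_cast
      ring
    have hp3 : ∀ x, (b x ^ 2) ^ ((p - 2) / 2) * b x ^ 2 = b x ^ p := fun x => by
      rw [hp2, ← Real.rpow_natCast, ← Real.rpow_add_of_nonneg (b0 x) (by linarith) (by positivity)]
      congr 1
      push_cast
      ring
    have hmain' : ∫ x, b x ^ p ∂(riemannianVolume m M) ≤ (Real.sqrt m + (p - 2)) *
        ∫ x, a x * c x * b x ^ (p - 2) ∂(riemannianVolume m M) := by
      have e : 2 * ((p - 2) / 2) = p - 2 := by ring
      have h : ∫ x, (b x ^ 2) ^ ((p - 2) / 2) * b x ^ 2 ∂(riemannianVolume m M) ≤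
          (Real.sqrt m + 2 * ((p - 2) / 2)) * ∫ x, a x * c x * (b x ^ 2) ^ ((p - 2) / 2)
            ∂(riemannianVolume m M) := hmain
      simp only [hp3] at h
      simp only [hp2, e] at h
      exact h
    have i1 : Integrable (fun x => b x ^ p) (riemannianVolume m M) :=
      hint (cb.rpow_const fun _ => Or.inr (by linarith))
    have i2 : Integrable (fun x => a x * c x * b x ^ (p - 2)) (riemannianVolume m M) :=
      hint ((ca.mul cc).mul (cb.rpow_const fun _ => Or.inr (by linarith)))
    have e1 : ∫⁻ x, ‖b x‖ₑ ^ p ∂(riemannianVolume m M) =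
        ENNReal.ofReal (∫ x, b x ^ p ∂(riemannianVolume m M)) := by
      rw [ofReal_integral_eq_lintegral_ofReal i1 (ae_of_all _ fun x => Real.rpow_nonneg (b0 x) _)]
      refine lintegral_congr fun x => ?_
      rw [← Real.enorm_rpow_of_nonneg (b0 x) (by linarith),
        Real.enorm_of_nonneg (Real.rpow_nonneg (b0 x) _)]
    have e2 : ∫⁻ x, ‖a x‖ₑ * ‖c x‖ₑ * ‖b x‖ₑ ^ (p - 2) ∂(riemannianVolume m M) =
        ENNReal.ofReal (∫ x, a x * c x * b x ^ (p - 2) ∂(riemannianVolume m M)) := by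
      have hnn : ∀ x, 0 ≤ a x * c x * b x ^ (p - 2) := fun x =>
        mul_nonneg (mul_nonneg (a0 x) (c0 x)) (Real.rpow_nonneg (b0 x) _)
      rw [ofReal_integral_eq_lintegral_ofReal i2 (ae_of_all _ hnn)]
      refine lintegral_congr fun x => ?_
      rw [← Real.enorm_rpow_of_nonneg (b0 x) (by linarith), ← enorm_mul, ← enorm_mul,
        Real.enorm_of_nonneg (hnn x)]
    rw [e1, e2, ← ENNReal.ofReal_mul (add_nonneg (Real.sqrt_nonneg _) (by linarith))]
    exact ENNReal.ofReal_le_ofReal hmain'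

end IntegralEstimate

/-! ### First-order conditions at a maximum over unit vectors. -/

section LocalExtrema

variable {m : ℕ} {M : Type*} [TopologicalSpace M] [ChartedSpace (EuclideanSpace ℝ (Fin m)) M]
  [IsManifold (𝓡 m) ∞ M]

theorem mvfderiv_eq_zero_of_isLocalMax {f : M → ℝ} {x : M}
    (hf : MDifferentiableAt (𝓡 m) 𝓘(ℝ) f x) (h : IsLocalMax f x) : mvfderiv (𝓡 m) f x = 0 := by
  obtain ⟨L, h1, hL⟩ : ∃ L : EuclideanSpace ℝ (Fin m) →L[ℝ] ℝ,
      HasFDerivWithinAt (writtenInExtChartAt (𝓡 m) 𝓘(ℝ) x f) L (Set.range (𝓡 m))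
        (extChartAt (𝓡 m) x x) ∧ ∀ w : TangentSpace (𝓡 m) x, mvfderiv (𝓡 m) f x w = L w :=
    ⟨_, hf.hasMFDerivAt.2, fun _ => rfl⟩
  rw [ModelWithCorners.range_eq_univ, hasFDerivWithinAt_univ] at h1
  have hc : ContinuousAt (extChartAt (𝓡 m) x).symm (extChartAt (𝓡 m) x x) :=
    continuousAt_extChartAt_symm x
  have h2 : IsLocalMax (writtenInExtChartAt (𝓡 m) 𝓘(ℝ) x f) (extChartAt (𝓡 m) x x) := by
    have h3 : ∀ᶠ z in 𝓝 (extChartAt (𝓡 m) x x), f ((extChartAt (𝓡 m) x).symm z) ≤ f x :=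
      hc.eventually (by rw [extChartAt_to_inv]; exact h)
    filter_upwards [h3] with z hz
    change f ((extChartAt (𝓡 m) x).symm z) ≤
      f ((extChartAt (𝓡 m) x).symm (extChartAt (𝓡 m) x x))
    rw [extChartAt_to_inv]
    exact hz
  ext w
  rw [hL, h2.hasFDerivAt_eq_zero h1]
  rfl

/-- A linear functional composed with the chart. It serves to correct the first-order behaviour of
extensions in one direction. -/
theorem exists_mvfderiv_eq_one {x : M} {w : TangentSpace (𝓡 m) x} (hw : w ≠ 0) :
    ∃ u : M → ℝ, MDifferentiableAt (𝓡 m) 𝓘(ℝ) u x ∧ u x = 0 ∧ mvfderiv (𝓡 m) u x w = 1 := by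
  set φ := extChartAt (𝓡 m) x
  have hφ : MDifferentiableAt (𝓡 m) 𝓘(ℝ, EuclideanSpace ℝ (Fin m)) φ x :=
    mdifferentiableAt_extChartAt (mem_chart_source _ x)
  set v : EuclideanSpace ℝ (Fin m) := mfderiv (𝓡 m) 𝓘(ℝ, EuclideanSpace ℝ (Fin m)) φ x w with hv
  have hv0 : v ≠ 0 := fun h0 => hw (by
    have hinv := isInvertible_mfderiv_extChartAt (I := 𝓡 m) (mem_extChartAt_source x)
    have h1 := hinv.inverse_apply_self w
    rw [← h1]
    refine (congrArg _ h0).trans ?_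
    exact map_zero _)
  set L : EuclideanSpace ℝ (Fin m) →L[ℝ] ℝ := (‖v‖ ^ 2)⁻¹ • innerSL ℝ v with hL
  have hLv : L v = 1 := by
    simp only [hL, smul_apply, innerSL_apply_apply, real_inner_self_eq_norm_sq, smul_eq_mul]
    exact inv_mul_cancel₀ (by positivity)
  have hd : HasMFDerivAt 𝓘(ℝ, EuclideanSpace ℝ (Fin m)) 𝓘(ℝ) (fun z => L z - L (φ x)) (φ x) L :=
    (L.hasFDerivAt.sub_const _).hasMFDerivAt
  have hcomp := hd.comp x hφ.hasMFDerivAt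
  refine ⟨fun y => L (φ y) - L (φ x), hcomp.mdifferentiableAt, sub_self _, ?_⟩
  have h2 : mfderiv (𝓡 m) 𝓘(ℝ) (fun y => L (φ y) - L (φ x)) x = _ := hcomp.mfderiv
  have h3 : mvfderiv (𝓡 m) (fun y => L (φ y) - L (φ x)) x w = L v := by
    simp only [mvfderiv, h2]
    rfl
  rw [h3, hLv]

variable [RiemannianBundle (fun x : M => TangentSpace (𝓡 m) x)]
  [IsContMDiffRiemannianBundle (𝓡 m) ∞ (EuclideanSpace ℝ (Fin m))
    (fun x : M => TangentSpace (𝓡 m) x)] [T2Space M]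
  {F : Type*} [NormedAddCommGroup F] [NormedSpace ℝ F] [FiniteDimensional ℝ F]
  {V : M → Type*} [TopologicalSpace (TotalSpace F V)]
  [∀ x, NormedAddCommGroup (V x)] [∀ x, InnerProductSpace ℝ (V x)]
  [FiberBundle F V] [VectorBundle ℝ F V] [ContMDiffVectorBundle ∞ F V (𝓡 m)]
  [IsContMDiffRiemannianBundle (𝓡 m) ∞ F V]

/-- A unit vector extends to a section of unit length which is parallel to first order in a given
direction. -/
theorem exists_unit_section_parallel {D : CovariantDerivative (𝓡 m) F V}
    (hD : D.IsMetricCompatible) {x : M} {w : TangentSpace (𝓡 m) x} (hw : w ≠ 0) {ξ : V x}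
    (hξ : ‖ξ‖ = 1) :
    ∃ σ : Π x : M, V x, DiffSectionAt m F σ x ∧ σ x = ξ ∧ D σ x w = 0 ∧
      ∀ᶠ y in 𝓝 x, ‖σ y‖ = 1 := by
  obtain ⟨u, hu, hu0, hu1⟩ := exists_mvfderiv_eq_one hw
  set σ₀ : Π x : M, V x := FiberBundle.extend F ξ with hσ₀
  have d₀ : DiffSectionAt m F σ₀ x := FiberBundle.mdifferentiableAt_extend ..
  have e₀ : σ₀ x = ξ := by simp [hσ₀]
  -- Since u vanishes at x and has derivative 1 along w, adding u σ₁ changes the derivative along w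
  -- by σ₁(x), which cancels it, and leaves the value at x unchanged.
  set σ₁ : Π x : M, V x := FiberBundle.extend F (-(D σ₀ x w)) with hσ₁
  have d₁ : DiffSectionAt m F σ₁ x := FiberBundle.mdifferentiableAt_extend ..
  have e₁ : σ₁ x = -(D σ₀ x w) := by simp [hσ₁]
  set τ : Π x : M, V x := σ₀ + u • σ₁ with hτ
  have du : DiffSectionAt m F (u • σ₁) x := hu.smul_section d₁
  have dτ : DiffSectionAt m F τ x := mdifferentiableAt_add_section d₀ du
  have eτ : τ x = ξ := by simp [hτ, e₀, hu0]
  have hDτ : D τ x w = 0 := by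
    rw [hτ, D.isCovariantDerivativeOn.add (s := Set.univ) d₀ du,
      D.isCovariantDerivativeOn.leibniz (s := Set.univ) d₁ hu]
    simp [hu0, hu1, e₁]
  set ρ : M → ℝ := fun y => (inner ℝ (τ y) (τ y) : ℝ) with hρ
  have dρ : MDifferentiableAt (𝓡 m) 𝓘(ℝ) ρ x := dτ.inner_bundle dτ
  have eρ : ρ x = 1 := by simp only [hρ, eτ, real_inner_self_eq_norm_sq, hξ]; norm_num
  -- The squared length is stationary along w, so dividing by the length keeps the section parallel
  -- in that direction.
  have hρw : mvfderiv (𝓡 m) ρ x w = 0 := by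
    rw [hρ, mvfderiv_inner_eq hD dτ dτ, hDτ]; simp
  have hg : HasDerivAt (fun t : ℝ => (Real.sqrt t)⁻¹) (-(1 / (2 * Real.sqrt 1)) / Real.sqrt 1 ^ 2)
      (ρ x) := by
    rw [eρ]
    exact (Real.hasDerivAt_sqrt one_ne_zero).inv (by simp)
  have dn : MDifferentiableAt (𝓡 m) 𝓘(ℝ) (fun y => (Real.sqrt (ρ y))⁻¹) x :=
    (hg.hasFDerivAt.hasMFDerivAt.comp x dρ.hasMFDerivAt).mdifferentiableAt
  have hnw : mvfderiv (𝓡 m) (fun y => (Real.sqrt (ρ y))⁻¹) x w = 0 := by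
    rw [mvfderiv_comp_hasDerivAt hg dρ, hρw, mul_zero]
  refine ⟨(fun y => (Real.sqrt (ρ y))⁻¹) • τ, dn.smul_section dτ, ?_, ?_, ?_⟩
  · simp [Pi.smul_apply', eρ, eτ]
  · rw [D.isCovariantDerivativeOn.leibniz (s := Set.univ) dτ dn]
    simp [hDτ, hnw]
  · have hpos : ∀ᶠ y in 𝓝 x, 0 < ρ y := dρ.continuousAt.eventually (by
      rw [eρ]; exact lt_mem_nhds one_pos)
    filter_upwards [hpos] with y hy
    have hn : Real.sqrt (ρ y) = ‖τ y‖ := by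
      rw [hρ]; simp only [real_inner_self_eq_norm_sq]; exact Real.sqrt_sq (norm_nonneg _)
    rw [Pi.smul_apply', norm_smul, hn, norm_inv, norm_norm, inv_mul_cancel₀]
    rw [← hn]
    exact (Real.sqrt_pos.2 hy).ne'

variable {nabla : CovariantDerivative (𝓡 m) (EuclideanSpace ℝ (Fin m))
    (fun x : M => TangentSpace (𝓡 m) x)}
  [CovariantDerivative.ContMDiffCovariantDerivative nabla ∞]
  {D : CovariantDerivative (𝓡 m) F V}
  [CovariantDerivative.ContMDiffCovariantDerivative D ∞]
  {k : ℕ}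

theorem mvfderiv_inner_tensor_of_parallel (hD : D.IsMetricCompatible)
    {S : Π x : M, (Fin k → TangentSpace (𝓡 m) x) → V x} (hS : IsSmoothTensor F S) {x : M}
    {X : Fin k → Π x : M, TangentSpace (𝓡 m) x}
    (hX : ∀ i, DiffSectionAt m (EuclideanSpace ℝ (Fin m)) (X i) x) {σ : Π x : M, V x}
    (hσ : DiffSectionAt m F σ x) {w : TangentSpace (𝓡 m) x} (hXw : ∀ i, nabla (X i) x w = 0)
    (hσw : D σ x w = 0) :
    mvfderiv (𝓡 m) (fun y => (inner ℝ (S y fun i => X i y) (σ y) : ℝ)) x w =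
      inner ℝ (tensorCovDeriv nabla D S x (Fin.snoc (fun i => X i x) w)) (σ x) := by
  rw [mvfderiv_inner_eq hD (hS.diffSectionAt hX) hσ, hσw, inner_zero_right, add_zero]
  have h := insertLast_tensorCovDeriv (nabla := nabla) (D := D) hS hX w
  have h0 : ∀ i, S x (Function.update (fun a => X a x) i (nabla (X i) x w)) = 0 := fun i => by
    rw [hXw i, ← zero_smul ℝ (0 : TangentSpace (𝓡 m) x), hS.update_smul, zero_smul]
  simp only [h0, Finset.sum_const_zero, sub_zero] at h
  rw [← h]
  rfl

/-- At a maximum over unit vectors of `⟨DS, ξ⟩² + λ⟨S, ξ⟩`, with `λ` large, the first term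
vanishes. -/
theorem inner_eq_zero_of_max (hnabla : nabla.IsMetricCompatible) (hD : D.IsMetricCompatible)
    {S : Π x : M, (Fin k → TangentSpace (𝓡 m) x) → V x} (hS : IsSmoothTensor F S) {lam B : ℝ}
    (hlam : 2 * B < lam) {x : M} {u : Fin (k + 1) → TangentSpace (𝓡 m) x} {ξ : V x}
    (hu : ∀ i, ‖u i‖ = 1) (hξ : ‖ξ‖ = 1)
    (hB : |inner ℝ (tensorCovDeriv nabla D (tensorCovDeriv nabla D S) x
      (Fin.snoc u (u (Fin.last k)))) ξ| ≤ B)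
    (hmax : ∀ (y : M) (v : Fin (k + 1) → TangentSpace (𝓡 m) y) (η : V y), (∀ i, ‖v i‖ = 1) →
      ‖η‖ = 1 → (inner ℝ (tensorCovDeriv nabla D S y v) η : ℝ) ^ 2 +
        lam * inner ℝ (S y fun i => v i.castSucc) η ≤
      (inner ℝ (tensorCovDeriv nabla D S x u) ξ : ℝ) ^ 2 +
        lam * inner ℝ (S x fun i => u i.castSucc) ξ) :
    (inner ℝ (tensorCovDeriv nabla D S x u) ξ : ℝ) = 0 := by
  have hP : IsSmoothTensor F (tensorCovDeriv nabla D S) := hS.tensorCovDeriv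
  set w := u (Fin.last k) with hw
  have hw0 : w ≠ 0 := by
    rw [← norm_ne_zero_iff, hw, hu]; exact one_ne_zero
  choose X hXd hXx hXw hXn using fun i => exists_unit_section_parallel
    (F := EuclideanSpace ℝ (Fin m)) hnabla hw0 (hu i)
  obtain ⟨σ, hσd, hσx, hσw, hσn⟩ := exists_unit_section_parallel hD hw0 hξ
  have hXu : (fun i => X i x) = u := funext hXx
  set f : M → ℝ := fun y => inner ℝ (tensorCovDeriv nabla D S y fun i => X i y) (σ y) with hf
  set g : M → ℝ := fun y => inner ℝ (S y fun i => X i.castSucc y) (σ y) with hg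
  have df : MDifferentiableAt (𝓡 m) 𝓘(ℝ) f x := (hP.diffSectionAt hXd).inner_bundle hσd
  have dg : MDifferentiableAt (𝓡 m) 𝓘(ℝ) g x :=
    (hS.diffSectionAt fun i => hXd i.castSucc).inner_bundle hσd
  have ef : f x = inner ℝ (tensorCovDeriv nabla D S x u) ξ := by
    simp only [hf, hXu, hσx]
  have eg : g x = inner ℝ (S x fun i => u i.castSucc) ξ := by
    simp only [hg, hXx, hσx]
  have hfw : mvfderiv (𝓡 m) f x w = inner ℝ (tensorCovDeriv nabla D
      (tensorCovDeriv nabla D S) x (Fin.snoc u w)) ξ := by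
    rw [hf, mvfderiv_inner_tensor_of_parallel hD hP hXd hσd hXw hσw, hXu, hσx]
  -- The direction w is the vector in the differentiation slot of DS, so the derivative of ⟨S, ξ⟩ is
  -- the very quantity f(x) to be shown to vanish.
  have hgw : mvfderiv (𝓡 m) g x w = inner ℝ (tensorCovDeriv nabla D S x u) ξ := by
    rw [hg, mvfderiv_inner_tensor_of_parallel (nabla := nabla) hD hS (fun i => hXd i.castSucc) hσd
      (fun i => hXw i.castSucc) hσw, hσx]
    congr 2
    simp only [hXx]
    exact Fin.snoc_init_self u
  set q : M → ℝ := fun y => f y ^ 2 + lam * g y with hq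
  have hmaxq : IsLocalMax q x := by
    filter_upwards [eventually_all.2 hXn, hσn] with y hy1 hy2
    simp only [hq, ef, eg]
    exact hmax y (fun i => X i y) (σ y) hy1 hy2
  have h1 : HasDerivAt (fun t : ℝ => t ^ 2) (2 * f x) (f x) := by
    simpa using hasDerivAt_pow 2 (f x)
  have h2 : HasDerivAt (fun t : ℝ => lam * t) lam (g x) := by
    simpa using (hasDerivAt_id (g x)).const_mul lam
  have d1 : MDifferentiableAt (𝓡 m) 𝓘(ℝ) (fun y => f y ^ 2) x :=
    (h1.hasFDerivAt.hasMFDerivAt.comp x df.hasMFDerivAt).mdifferentiableAt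
  have d2 : MDifferentiableAt (𝓡 m) 𝓘(ℝ) (fun y => lam * g y) x :=
    (h2.hasFDerivAt.hasMFDerivAt.comp x dg.hasMFDerivAt).mdifferentiableAt
  have h0 := congrArg (fun L => L w) (mvfderiv_eq_zero_of_isLocalMax (d1.add d2) hmaxq)
  have hsum : mvfderiv (𝓡 m) q x w = 2 * f x * mvfderiv (𝓡 m) f x w +
      lam * mvfderiv (𝓡 m) g x w := by
    rw [hq, mvfderiv_fun_add d1 d2]
    rw [add_apply, mvfderiv_comp_hasDerivAt h1 df, mvfderiv_comp_hasDerivAt h2 dg]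
  have h3 : 2 * f x * mvfderiv (𝓡 m) f x w + lam * mvfderiv (𝓡 m) g x w = 0 :=
    hsum.symm.trans h0
  rw [hfw, hgw, ← ef] at h3
  have h4 := abs_le.1 hB
  rw [← ef]
  -- The first-order condition factors through f(x), and the other factor is positive because λ >
  -- 2B.
  have h5 : f x * (2 * inner ℝ (tensorCovDeriv nabla D (tensorCovDeriv nabla D S) x
      (Fin.snoc u w)) ξ + lam) = 0 := by linarith
  rcases mul_eq_zero.1 h5 with h | h
  · exact h
  · linarith [h4.1]

end LocalExtrema

/-! ### Existence of the maximum and the estimate on unit vectors. -/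

section SupremumEstimate

variable {m : ℕ} {M : Type*} [TopologicalSpace M] [ChartedSpace (EuclideanSpace ℝ (Fin m)) M]
  [IsManifold (𝓡 m) ∞ M] [T2Space M]
  [RiemannianBundle (fun x : M => TangentSpace (𝓡 m) x)]
  [IsContMDiffRiemannianBundle (𝓡 m) ∞ (EuclideanSpace ℝ (Fin m))
    (fun x : M => TangentSpace (𝓡 m) x)]
  {F : Type*} [NormedAddCommGroup F] [NormedSpace ℝ F] [FiniteDimensional ℝ F]
  {V : M → Type*} [TopologicalSpace (TotalSpace F V)]
  [∀ x, NormedAddCommGroup (V x)] [∀ x, InnerProductSpace ℝ (V x)]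
  [FiberBundle F V] [VectorBundle ℝ F V] [ContMDiffVectorBundle ∞ F V (𝓡 m)]
  [IsContMDiffRiemannianBundle (𝓡 m) ∞ F V]
  {k : ℕ}

/-- A tensor evaluated on combinations of smooth fields depends continuously on the point and on
the coefficients. -/
theorem IsSmoothTensor.continuous_inner_apply_sum
    {P : Π x : M, (Fin k → TangentSpace (𝓡 m) x) → V x}
    (hP : IsSmoothTensor F P) {n : ℕ} {E : Fin m → Π x : M, TangentSpace (𝓡 m) x}
    {G : Fin n → Π x : M, V x}
    (hE : ∀ i, SmoothSection m (EuclideanSpace ℝ (Fin m)) (E i))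
    (hG : ∀ i, SmoothSection m F (G i)) :
    Continuous fun z : M × (Fin k → EuclideanSpace ℝ (Fin m)) × EuclideanSpace ℝ (Fin n) =>
      (inner ℝ (P z.1 fun i => ∑ a, z.2.1 i a • E a z.1) (∑ l, z.2.2 l • G l z.1) : ℝ) := by
  have hc : ∀ (r : Fin k → Fin m) (l : Fin n), Continuous fun x : M =>
      (inner ℝ (P x fun i => E (r i) x) (G l x) : ℝ) := fun r l =>
    ((hP.smooth _ fun i => hE (r i)).inner_bundle (hG l)).continuous
  have heq : (fun z : M × (Fin k → EuclideanSpace ℝ (Fin m)) × EuclideanSpace ℝ (Fin n) =>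
      (inner ℝ (P z.1 fun i => ∑ a, z.2.1 i a • E a z.1) (∑ l, z.2.2 l • G l z.1) : ℝ)) =
      fun z => ∑ r : Fin k → Fin m, ∑ l, (∏ i, z.2.1 i (r i)) * (z.2.2 l *
        (inner ℝ (P z.1 fun i => E (r i) z.1) (G l z.1) : ℝ)) := by
    funext z
    rw [hP.apply_sum z.1 (fun i a => z.2.1 i a) (fun a => E a z.1)]
    simp only [sum_inner, inner_sum, inner_smul_left, inner_smul_right, conj_trivial,
      Finset.mul_sum]
    rw [Finset.sum_comm]
    refine Finset.sum_congr rfl fun r _ => Finset.sum_congr rfl fun l _ => ?_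
    ring
  rw [heq]
  refine continuous_finsetSum _ fun r _ => continuous_finsetSum _ fun l _ => ?_
  refine (continuous_finsetProd _ fun i _ => ?_).mul (Continuous.mul ?_
      ((hc r l).comp continuous_fst))
  · exact (EuclideanSpace.proj (𝕜 := ℝ) (r i)).continuous.comp
      ((continuous_apply i).comp (continuous_fst.comp continuous_snd))
  · exact (EuclideanSpace.proj (𝕜 := ℝ) l).continuous.comp (continuous_snd.comp continuous_snd)

theorem OrthonormalBasis.norm_sum_smul {n : ℕ} {W : Type*} [NormedAddCommGroup W]
    [InnerProductSpace ℝ W] (e : OrthonormalBasis (Fin n) ℝ W) (a : EuclideanSpace ℝ (Fin n)) :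
    ‖∑ i, a i • e i‖ = ‖a‖ := by
  rw [e.sum_repr_symm, LinearIsometryEquiv.norm_map]

variable [CompactSpace M]

/-- The expression `⟨P, ξ⟩² + λ⟨S, ξ⟩` attains its maximum over unit vectors. -/
theorem exists_max_inner_sq_add {S : Π x : M, (Fin k → TangentSpace (𝓡 m) x) → V x}
    (hS : IsSmoothTensor F S) {P : Π x : M, (Fin (k + 1) → TangentSpace (𝓡 m) x) → V x}
    (hP : IsSmoothTensor F P) (lam : ℝ) {x₁ : M} {u₁ : Fin (k + 1) → TangentSpace (𝓡 m) x₁}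
    {ξ₁ : V x₁} (hu₁ : ∀ i, ‖u₁ i‖ = 1) (hξ₁ : ‖ξ₁‖ = 1) :
    ∃ (x : M) (u : Fin (k + 1) → TangentSpace (𝓡 m) x) (ξ : V x), (∀ i, ‖u i‖ = 1) ∧ ‖ξ‖ = 1 ∧
      ∀ (y : M) (v : Fin (k + 1) → TangentSpace (𝓡 m) y) (η : V y), (∀ i, ‖v i‖ = 1) →
      ‖η‖ = 1 → (inner ℝ (P y v) η : ℝ) ^ 2 + lam * inner ℝ (S y fun i => v i.castSucc) η ≤
      (inner ℝ (P x u) ξ : ℝ) ^ 2 + lam * inner ℝ (S x fun i => u i.castSucc) ξ := by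
  set ψ : Π x : M, (Fin (k + 1) → TangentSpace (𝓡 m) x) → V x → ℝ := fun x u ξ =>
    (inner ℝ (P x u) ξ : ℝ) ^ 2 + lam * inner ℝ (S x fun i => u i.castSucc) ξ with hψ
  have key : ∃ (x : M) (u : Fin (k + 1) → TangentSpace (𝓡 m) x) (ξ : V x), (∀ i, ‖u i‖ = 1) ∧
      ‖ξ‖ = 1 ∧ ∀ y ∈ (Set.univ : Set M), ∀ (v : Fin (k + 1) → TangentSpace (𝓡 m) y) (η : V y),
        (∀ i, ‖v i‖ = 1) → ‖η‖ = 1 → ψ y v η ≤ ψ x u ξ := by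
    -- Induction over the compact set M avoids topologising the bundle of unit vectors. The property
    -- of a set s is that some admissible triple, not necessarily over s, dominates all triples over
    -- s; for s = M it gives a maximum. The given triple handles the empty set.
    refine isCompact_univ.induction_on ⟨x₁, u₁, ξ₁, hu₁, hξ₁, by simp⟩ ?_ ?_ ?_
    · rintro s t hst ⟨x, u, ξ, hu, hξ, h⟩
      exact ⟨x, u, ξ, hu, hξ, fun y hy => h y (hst hy)⟩
    · rintro s t ⟨x, u, ξ, hu, hξ, h⟩ ⟨x', u', ξ', hu', hξ', h'⟩
      rcases le_total (ψ x u ξ) (ψ x' u' ξ') with hle | hle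
      · refine ⟨x', u', ξ', hu', hξ', fun y hy v η hv hη => ?_⟩
        rcases hy with hy | hy
        · exact (h y hy v η hv hη).trans hle
        · exact h' y hy v η hv hη
      · refine ⟨x, u, ξ, hu, hξ, fun y hy v η hv hη => ?_⟩
        rcases hy with hy | hy
        · exact h y hy v η hv hη
        · exact (h' y hy v η hv hη).trans hle
    · intro x₀ _
      obtain ⟨E, hE, honE⟩ := exists_orthonormalBasis_vectorFields m x₀
      obtain ⟨n, ⟨bF⟩⟩ : ∃ n, Nonempty (Module.Basis (Fin n) ℝ F) := ⟨_, ⟨Module.finBasis ℝ F⟩⟩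
      obtain ⟨G, hG, honG⟩ := exists_orthonormalBasis_sections (m := m) (V := V) bF x₀
      obtain ⟨K, hKn, hKs, hKc⟩ := local_compact_nhds (honE.and honG)
      refine ⟨K, mem_nhdsWithin_of_mem_nhds hKn, ?_⟩
      -- Orthonormal frames identify unit vectors over the compact neighbourhood K with points of a
      -- compact product of spheres.
      set Z : Set (M × (Fin (k + 1) → EuclideanSpace ℝ (Fin m)) × EuclideanSpace ℝ (Fin n)) :=
        K ×ˢ ((Set.univ.pi fun _ => Metric.sphere 0 1) ×ˢ Metric.sphere 0 1) with hZ
      have hZc : IsCompact Z := hKc.prod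
        ((isCompact_univ_pi fun _ => isCompact_sphere 0 1).prod (isCompact_sphere 0 1))
      set Ψ : M × (Fin (k + 1) → EuclideanSpace ℝ (Fin m)) × EuclideanSpace ℝ (Fin n) → ℝ :=
        fun z => ψ z.1 (fun i => ∑ a, z.2.1 i a • E a z.1) (∑ l, z.2.2 l • G l z.1) with hΨ
      have hΨc : Continuous Ψ := by
        have h1 := hP.continuous_inner_apply_sum hE hG
        have h2 := (hS.continuous_inner_apply_sum hE hG).comp
          (f := fun z : M × (Fin (k + 1) → EuclideanSpace ℝ (Fin m)) × EuclideanSpace ℝ (Fin n) =>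
            (z.1, (fun i : Fin k => z.2.1 i.castSucc), z.2.2)) (by fun_prop)
        exact (h1.pow 2).add (h2.const_mul lam)
      have hrep : ∀ y ∈ K, ∀ (v : Fin (k + 1) → TangentSpace (𝓡 m) y) (η : V y),
          (∀ i, ‖v i‖ = 1) → ‖η‖ = 1 → ∃ z ∈ Z, Ψ z = ψ y v η := by
        intro y hy v η hv hη
        obtain ⟨⟨e, he⟩, g, hg⟩ := hKs hy
        refine ⟨(y, fun i => e.repr (v i), g.repr η), ⟨hy, ⟨fun i _ => ?_, ?_⟩⟩, ?_⟩
        · simp [hv]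
        · simp [hη]
        · simp only [hΨ, ← he, ← hg, OrthonormalBasis.sum_repr]
      by_cases hne : Z.Nonempty
      · obtain ⟨z, hz, hzmax⟩ := hZc.exists_isMaxOn hne hΨc.continuousOn
        obtain ⟨⟨e, he⟩, g, hg⟩ := hKs hz.1
        refine ⟨z.1, (fun i => ∑ a, z.2.1 i a • E a z.1), (∑ l, z.2.2 l • G l z.1), fun i => ?_, ?_,
          fun y hy v η hv hη => ?_⟩
        · simp only [← he]
          rw [e.norm_sum_smul]
          simpa using hz.2.1 i (Set.mem_univ i)
        · simp only [← hg]
          rw [g.norm_sum_smul]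
          simpa using hz.2.2
        · obtain ⟨z', hz', h⟩ := hrep y hy v η hv hη
          rw [← h]
          exact hzmax hz'
      · refine ⟨x₁, u₁, ξ₁, hu₁, hξ₁, fun y hy v η hv hη => ?_⟩
        obtain ⟨z', hz', -⟩ := hrep y hy v η hv hη
        exact absurd ⟨z', hz'⟩ hne
  obtain ⟨x, u, ξ, hu, hξ, h⟩ := key
  exact ⟨x, u, ξ, hu, hξ, fun y => h y (Set.mem_univ y)⟩

variable {nabla : CovariantDerivative (𝓡 m) (EuclideanSpace ℝ (Fin m))
    (fun x : M => TangentSpace (𝓡 m) x)}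
  [CovariantDerivative.ContMDiffCovariantDerivative nabla ∞]
  {D : CovariantDerivative (𝓡 m) F V}
  [CovariantDerivative.ContMDiffCovariantDerivative D ∞]

/-- For λ > 2B the squared term vanishes at a maximum, so the maximal value is at most λA.
Comparison gives ⟨DS, ξ⟩² ≤ λA - λ⟨S, ξ⟩ ≤ 2λA at every admissible triple. Letting λ decrease to 2B
yields 4AB. -/
theorem sq_inner_tensorCovDeriv_le (hnabla : nabla.IsMetricCompatible)
    (hD : D.IsMetricCompatible)
    {S : Π x : M, (Fin k → TangentSpace (𝓡 m) x) → V x} (hS : IsSmoothTensor F S) {A B : ℝ}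
    (hA : ∀ (y : M) (v : Fin k → TangentSpace (𝓡 m) y), (∀ i, ‖v i‖ = 1) → ‖S y v‖ ≤ A)
    (hB : ∀ (y : M) (v : Fin (k + 2) → TangentSpace (𝓡 m) y), (∀ i, ‖v i‖ = 1) →
      ‖tensorCovDeriv nabla D (tensorCovDeriv nabla D S) y v‖ ≤ B) {x : M}
    {u : Fin (k + 1) → TangentSpace (𝓡 m) x} {ξ : V x} (hu : ∀ i, ‖u i‖ = 1) (hξ : ‖ξ‖ = 1) :
    (inner ℝ (tensorCovDeriv nabla D S x u) ξ : ℝ) ^ 2 ≤ 4 * A * B := by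
  have hP : IsSmoothTensor F (tensorCovDeriv nabla D S) := hS.tensorCovDeriv
  have hsnoc : ∀ {y : M} {v : Fin (k + 1) → TangentSpace (𝓡 m) y}, (∀ i, ‖v i‖ = 1) →
      ∀ i, ‖(Fin.snoc v (v (Fin.last k)) : Fin (k + 2) → TangentSpace (𝓡 m) y) i‖ = 1 := by
    intro y v hv i
    refine Fin.lastCases ?_ (fun i => ?_) i
    · rw [Fin.snoc_last]; exact hv _
    · rw [Fin.snoc_castSucc]; exact hv i
  have hA0 : 0 ≤ A := (norm_nonneg _).trans (hA x _ fun i => hu i.castSucc)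
  have hB0 : 0 ≤ B := (norm_nonneg _).trans (hB x _ (hsnoc hu))
  have hAi : ∀ (y : M) (v : Fin k → TangentSpace (𝓡 m) y) (η : V y), (∀ i, ‖v i‖ = 1) → ‖η‖ = 1 →
      |(inner ℝ (S y v) η : ℝ)| ≤ A := fun y v η hv hη =>
    (abs_real_inner_le_norm _ _).trans (by rw [hη, mul_one]; exact hA y v hv)
  have hlam : ∀ lam > 2 * B, (inner ℝ (tensorCovDeriv nabla D S x u) ξ : ℝ) ^ 2 ≤
      2 * lam * A := by
    intro lam hl
    obtain ⟨x₀, u₀, ξ₀, hu₀, hξ₀, hmax⟩ := exists_max_inner_sq_add hS hP lam hu hξ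
    have h0 := inner_eq_zero_of_max hnabla hD hS hl hu₀ hξ₀
      ((abs_real_inner_le_norm _ _).trans (by rw [hξ₀, mul_one]; exact hB x₀ _ (hsnoc hu₀))) hmax
    have h1 := hmax x u ξ hu hξ
    rw [h0] at h1
    have h2 := (abs_le.1 (hAi x₀ _ ξ₀ (fun i => hu₀ i.castSucc) hξ₀)).2
    have h3 := (abs_le.1 (hAi x _ ξ (fun i => hu i.castSucc) hξ)).1
    have hl0 : 0 ≤ lam := by linarith
    nlinarith [mul_le_mul_of_nonneg_left h2 hl0, mul_le_mul_of_nonneg_left h3 hl0]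
  have hlim : Tendsto (fun lam : ℝ => 2 * lam * A) (𝓝[>] (2 * B)) (𝓝 (2 * (2 * B) * A)) :=
    (Continuous.tendsto (by fun_prop) _).mono_left nhdsWithin_le_nhds
  have := ge_of_tendsto hlim (Filter.eventually_of_mem self_mem_nhdsWithin hlam)
  linarith

end SupremumEstimate

/-! ### Discrete logarithmic convexity. -/

/-- A finite sequence satisfying `b_{i+1}² ≤ b_i b_{i+2}` is logarithmically convex. -/
theorem le_rpow_mul_rpow_of_sq_le {b : ℕ → ℝ≥0∞} {k : ℕ} (hfin : ∀ i, b i ≠ ⊤)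
    (h : ∀ i, i + 2 ≤ k → b (i + 1) ^ 2 ≤ b i * b (i + 2)) {j : ℕ} (hj : 1 ≤ j) (hjk : j ≤ k) :
    b j ≤ b k ^ ((j : ℝ) / k) * b 0 ^ (1 - (j : ℝ) / k) := by
  -- The case of the indices 0, n, n+1, cleared of fractions. It is proved by raising the hypothesis
  -- to the power n+1, inserting the previous case and cancelling b(n+1)^n.
  have hP : ∀ n, n + 1 ≤ k → b n ^ (n + 1) ≤ b (n + 1) ^ n * b 0 := by
    intro n
    induction n with
    | zero => intro _; simp
    | succ n ih =>
      intro hn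
      by_cases h0 : b (n + 1) = 0
      · simp [h0]
      have h1 := pow_le_pow_left' (h n (by omega)) (n + 1)
      have h2 := ih (by omega)
      have h3 : b (n + 1) ^ (n + 2) * b (n + 1) ^ n ≤
          b (n + 2) ^ (n + 1) * b 0 * b (n + 1) ^ n := by
        calc b (n + 1) ^ (n + 2) * b (n + 1) ^ n = (b (n + 1) ^ 2) ^ (n + 1) := by ring
          _ ≤ (b n * b (n + 2)) ^ (n + 1) := h1
          _ = b n ^ (n + 1) * b (n + 2) ^ (n + 1) := by ring
          _ ≤ b (n + 1) ^ n * b 0 * b (n + 2) ^ (n + 1) := by gcongr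
          _ = _ := by ring
      exact (ENNReal.mul_le_mul_iff_left (pow_ne_zero _ h0) (ENNReal.pow_ne_top (hfin _))).1 h3
  induction k, hjk using Nat.le_induction with
  | base =>
    have hj0 : (j : ℝ) ≠ 0 := by positivity
    simp [div_self hj0]
  | succ k hjk ih =>
    have hk : 0 < (k : ℝ) := by exact_mod_cast (by omega : 0 < k)
    have hjk' : (j : ℝ) ≤ k := by exact_mod_cast hjk
    have ih' := ih (fun i hi => h i (by omega)) fun n hn => hP n (by omega)
    -- Inserting this bound for b k into the interpolation between 0 and k moves the right endpoint
    -- to k + 1.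
    have h1 : b k ≤ b (k + 1) ^ ((k : ℝ) / (k + 1)) * b 0 ^ (1 / ((k : ℝ) + 1)) := by
      have h2 := ENNReal.rpow_le_rpow (z := 1 / ((k : ℝ) + 1)) (hP k le_rfl) (by positivity)
      rw [ENNReal.mul_rpow_of_nonneg _ _ (by positivity), ← ENNReal.rpow_natCast,
        ← ENNReal.rpow_natCast, ← ENNReal.rpow_mul, ← ENNReal.rpow_mul] at h2
      convert h2 using 2
      · push_cast
        rw [mul_one_div_cancel (by positivity), ENNReal.rpow_one]
      · rw [mul_one_div]
    have h2 : 0 ≤ (j : ℝ) / k := by positivity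
    have h3 : (j : ℝ) / k ≤ 1 := (div_le_one hk).2 hjk'
    calc b j ≤ b k ^ ((j : ℝ) / k) * b 0 ^ (1 - (j : ℝ) / k) := ih'
      _ ≤ (b (k + 1) ^ ((k : ℝ) / (k + 1)) * b 0 ^ (1 / ((k : ℝ) + 1))) ^ ((j : ℝ) / k) *
          b 0 ^ (1 - (j : ℝ) / k) := by gcongr
      _ = _ := by
        rw [ENNReal.mul_rpow_of_nonneg _ _ h2, ← ENNReal.rpow_mul, ← ENNReal.rpow_mul, mul_assoc,
          ← ENNReal.rpow_add_of_nonneg _ _ (by positivity) (by linarith)]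
        congr 2
        · push_cast
          field_simp
        · push_cast
          field_simp
          ring

/-- The weights K^(i choose 2) absorb the constant: (i choose 2) + (i+2 choose 2) = 2 (i+1 choose 2)
+ 1, so the weighted sequence is exactly log-convex. Since K ≥ 1, the weight at j may be dropped and
the weight at k need not be raised to the power j/k. -/
theorem le_mul_rpow_mul_rpow_of_sq_le {a : ℕ → ℝ≥0∞} {k : ℕ} {K : ℝ≥0} (hK : 1 ≤ K)
    (hfin : ∀ i, a i ≠ ⊤)
    (h : ∀ i, i + 2 ≤ k → a (i + 1) ^ 2 ≤ K * (a i * a (i + 2))) {j : ℕ} (hj : 1 ≤ j)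
    (hjk : j ≤ k) :
    a j ≤ (K ^ k.choose 2 : ℝ≥0) * a k ^ ((j : ℝ) / k) * a 0 ^ (1 - (j : ℝ) / k) := by
  have hK' : (1 : ℝ≥0∞) ≤ K := by exact_mod_cast hK
  have hk : 0 < (k : ℝ) := by exact_mod_cast (by omega : 0 < k)
  have h2 : 0 ≤ (j : ℝ) / k := by positivity
  have h3 : (j : ℝ) / k ≤ 1 := (div_le_one hk).2 (by exact_mod_cast hjk)
  have hb := le_rpow_mul_rpow_of_sq_le (b := fun i => (K : ℝ≥0∞) ^ i.choose 2 * a i) (k := k)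
    (fun i => ENNReal.mul_ne_top (ENNReal.pow_ne_top ENNReal.coe_ne_top) (hfin i))
    (fun i hi => by
      have e1 : (i + 1).choose 2 = i.choose 2 + i := by
        rw [Nat.choose_succ_succ' i 1]; simp [add_comm]
      have e2 : (i + 2).choose 2 = i.choose 2 + i + (i + 1) := by
        rw [Nat.choose_succ_succ' (i + 1) 1, e1]; simp [add_comm]
      calc ((K : ℝ≥0∞) ^ (i + 1).choose 2 * a (i + 1)) ^ 2 =
            ((K : ℝ≥0∞) ^ (i + 1).choose 2) ^ 2 * a (i + 1) ^ 2 := by ring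
        _ ≤ ((K : ℝ≥0∞) ^ (i + 1).choose 2) ^ 2 * (K * (a i * a (i + 2))) := by
          gcongr; exact h i hi
        _ = _ := by rw [e1, e2]; ring) hj hjk
  calc a j ≤ (K : ℝ≥0∞) ^ j.choose 2 * a j := le_mul_of_one_le_left' (one_le_pow₀ hK')
    _ ≤ _ := hb
    _ ≤ _ := by
      rw [Nat.choose_zero_succ, pow_zero, one_mul, ENNReal.mul_rpow_of_nonneg _ _ h2]
      push_cast
      gcongr
      exact (ENNReal.rpow_le_rpow_of_exponent_le (one_le_pow₀ hK') h3).trans_eq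
        (ENNReal.rpow_one _)

/-! ### The step inequality for the supremum norm. -/

section SupNorm

variable {m : ℕ} {M : Type*} [TopologicalSpace M] [ChartedSpace (EuclideanSpace ℝ (Fin m)) M]
  [IsManifold (𝓡 m) ∞ M] [T2Space M]
  [RiemannianBundle (fun x : M => TangentSpace (𝓡 m) x)]
  [IsContMDiffRiemannianBundle (𝓡 m) ∞ (EuclideanSpace ℝ (Fin m))
    (fun x : M => TangentSpace (𝓡 m) x)]
  {F : Type*} [NormedAddCommGroup F] [NormedSpace ℝ F] [FiniteDimensional ℝ F]
  {V : M → Type*} [TopologicalSpace (TotalSpace F V)]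
  [∀ x, NormedAddCommGroup (V x)] [∀ x, InnerProductSpace ℝ (V x)]
  [FiberBundle F V] [VectorBundle ℝ F V] [ContMDiffVectorBundle ∞ F V (𝓡 m)]
  [IsContMDiffRiemannianBundle (𝓡 m) ∞ F V]
  {k : ℕ}

theorem exists_orthonormalBasis_tangentSpace (x : M) :
    Nonempty (OrthonormalBasis (Fin m) ℝ (TangentSpace (𝓡 m) x)) :=
  (exists_orthonormalBasis_vectorFields m x).choose_spec.2.self_of_nhds.nonempty

theorem IsSmoothTensor.tensorNorm_sq_eq_sum
    {S : Π x : M, (Fin k → TangentSpace (𝓡 m) x) → V x} (hS : IsSmoothTensor F S) (x : M)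
    (e : OrthonormalBasis (Fin m) ℝ (TangentSpace (𝓡 m) x)) :
    tensorNorm x (S x) ^ 2 = ∑ r : Fin k → Fin m, ‖S x fun i => e (r i)‖ ^ 2 := by
  rw [tensorNorm_sq, tensorInner_eq_sum (hS.isMultilinear x) (hS.isMultilinear x) e]
  simp only [real_inner_self_eq_norm_sq]

/-- Expansion in an orthonormal basis gives m^k terms whose coefficients are at most 1 in absolute
value. -/
theorem IsSmoothTensor.norm_apply_le
    {S : Π x : M, (Fin k → TangentSpace (𝓡 m) x) → V x} (hS : IsSmoothTensor F S) {x : M}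
    {v : Fin k → TangentSpace (𝓡 m) x} (hv : ∀ i, ‖v i‖ = 1) :
    ‖S x v‖ ≤ (m : ℝ) ^ k * tensorNorm x (S x) := by
  obtain ⟨e⟩ := exists_orthonormalBasis_tangentSpace (m := m) x
  have hve : v = fun i => ∑ a, (e.repr (v i)) a • e a := by
    funext i; exact (e.sum_repr (v i)).symm
  rw [hve, hS.apply_sum x (fun i a => e.repr (v i) a) e]
  have hle : ∀ r : Fin k → Fin m, ‖(∏ i, e.repr (v i) (r i)) • S x fun i => e (r i)‖ ≤
      tensorNorm x (S x) := by
    intro r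
    rw [norm_smul, norm_prod]
    have h1 : ∏ i, ‖e.repr (v i) (r i)‖ ≤ 1 := Finset.prod_le_one (fun _ _ => norm_nonneg _)
      fun i _ => (PiLp.norm_apply_le _ _).trans (by rw [LinearIsometryEquiv.norm_map, hv])
    have h2 : ‖S x fun i => e (r i)‖ ≤ tensorNorm x (S x) := by
      refine abs_le_of_sq_le_sq' ?_ (tensorNorm_nonneg x _) |>.2
      rw [hS.tensorNorm_sq_eq_sum x e]
      exact Finset.single_le_sum (f := fun r : Fin k → Fin m => ‖S x fun i => e (r i)‖ ^ 2)
        (fun _ _ => sq_nonneg _) (Finset.mem_univ r)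
    calc _ ≤ 1 * tensorNorm x (S x) := mul_le_mul h1 h2 (norm_nonneg _) zero_le_one
      _ = _ := one_mul _
  refine (norm_sum_le_of_le _ fun r _ => hle r).trans_eq ?_
  simp

variable [CompactSpace M]
  {nabla : CovariantDerivative (𝓡 m) (EuclideanSpace ℝ (Fin m))
    (fun x : M => TangentSpace (𝓡 m) x)}
  [CovariantDerivative.ContMDiffCovariantDerivative nabla ∞]
  {D : CovariantDerivative (𝓡 m) F V}
  [CovariantDerivative.ContMDiffCovariantDerivative D ∞]

/-- The unit-vector estimate is applied to each of the m^(k+1) frame components of DS. The factors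
m^k and m^(k+2) come from bounding S and D²S on unit vectors by their tensor norms. -/
theorem tensorNorm_tensorCovDeriv_sq_le (hnabla : nabla.IsMetricCompatible)
    (hD : D.IsMetricCompatible)
    {S : Π x : M, (Fin k → TangentSpace (𝓡 m) x) → V x} (hS : IsSmoothTensor F S) {a b : ℝ}
    (ha : ∀ y, tensorNorm y (S y) ≤ a)
    (hb : ∀ y, tensorNorm y (tensorCovDeriv nabla D (tensorCovDeriv nabla D S) y) ≤ b) (x : M) :
    tensorNorm x (tensorCovDeriv nabla D S x) ^ 2 ≤
      4 * (m : ℝ) ^ (k + 1) * (m : ℝ) ^ k * (m : ℝ) ^ (k + 2) * (a * b) := by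
  have hP : IsSmoothTensor F (tensorCovDeriv nabla D S) := hS.tensorCovDeriv
  have hQ : IsSmoothTensor F (tensorCovDeriv nabla D (tensorCovDeriv nabla D S)) :=
    hP.tensorCovDeriv
  obtain ⟨e⟩ := exists_orthonormalBasis_tangentSpace (m := m) x
  have ha0 : 0 ≤ a := (tensorNorm_nonneg x _).trans (ha x)
  have hb0 : 0 ≤ b := (tensorNorm_nonneg x _).trans (hb x)
  have hle : ∀ r : Fin (k + 1) → Fin m, ‖tensorCovDeriv nabla D S x fun i => e (r i)‖ ^ 2 ≤
      4 * ((m : ℝ) ^ k * a) * ((m : ℝ) ^ (k + 2) * b) := by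
    intro r
    set z := tensorCovDeriv nabla D S x fun i => e (r i) with hz
    by_cases hz0 : z = 0
    · rw [hz0, norm_zero, zero_pow two_ne_zero]
      positivity
    have hn : ‖z‖ ≠ 0 := norm_ne_zero_iff.2 hz0
    -- Choosing ξ as the normalised component z turns the inner product into ‖z‖.
    have h := sq_inner_tensorCovDeriv_le (nabla := nabla) (D := D) hnabla hD hS
      (A := (m : ℝ) ^ k * a) (B := (m : ℝ) ^ (k + 2) * b)
      (fun y v hv => (hS.norm_apply_le hv).trans (by gcongr; exact ha y))
      (fun y v hv => (hQ.norm_apply_le hv).trans (by gcongr; exact hb y))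
      (u := fun i => e (r i)) (ξ := ‖z‖⁻¹ • z) (fun i => e.norm_eq_one _)
      (by rw [norm_smul, norm_inv, norm_norm, inv_mul_cancel₀ hn])
    rw [← hz, inner_smul_right, real_inner_self_eq_norm_sq, sq ‖z‖, inv_mul_cancel_left₀ hn] at h
    exact h
  rw [hP.tensorNorm_sq_eq_sum x e]
  refine (Finset.sum_le_card_nsmul _ _ _ fun r _ => hle r).trans_eq ?_
  simp only [Finset.card_univ, Fintype.card_pi, Fintype.card_fin, Finset.prod_const, nsmul_eq_mul]
  push_cast
  ring

variable [MeasurableSpace M] [BorelSpace M]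

/-- The set where a continuous f exceeds its essential bound is open and null, hence empty. -/
theorem le_toReal_eLpNorm_top {f : M → ℝ} (hf : Continuous f) (x : M) :
    f x ≤ (eLpNorm f ⊤ (riemannianVolume m M)).toReal := by
  have := isFiniteMeasure_riemannianVolume (m := m) (M := M)
  have := isOpenPosMeasure_riemannianVolume (m := m) (M := M)
  have hfin : eLpNorm f ⊤ (riemannianVolume m M) ≠ ⊤ :=
    (hf.memLp_of_hasCompactSupport (p := ⊤) (μ := riemannianVolume m M)
      (HasCompactSupport.of_compactSpace _)).2.ne
  set A := (eLpNorm f ⊤ (riemannianVolume m M)).toReal with hA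
  have hae : ∀ᵐ y ∂(riemannianVolume m M), f y ≤ A := by
    have h := ae_le_eLpNormEssSup (f := f) (μ := riemannianVolume m M)
    rw [← eLpNorm_exponent_top] at h
    filter_upwards [h] with y hy
    have h1 := ENNReal.toReal_mono hfin hy
    rw [toReal_enorm] at h1
    exact (le_abs_self _).trans h1
  have hopen : IsOpen {y | A < f y} := isOpen_lt continuous_const hf
  have h0 : riemannianVolume m M {y | A < f y} = 0 := by
    rw [ae_iff] at hae
    simpa using hae
  have hempty := (hopen.measure_eq_zero_iff _).1 h0
  by_contra hx
  exact (Set.eq_empty_iff_forall_notMem.1 hempty x) (not_le.1 hx)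

/-- Interpolation between consecutive derivatives, for the supremum norm. -/
theorem eLpNorm_top_tensorCovDeriv_sq_le (hnabla : nabla.IsMetricCompatible)
    (hD : D.IsMetricCompatible)
    {S : Π x : M, (Fin k → TangentSpace (𝓡 m) x) → V x} (hS : IsSmoothTensor F S) :
    eLpNorm (fun x => tensorNorm x (tensorCovDeriv nabla D S x)) ⊤ (riemannianVolume m M) ^ 2 ≤
      ENNReal.ofReal (4 * (m : ℝ) ^ (k + 1) * (m : ℝ) ^ k * (m : ℝ) ^ (k + 2)) *
        (eLpNorm (fun x => tensorNorm x (S x)) ⊤ (riemannianVolume m M) *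
        eLpNorm (fun x => tensorNorm x (tensorCovDeriv nabla D (tensorCovDeriv nabla D S) x)) ⊤
          (riemannianVolume m M)) := by
  have := isFiniteMeasure_riemannianVolume (m := m) (M := M)
  have hP : IsSmoothTensor F (tensorCovDeriv nabla D S) := hS.tensorCovDeriv
  have hQ : IsSmoothTensor F (tensorCovDeriv nabla D (tensorCovDeriv nabla D S)) :=
    hP.tensorCovDeriv
  have hfin : ∀ {f : M → ℝ}, Continuous f → eLpNorm f ⊤ (riemannianVolume m M) ≠ ⊤ := fun hf =>
    (hf.memLp_of_hasCompactSupport (p := ⊤) (μ := riemannianVolume m M)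
      (HasCompactSupport.of_compactSpace _)).2.ne
  have fa := hfin hS.continuous_tensorNorm
  have fc := hfin hQ.continuous_tensorNorm
  set a := eLpNorm (fun x => tensorNorm x (S x)) ⊤ (riemannianVolume m M) with ha
  set c := eLpNorm (fun x => tensorNorm x (tensorCovDeriv nabla D (tensorCovDeriv nabla D S) x)) ⊤
    (riemannianVolume m M) with hc
  set K : ℝ := 4 * (m : ℝ) ^ (k + 1) * (m : ℝ) ^ k * (m : ℝ) ^ (k + 2) with hK
  have hK0 : 0 ≤ K := by positivity
  have hpt := fun x => tensorNorm_tensorCovDeriv_sq_le (nabla := nabla) (D := D) hnabla hD hS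
    (a := a.toReal) (b := c.toReal) (fun y => le_toReal_eLpNorm_top hS.continuous_tensorNorm y)
    (fun y => le_toReal_eLpNorm_top hQ.continuous_tensorNorm y) x
  have hb : eLpNorm (fun x => tensorNorm x (tensorCovDeriv nabla D S x)) ⊤
      (riemannianVolume m M) ≤ ENNReal.ofReal (Real.sqrt (K * (a.toReal * c.toReal))) := by
    rw [eLpNorm_exponent_top]
    refine eLpNormEssSup_le_of_ae_bound (ae_of_all _ fun x => ?_)
    rw [Real.norm_of_nonneg (tensorNorm_nonneg x _)]
    exact Real.le_sqrt_of_sq_le (hpt x)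
  calc _ ≤ ENNReal.ofReal (Real.sqrt (K * (a.toReal * c.toReal))) ^ 2 := by gcongr
    _ = ENNReal.ofReal (K * (a.toReal * c.toReal)) := by
      rw [← ENNReal.ofReal_pow (Real.sqrt_nonneg _), Real.sq_sqrt (by positivity)]
    _ = _ := by
      rw [ENNReal.ofReal_mul hK0, ENNReal.ofReal_mul ENNReal.toReal_nonneg,
        ENNReal.ofReal_toReal fa, ENNReal.ofReal_toReal fc]

end SupNorm

/-- The constant of the interpolation inequality for the covariant derivative of an `n`-tensor in
`L^p`. -/
def stepConst (m n : ℕ) (p : ℝ≥0∞) : ℝ≥0 :=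
  if p = ⊤ then Real.toNNReal (4 * (m : ℝ) ^ (n + 1) * (m : ℝ) ^ n * (m : ℝ) ^ (n + 2))
  else Real.toNNReal (Real.sqrt m + (p.toReal - 2))

/-! ### Interpolation along progressions of exponents. -/

section Interpolation

variable {m : ℕ} {M : Type*} [TopologicalSpace M] [ChartedSpace (EuclideanSpace ℝ (Fin m)) M]
  [IsManifold (𝓡 m) ∞ M] [T2Space M] [CompactSpace M] [MeasurableSpace M] [BorelSpace M]
  [RiemannianBundle (fun x : M => TangentSpace (𝓡 m) x)]
  [IsContMDiffRiemannianBundle (𝓡 m) ∞ (EuclideanSpace ℝ (Fin m))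
    (fun x : M => TangentSpace (𝓡 m) x)]
  {nabla : CovariantDerivative (𝓡 m) (EuclideanSpace ℝ (Fin m))
    (fun x : M => TangentSpace (𝓡 m) x)}
  [CovariantDerivative.ContMDiffCovariantDerivative nabla ∞]
  {F : Type*} [NormedAddCommGroup F] [NormedSpace ℝ F] [FiniteDimensional ℝ F]
  {V : M → Type*} [TopologicalSpace (TotalSpace F V)]
  [∀ x, NormedAddCommGroup (V x)] [∀ x, InnerProductSpace ℝ (V x)]
  [FiberBundle F V] [VectorBundle ℝ F V] [ContMDiffVectorBundle ∞ F V (𝓡 m)]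
  [IsContMDiffRiemannianBundle (𝓡 m) ∞ F V]
  {D : CovariantDerivative (𝓡 m) F V}
  [CovariantDerivative.ContMDiffCovariantDerivative D ∞]
  {T : Π x : M, V x}

theorem covDerivLpNorm_ne_top
    (hT : ContMDiff (𝓡 m) ((𝓡 m).prod 𝓘(ℝ, F)) ∞ fun x => TotalSpace.mk' F x (T x))
    (i : ℕ) (p : ℝ≥0∞) : covDerivLpNorm nabla D T i p ≠ ⊤ := by
  have := isFiniteMeasure_riemannianVolume (m := m) (M := M)
  have hS : IsSmoothTensor F (iterCovDeriv nabla D T i) := isSmoothTensor_iterCovDeriv hT i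
  exact (hS.continuous_tensorNorm.memLp_of_hasCompactSupport (p := p)
    (μ := riemannianVolume m M) (HasCompactSupport.of_compactSpace _)).2.ne

/-- Unites the two step inequalities. For p = ∞ the relation between the exponents forces q = r = ∞.
-/
theorem covDerivLpNorm_sq_le (hn : IsLeviCivita nabla) (hD : D.IsMetricCompatible)
    (hT : ContMDiff (𝓡 m) ((𝓡 m).prod 𝓘(ℝ, F)) ∞ fun x => TotalSpace.mk' F x (T x))
    (i : ℕ) {p q r : ℝ≥0∞} (hp : 2 ≤ p) (hpqr : 2 / p = q⁻¹ + r⁻¹) :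
    covDerivLpNorm nabla D T (i + 1) p ^ 2 ≤
      stepConst m i p * (covDerivLpNorm nabla D T i q * covDerivLpNorm nabla D T (i + 2) r) := by
  have hS : IsSmoothTensor F (iterCovDeriv nabla D T i) := isSmoothTensor_iterCovDeriv hT i
  by_cases hptop : p = ⊤
  · subst hptop
    rw [ENNReal.div_top] at hpqr
    obtain ⟨hq, hr⟩ := add_eq_zero.1 hpqr.symm
    rw [ENNReal.inv_eq_zero] at hq hr
    subst hq hr
    rw [stepConst, if_pos rfl]
    exact eLpNorm_top_tensorCovDeriv_sq_le hn.isMetricCompatible hD hS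
  · have hp' : ENNReal.ofReal p.toReal = p := ENNReal.ofReal_toReal hptop
    rw [stepConst, if_neg hptop]
    have h := eLpNorm_tensorCovDeriv_sq_le hn hD hS (p := p.toReal)
      (by simpa using ENNReal.toReal_mono hptop hp) (q := q) (r := r) (by rw [hp', hpqr])
    rw [hp'] at h
    exact h

/-- Interpolation along a sequence of exponents whose inverses form an arithmetic progression. -/
theorem covDerivLpNorm_le_of_exponents (hn : IsLeviCivita nabla) (hD : D.IsMetricCompatible)
    (hT : ContMDiff (𝓡 m) ((𝓡 m).prod 𝓘(ℝ, F)) ∞ fun x => TotalSpace.mk' F x (T x))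
    {j k : ℕ} (hj : 1 ≤ j) (hjk : j ≤ k) {p : ℕ → ℝ≥0∞} {K : ℝ≥0} (hK : 1 ≤ K)
    (hp : ∀ i, i + 2 ≤ k → 2 ≤ p (i + 1) ∧ 2 / p (i + 1) = (p i)⁻¹ + (p (i + 2))⁻¹ ∧
      stepConst m i (p (i + 1)) ≤ K) :
    covDerivLpNorm nabla D T j (p j) ≤ (K ^ k.choose 2 : ℝ≥0) *
      covDerivLpNorm nabla D T k (p k) ^ ((j : ℝ) / k) *
      covDerivLpNorm nabla D T 0 (p 0) ^ (1 - (j : ℝ) / k) :=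
  le_mul_rpow_mul_rpow_of_sq_le (a := fun i => covDerivLpNorm nabla D T i (p i)) hK
    (fun i => covDerivLpNorm_ne_top hT i _)
    (fun i hi => (covDerivLpNorm_sq_le hn hD hT i (hp i hi).1 (hp i hi).2.1).trans
      (by gcongr; exact (hp i hi).2.2)) hj hjk

/-- The exponents are p_i = 2s/(l - j + i), equal to ∞ at i = 0 when l = j. The requirement p ≥ 2
concerns only the interior indices 1, …, k-1, so the exponent at i = k may be smaller than 2. -/
theorem covDerivLpNorm_le_of_scaling (hn : IsLeviCivita nabla) (hD : D.IsMetricCompatible)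
    (hT : ContMDiff (𝓡 m) ((𝓡 m).prod 𝓘(ℝ, F)) ∞ fun x => TotalSpace.mk' F x (T x))
    {j k : ℕ} (hj : 1 ≤ j) (hjk : j ≤ k) {s : ℝ} (hs : 0 < s) {l : ℕ} (hjl : j ≤ l)
    (hl : (l : ℝ) ≤ s + j + 1 - k) :
    covDerivLpNorm nabla D T j (ENNReal.ofReal (2 * s) / (l : ℝ≥0∞)) ≤
      (Real.toNNReal (1 + Real.sqrt m + 2 * s) ^ k.choose 2 : ℝ≥0)
        * covDerivLpNorm nabla D T k
            (ENNReal.ofReal (2 * s) / ((l + k - j : ℕ) : ℝ≥0∞)) ^ ((j : ℝ) / k)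
        * covDerivLpNorm nabla D T 0
            (ENNReal.ofReal (2 * s) / ((l - j : ℕ) : ℝ≥0∞)) ^ (1 - (j : ℝ) / k) := by
  have hs0 : ENNReal.ofReal (2 * s) ≠ 0 := by simpa using hs
  have h := covDerivLpNorm_le_of_exponents hn hD hT hj hjk
    (p := fun i => ENNReal.ofReal (2 * s) / ((l + i - j : ℕ) : ℝ≥0∞))
    (K := Real.toNNReal (1 + Real.sqrt m + 2 * s))
    (by
      rw [Real.one_le_toNNReal]
      have := Real.sqrt_nonneg (m : ℝ)
      linarith)
    (fun i hi => by
      obtain ⟨d, rfl⟩ := Nat.exists_eq_add_of_le hjl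
      have e0 : j + d + i - j = d + i := by omega
      have e1 : j + d + (i + 1) - j = d + i + 1 := by omega
      have e2 : j + d + (i + 2) - j = d + i + 2 := by omega
      simp only [e0, e1, e2]
      -- The upper bound on l says exactly that the largest interior denominator, l - j + k - 1, is
      -- at most s; hence interior exponents are at least 2.
      have hd : ((d + i + 1 : ℕ) : ℝ) ≤ s := by
        have : ((i : ℝ) + 2) ≤ k := by exact_mod_cast hi
        push_cast at hl ⊢
        linarith
      have hpos : (1 : ℝ) ≤ ((d + i + 1 : ℕ) : ℝ) := by exact_mod_cast (by omega)
      have hreal : ENNReal.ofReal (2 * s) / ((d + i + 1 : ℕ) : ℝ≥0∞) =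
          ENNReal.ofReal (2 * s / ((d + i + 1 : ℕ) : ℝ)) := by
        rw [ENNReal.ofReal_div_of_pos (by linarith), ENNReal.ofReal_natCast]
      refine ⟨?_, ?_, ?_⟩
      · rw [hreal, ← ENNReal.ofReal_ofNat, ENNReal.ofReal_le_ofReal_iff (by positivity),
          le_div_iff₀ (by linarith)]
        linarith
      · rw [ENNReal.inv_div (Or.inr ENNReal.ofReal_ne_top) (Or.inr hs0),
          ENNReal.inv_div (Or.inr ENNReal.ofReal_ne_top) (Or.inr hs0), ← ENNReal.add_div,
          div_eq_mul_inv, ENNReal.inv_div (Or.inr ENNReal.ofReal_ne_top) (Or.inr hs0),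
          ← mul_div_assoc]
        congr 1
        push_cast
        ring
      · rw [hreal, stepConst, if_neg ENNReal.ofReal_ne_top, ENNReal.toReal_ofReal (by positivity)]
        refine Real.toNNReal_le_toNNReal ?_
        -- Interior denominators are at least 1, so the step constants have a bound independent of
        -- l.
        have : 2 * s / ((d + i + 1 : ℕ) : ℝ) ≤ 2 * s := div_le_self (by linarith) hpos
        linarith)
  simpa only [Nat.add_sub_cancel, Nat.add_zero] using h

/-- The inverse exponents interpolate linearly between 1/q at i = 0 and 1/r at i = k, so each is at
most 1/2. The constant is 1 plus a sum of step constants, which dominates each step constant needed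
and is at least 1. -/
theorem covDerivLpNorm_le_of_endpoints (hn : IsLeviCivita nabla) (hD : D.IsMetricCompatible)
    (hT : ContMDiff (𝓡 m) ((𝓡 m).prod 𝓘(ℝ, F)) ∞ fun x => TotalSpace.mk' F x (T x))
    {j k : ℕ} (hj : 1 ≤ j) (hjk : j ≤ k) {r q : ℝ≥0∞} (hr : 2 ≤ r) (hq : 2 ≤ q) {p : ℝ≥0∞}
    (hp : (k : ℝ≥0∞) / p = (j : ℝ≥0∞) / r + ((k - j : ℕ) : ℝ≥0∞) / q) :
    covDerivLpNorm nabla D T j p ≤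
      ((1 + ∑ i ∈ Finset.range k, stepConst m i ((k : ℝ≥0∞) /
          (((i + 1 : ℕ) : ℝ≥0∞) / r + ((k - (i + 1) : ℕ) : ℝ≥0∞) / q))) ^ k.choose 2 : ℝ≥0)
        * covDerivLpNorm nabla D T k r ^ ((j : ℝ) / k)
        * covDerivLpNorm nabla D T 0 q ^ (1 - (j : ℝ) / k) := by
  have hk0 : (k : ℝ≥0∞) ≠ 0 := by exact_mod_cast (by omega : k ≠ 0)
  have hkt : (k : ℝ≥0∞) ≠ ⊤ := ENNReal.natCast_ne_top k
  set P : ℕ → ℝ≥0∞ := fun i => (k : ℝ≥0∞) / ((i : ℝ≥0∞) / r + ((k - i : ℕ) : ℝ≥0∞) / q) with hP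
  have hinv : ∀ i, (P i)⁻¹ = ((i : ℝ≥0∞) / r + ((k - i : ℕ) : ℝ≥0∞) / q) / k := fun i =>
    ENNReal.inv_div (Or.inr hkt) (Or.inr hk0)
  have h2 : ∀ i, i ≤ k → 2 ≤ P i := by
    intro i hi
    rw [← ENNReal.inv_le_inv, hinv, ENNReal.div_le_iff hk0 hkt]
    calc (i : ℝ≥0∞) / r + ((k - i : ℕ) : ℝ≥0∞) / q
        ≤ (i : ℝ≥0∞) / 2 + ((k - i : ℕ) : ℝ≥0∞) / 2 := by gcongr
      _ = 2⁻¹ * k := by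
        rw [← ENNReal.add_div, ← Nat.cast_add, Nat.add_sub_cancel' hi, div_eq_mul_inv, mul_comm]
  have hPj : P j = p := by
    rw [hP]
    simp only
    rw [← hp, ← inv_inj, ENNReal.inv_div (Or.inr hkt) (Or.inr hk0), div_eq_mul_inv, div_eq_mul_inv,
      mul_right_comm, ENNReal.mul_inv_cancel hk0 hkt, one_mul]
  have hPk : P k = r := by
    rw [← inv_inj, hinv, Nat.sub_self, Nat.cast_zero, ENNReal.zero_div, add_zero, div_eq_mul_inv,
      div_eq_mul_inv, mul_right_comm, ENNReal.mul_inv_cancel hk0 hkt, one_mul]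
  have hP0 : P 0 = q := by
    rw [← inv_inj, hinv, Nat.sub_zero, Nat.cast_zero, ENNReal.zero_div, zero_add, div_eq_mul_inv,
      div_eq_mul_inv, mul_right_comm, ENNReal.mul_inv_cancel hk0 hkt, one_mul]
  have h := covDerivLpNorm_le_of_exponents hn hD hT hj hjk (p := P)
    (K := 1 + ∑ i ∈ Finset.range k, stepConst m i (P (i + 1))) le_self_add
    (fun i hi => by
      refine ⟨h2 _ (by omega), ?_, ?_⟩
      · obtain ⟨d, rfl⟩ := Nat.exists_eq_add_of_le hi
        rw [div_eq_mul_inv, hinv, hinv, hinv, ← ENNReal.add_div, ← mul_div_assoc]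
        congr 1
        have e0 : i + 2 + d - i = d + 2 := by omega
        have e1 : i + 2 + d - (i + 1) = d + 1 := by omega
        have e2 : i + 2 + d - (i + 2) = d := by omega
        rw [e0, e1, e2]
        simp only [div_eq_mul_inv]
        push_cast
        ring
      · exact (Finset.single_le_sum (f := fun i => stepConst m i (P (i + 1)))
          (fun _ _ => zero_le) (Finset.mem_range.2 (by omega))).trans le_add_self)
  rw [hPj, hPk, hP0] at h
  exact h

end Interpolation

end

theorem theorem2p4 :
    ∃ (C₁ : (m : ℕ) → (s : ℝ) → (k j : ℕ) → ℝ≥0)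
      (C₂ : (m : ℕ) → (r q : ℝ≥0∞) → (j k : ℕ) → ℝ≥0),
    ∀ (m : ℕ)
      -- a closed smooth Riemannian manifold `M` of dimension `m`
      (M : Type*) [TopologicalSpace M] [T2Space M] [CompactSpace M]
      [MeasurableSpace M] [BorelSpace M]
      [ChartedSpace (EuclideanSpace ℝ (Fin m)) M] [IsManifold (𝓡 m) ∞ M]
      [RiemannianBundle (fun x : M => TangentSpace (𝓡 m) x)]
      [IsContMDiffRiemannianBundle (𝓡 m) ∞ (EuclideanSpace ℝ (Fin m))
        (fun x : M => TangentSpace (𝓡 m) x)]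
      -- its Levi-Civita connection
      (nabla : CovariantDerivative (𝓡 m) (EuclideanSpace ℝ (Fin m))
        (fun x : M => TangentSpace (𝓡 m) x))
      [CovariantDerivative.ContMDiffCovariantDerivative nabla ∞] (_ : IsLeviCivita nabla)
      -- a smooth real vector bundle `V` of finite rank over `M`, with a smooth bundle metric
      (F : Type*) [NormedAddCommGroup F] [NormedSpace ℝ F] [FiniteDimensional ℝ F]
      (V : M → Type*) [TopologicalSpace (TotalSpace F V)]
      [∀ x, NormedAddCommGroup (V x)] [∀ x, InnerProductSpace ℝ (V x)]
      [FiberBundle F V] [VectorBundle ℝ F V] [ContMDiffVectorBundle ∞ F V (𝓡 m)]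
      [IsContMDiffRiemannianBundle (𝓡 m) ∞ F V]
      -- a smooth connection on `V` for which the bundle metric is parallel
      (D : CovariantDerivative (𝓡 m) F V)
      [CovariantDerivative.ContMDiffCovariantDerivative D ∞] (_ : D.IsMetricCompatible)
      -- a smooth section of `V`
      (T : Π x : M, V x)
      (_ : ContMDiff (𝓡 m) ((𝓡 m).prod 𝓘(ℝ, F)) ∞ fun x => TotalSpace.mk' F x (T x))
      (j k : ℕ) (_ : 1 ≤ j) (_ : j ≤ k),
      (∀ (s : ℝ) (_ : 0 < s) (l : ℕ) (_ : 1 ≤ l) (_ : (l : ℝ) ≤ s) (_ : j ≤ l)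
        (_ : (l : ℝ) ≤ s + j + 1 - k),
        covDerivLpNorm nabla D T j (ENNReal.ofReal (2 * s) / (l : ℝ≥0∞)) ≤
          C₁ m s k j
            * covDerivLpNorm nabla D T k
                (ENNReal.ofReal (2 * s) / ((l + k - j : ℕ) : ℝ≥0∞)) ^ ((j : ℝ) / k)
            * covDerivLpNorm nabla D T 0
                (ENNReal.ofReal (2 * s) / ((l - j : ℕ) : ℝ≥0∞)) ^ (1 - (j : ℝ) / k)) ∧
      (∀ (r q : ℝ≥0∞) (_ : 2 ≤ r) (_ : 2 ≤ q) (p : ℝ≥0∞)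
        (_ : (k : ℝ≥0∞) / p = (j : ℝ≥0∞) / r + ((k - j : ℕ) : ℝ≥0∞) / q),
        covDerivLpNorm nabla D T j p ≤
          C₂ m r q j k
            * covDerivLpNorm nabla D T k r ^ ((j : ℝ) / k)
            * covDerivLpNorm nabla D T 0 q ^ (1 - (j : ℝ) / k)) := by
  refine ⟨fun m s k _ => Real.toNNReal (1 + Real.sqrt m + 2 * s) ^ k.choose 2,
    fun m r q _ k => (1 + ∑ i ∈ Finset.range k, stepConst m i ((k : ℝ≥0∞) /
      (((i + 1 : ℕ) : ℝ≥0∞) / r + ((k - (i + 1) : ℕ) : ℝ≥0∞) / q))) ^ k.choose 2, ?_⟩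
  intro m M _ _ _ _ _ _ _ _ _ nabla _ hn F _ _ _ V _ _ _ _ _ _ _ D _ hD T hT j k hj hjk
  exact ⟨fun s hs l _ _ hjl hl => covDerivLpNorm_le_of_scaling hn hD hT hj hjk hs hjl hl,
    fun r q hr hq p hp => covDerivLpNorm_le_of_endpoints hn hD hT hj hjk hr hq hp⟩
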